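/- Let $U,V\subset\mathbb R$ be nonempty open intervals and $\Omega=\{(u,v)\in U\times V:\ u\neq v\}$. Consider on $\Omega$ the Chaplygin/Born–Infeld system $$u_t=v\,u_x,\qquad v_t=u\,v_x .\tag{1}$$ For smooth nowhere vanishing functions $f$ on $U$ and $\varphi$ on $V$ put $$w^1=\tfrac12\big[(u-v)f'(u)-f(u)-\varphi(v)\big],\qquad w^2=\tfrac12\big[(v-u)\varphi'(v)-f(u)-\varphi(v)\big],$$ $$J_{f,\varphi}=(u-v)^2\begin{pmatrix}f(u)&0\\0&\varphi(v)\end{pmatrix}\frac{d}{dx}+(u-v)\begin{pmatrix}\frac12(u-v)f'(u)u_x+f(u)(u_x-v_x)&\varphi(v)u_x+f(u)v_x\\-\varphi(v)u_x-f(u)v_x&\frac12(u-v)\varphi'(v)v_x+\varphi(v)(u_x-v_x)\end{pmatrix}$$ $$\qquad+\begin{pmatrix}w^1u_x&u_x\\w^2v_x&v_x\end{pmatrix}\Big(\frac d{dx}\Big)^{-1}\begin{pmatrix}u_x&v_x\\w^1u_x&w^2v_x\end{pmatrix}.$$ Acting on smooth compactly supported covector fields, $(d/dx)^{-1}$ is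 the skew-symmetric antiderivative with kernel $\frac12\operatorname{sgn}(x-y)$. An operator $J$ is called Hamiltonian if for all smooth fields $x\mapsto(u(x),v(x))\in\Omega$ it maps smooth compactly supported covector fields linearly to smooth vector fields, is skew-symmetric, and the bracket $\{A,B\}=\int\frac{\delta A}{\delta u^i}J^{ij}\frac{\delta B}{\delta u^j}\,dx$ satisfies the Jacobi identity $\{\{A,B\},C\}+\{\{B,C\},A\}+\{\{C,A\},B\}=0$ for all linear functionals $A=\int a_i(x)u^i(x)\,dx$, etc., with $a,b,c$ smooth and compactly supported. It is local if $(Ja)(x)$ vanishes whenever $a$ vanishes near $x$. Then: 1. For all such $f,\varphi$: (a) the local part of $J_{f,\varphi}$ has the form $g^{ij}\frac d{dx}-g^{is}\Gamma^j_{sk}u^k_x$, where $\Gamma$ is the Levi-Civita connection of the metric $(u-v)^{-2}\big(\frac{du^2}{f(u)}+\frac{dv^2}{\varphi(v)}\big)$; (b) $J_{f,\varphi}$ is a Hamiltonian operator; (c) $u_\tau=w^1u_x,\ v_\tau=w^2v_x$ commutes with (1); (d) system (1) is Hamiltonian, $(u,v)^T_t=J_{f,\varphi}(\partial\tilde h/\partial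 u,\partial\tilde h/\partial v)^T$, with density $$\tilde h=\frac1{4(v-u)}\Big(\Big[\int^u\frac{d\nu}{\sqrt{f(\nu)}}\Big]^2-\Big[\int^v\frac{d\nu}{\sqrt{\varphi(\nu)}}\Big]^2\Big),$$ for any choice of the antiderivatives. Here, if $f<0$, $[\int d\nu/\sqrt f]^2$ stands for $-[\int d\nu/\sqrt{|f|}]^2$ (likewise for $\varphi$), and, in this equation, each $(d/dx)^{-1}$ is a formal antiderivative: for a suitable choice of constants, a function of $(u,v)$ whose total $x$-derivative is the given expression along every smooth field in $\Omega$; (e) $J_{f,\varphi}$ is local if and only if $w^1=w^2=0$ on $\Omega$. 2. All these operators are mutually compatible: every linear combination $c_1J_{f_1,\varphi_1}+c_2J_{f_2,\varphi_2}$ with real $c_1,c_2$ is Hamiltonian. 3. Different pairs $(f,\varphi)$ define different operators, and infinitely many of the operators are nonlocal. 4. The flows in 1(c) are the general commuting flow of (1): if $U\cap V=\emptyset$, every system $u^i_\tau=W^i_j(u,v)\,u^j_x$ ($i=1,2$, $(u^1,u^2)=(u,v)$) with smooth $W$ on $\Omega$ that commutes with (1) is of the form $u_\tau=w^1u_x,\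 v_\tau=w^2v_x$ for some smooth functions $f$ on $U$ and $\varphi$ on $V$ (zeros allowed). -/

import Mathlib

open scoped ContDiff Matrix Topology

noncomputable section

/-! ## Fields, test covectors, flows of hydrodynamic type -/

/-- A smooth field `x ↦ u(x)` with values in the domain `Ω` of the space of dependent variables. -/
def IsSmoothField {n : ℕ} (Ω : Set (Fin n → ℝ)) (u : ℝ → Fin n → ℝ) : Prop :=
  ContDiff ℝ ∞ u ∧ ∀ x, u x ∈ Ω

/-- A smooth compactly supported covector field `x ↦ a(x)`, i.e. the differential of the linear
functional `u ↦ ∫ aᵢ(x) uⁱ(x) dx`. -/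
def IsTestCovector {n : ℕ} (a : ℝ → Fin n → ℝ) : Prop :=
  ContDiff ℝ ∞ a ∧ HasCompactSupport a

/-- The right-hand side `u ↦ V(u) uₓ` of the system of hydrodynamic type `uₜ = V(u) uₓ`. -/
def hydroFlow {n : ℕ} (V : (Fin n → ℝ) → Matrix (Fin n) (Fin n) ℝ)
    (u : ℝ → Fin n → ℝ) (x : ℝ) : Fin n → ℝ :=
  V (u x) *ᵥ deriv u x

/-- The systems `uₜ = V(u) uₓ` and `u_τ = W(u) uₓ` commute on `Ω`: the commutator of the two
evolutionary vector fields vanishes, that is, the derivative of either right-hand side in the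
direction of the other one is the same. -/
def FlowsCommute {n : ℕ} (Ω : Set (Fin n → ℝ))
    (V W : (Fin n → ℝ) → Matrix (Fin n) (Fin n) ℝ) : Prop :=
  ∀ u, IsSmoothField Ω u → ∀ x, ∃ d : Fin n → ℝ,
    HasDerivAt (fun s : ℝ => hydroFlow V (u + s • hydroFlow W u) x) d 0 ∧
    HasDerivAt (fun s : ℝ => hydroFlow W (u + s • hydroFlow V u) x) d 0

/-! ## Hamiltonian operators -/

/-- A (field dependent, possibly nonlocal) operator `a ↦ J_u a` from covector fields to
vector fields. -/
abbrev FieldOperator (n : ℕ) : Type :=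
  (ℝ → Fin n → ℝ) → (ℝ → Fin n → ℝ) → ℝ → Fin n → ℝ

/-- The bracket `∫ aᵢ J^{ij} bⱼ dx` of the linear functionals with differentials `a` and `b`, as a
functional of the field `u`. -/
def linBracket {n : ℕ} (J : FieldOperator n) (a b : ℝ → Fin n → ℝ) (u : ℝ → Fin n → ℝ) : ℝ :=
  ∫ x, a x ⬝ᵥ J u b x

/-- `J` is a Hamiltonian operator on fields with values in `Ω`: it is a linear operator which is
skew-symmetric, and the bracket `{A, B} = ∫ (δA/δuⁱ) J^{ij} (δB/δuʲ) dx` satisfies the Jacobi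
identity. Both conditions are tested on linear functionals: since the functional `{A, B}` has the
derivative `{{A, B}, C}` in the direction `J_u c`, Jacobi's identity is
`∑_cyc D({A, B})_u [J_u c] = 0`. -/
structure IsHamiltonianOperator {n : ℕ} (Ω : Set (Fin n → ℝ)) (J : FieldOperator n) : Prop where
  smooth : ∀ u a, IsSmoothField Ω u → IsTestCovector a → ContDiff ℝ ∞ (J u a)
  map_add : ∀ u a b, IsSmoothField Ω u → IsTestCovector a → IsTestCovector b →
    J u (a + b) = J u a + J u b
  map_smul : ∀ u a, ∀ r : ℝ, IsSmoothField Ω u → IsTestCovector a → J u (r • a) = r • J u a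
  skew : ∀ u a b, IsSmoothField Ω u → IsTestCovector a → IsTestCovector b →
    linBracket J a b u = - linBracket J b a u
  jacobi : ∀ u a b c, IsSmoothField Ω u → IsTestCovector a → IsTestCovector b → IsTestCovector c →
    ∃ d₁ d₂ d₃ : ℝ,
      HasDerivAt (fun s : ℝ => linBracket J a b (u + s • J u c)) d₁ 0 ∧
      HasDerivAt (fun s : ℝ => linBracket J b c (u + s • J u a)) d₂ 0 ∧
      HasDerivAt (fun s : ℝ => linBracket J c a (u + s • J u b)) d₃ 0 ∧
      d₁ + d₂ + d₃ = 0

/-- Two Hamiltonian operators are compatible if all their linear combinations are Hamiltonian. -/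
def Compatible {n : ℕ} (Ω : Set (Fin n → ℝ)) (J₁ J₂ : FieldOperator n) : Prop :=
  ∀ c₁ c₂ : ℝ, IsHamiltonianOperator Ω (c₁ • J₁ + c₂ • J₂)

/-- Two operators coincide on all fields with values in `Ω`. -/
def SameOperatorOn {n : ℕ} (Ω : Set (Fin n → ℝ)) (J₁ J₂ : FieldOperator n) : Prop :=
  ∀ u a, IsSmoothField Ω u → IsTestCovector a → J₁ u a = J₂ u a

/-- The operator is local: `(J_u a)(x)` depends only on the germ of `a` at `x`. -/
def IsLocalOperator {n : ℕ} (Ω : Set (Fin n → ℝ)) (J : FieldOperator n) : Prop :=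
  ∀ u a x, IsSmoothField Ω u → IsTestCovector a → a =ᶠ[𝓝 x] 0 → J u a x = 0

/-! ## Nonlocal operators of hydrodynamic type -/

/-- The skew-symmetric inverse of `d/dx`, with kernel `½ sgn(x - y)`. -/
def invD (p : ℝ → ℝ) (x : ℝ) : ℝ :=
  (1 / 2) * ((∫ y in Set.Iic x, p y) - ∫ y in Set.Ioi x, p y)

/-- The data of an operator
`J = lead(u) d/dx + coef(u, uₓ) + left(u, uₓ) (d/dx)⁻¹ right(u, uₓ)`
in `n` dependent variables, with a nonlocal tail of `m` terms. -/
structure HydroOperator (n m : ℕ) where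
  lead : (Fin n → ℝ) → Matrix (Fin n) (Fin n) ℝ
  coef : (Fin n → ℝ) → (Fin n → ℝ) → Matrix (Fin n) (Fin n) ℝ
  left : (Fin n → ℝ) → (Fin n → ℝ) → Matrix (Fin n) (Fin m) ℝ
  right : (Fin n → ℝ) → (Fin n → ℝ) → Matrix (Fin m) (Fin n) ℝ

/-- The action on covector fields. -/
def HydroOperator.toFieldOperator {n m : ℕ} (J : HydroOperator n m) : FieldOperator n :=
  fun u a x =>
    J.lead (u x) *ᵥ deriv a x + J.coef (u x) (deriv u x) *ᵥ a x +
      J.left (u x) (deriv u x) *ᵥ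
        fun k => invD (fun y => (J.right (u y) (deriv u y) *ᵥ a y) k) x

/-- The partial derivative `∂f/∂uⁱ`. -/
def pderiv {n : ℕ} (i : Fin n) (f : (Fin n → ℝ) → ℝ) (p : Fin n → ℝ) : ℝ :=
  fderiv ℝ f p (Pi.single i 1)

/-- The covector `(∂h/∂u¹, …, ∂h/∂uⁿ)`. -/
def grad {n : ℕ} (h : (Fin n → ℝ) → ℝ) (p : Fin n → ℝ) : Fin n → ℝ :=
  fun i => pderiv i h p

/-- On `Ω` the system `uₜ = V(u) uₓ` is Hamiltonian, `uₜ = J (∂h/∂u)`, with the operator `J` and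
the density `h(u)`. In `J (∂h/∂u)` each expression `(d/dx)⁻¹ (right(u, uₓ) ∂h/∂u)ₖ` is a formal
antiderivative: a function `Q k` of the dependent variables whose total `x`-derivative is
`(right(u, uₓ) ∂h/∂u)ₖ` along every field. -/
def IsHamiltonianSystem {n m : ℕ} (Ω : Set (Fin n → ℝ)) (J : HydroOperator n m)
    (h : (Fin n → ℝ) → ℝ) (V : (Fin n → ℝ) → Matrix (Fin n) (Fin n) ℝ) : Prop :=
  ContDiffOn ℝ ∞ h Ω ∧
  ∃ Q : Fin m → (Fin n → ℝ) → ℝ, ∀ u, IsSmoothField Ω u → ∀ x,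
    (∀ k, HasDerivAt (fun y => Q k (u y))
      ((J.right (u x) (deriv u x) *ᵥ grad h (u x)) k) x) ∧
    hydroFlow V u x =
      J.lead (u x) *ᵥ deriv (fun y => grad h (u y)) x +
        J.coef (u x) (deriv u x) *ᵥ grad h (u x) +
        J.left (u x) (deriv u x) *ᵥ fun k => Q k (u x)

/-- Christoffel symbols `Γᵏᵢⱼ` of the Levi-Civita connection of the (pseudo-Riemannian)
metric `g`. -/
def christoffel {n : ℕ} (g : (Fin n → ℝ) → Matrix (Fin n) (Fin n) ℝ) (p : Fin n → ℝ)
    (k i j : Fin n) : ℝ :=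
  (1 / 2) * ∑ l, (g p)⁻¹ k l *
    (pderiv i (fun q => g q l j) p + pderiv j (fun q => g q l i) p - pderiv l (fun q => g q i j) p)

/-- The local part of `J` is `g^{ij} d/dx - g^{is} Γʲₛₖ uₓᵏ`, where `g` is a nondegenerate symmetric
metric on `Ω` and `Γ` is its Levi-Civita connection. -/
def LocalPartOfMetric {n m : ℕ} (Ω : Set (Fin n → ℝ)) (J : HydroOperator n m)
    (g : (Fin n → ℝ) → Matrix (Fin n) (Fin n) ℝ) : Prop :=
  ∀ p ∈ Ω, (g p).IsSymm ∧ (g p).det ≠ 0 ∧ J.lead p = (g p)⁻¹ ∧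
    ∀ (ξ : Fin n → ℝ) (i j : Fin n),
      J.coef p ξ i j = - ∑ s, ∑ k, (g p)⁻¹ i s * christoffel g p j s k * ξ k

/-! ## The system `uₜ = v uₓ`, `vₜ = u vₓ`; here `p 0 = u` and `p 1 = v` -/

/-- The part of `U × V` off the diagonal `u = v`. -/
def offDiagonal (U V : Set ℝ) : Set (Fin 2 → ℝ) :=
  {p | p 0 ∈ U ∧ p 1 ∈ V ∧ p 0 ≠ p 1}

/-- The matrix of the system `uₜ = v uₓ`, `vₜ = u vₓ`. -/
def chaplyginMatrix (p : Fin 2 → ℝ) : Matrix (Fin 2) (Fin 2) ℝ :=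
  !![p 1, 0; 0, p 0]

/-- The parameter functions: smooth and nowhere zero. -/
def Admissible (U : Set ℝ) (f : ℝ → ℝ) : Prop :=
  ContDiffOn ℝ ∞ f U ∧ ∀ t ∈ U, f t ≠ 0

/-- `w¹ = ½ [(u - v) f'(u) - f(u) - φ(v)]`. -/
def speed₁ (f φ : ℝ → ℝ) (p : Fin 2 → ℝ) : ℝ :=
  (1 / 2) * ((p 0 - p 1) * deriv f (p 0) - f (p 0) - φ (p 1))

/-- `w² = ½ [(v - u) φ'(v) - f(u) - φ(v)]`. -/
def speed₂ (f φ : ℝ → ℝ) (p : Fin 2 → ℝ) : ℝ :=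
  (1 / 2) * ((p 1 - p 0) * deriv φ (p 1) - f (p 0) - φ (p 1))

/-- The matrix of the system `u_τ = w¹ uₓ`, `v_τ = w² vₓ`. -/
def speedMatrix (f φ : ℝ → ℝ) (p : Fin 2 → ℝ) : Matrix (Fin 2) (Fin 2) ℝ :=
  !![speed₁ f φ p, 0; 0, speed₂ f φ p]

/-- The metric `(u - v)⁻² (du² / f(u) + dv² / φ(v))`. -/
def chaplyginMetric (f φ : ℝ → ℝ) (p : Fin 2 → ℝ) : Matrix (Fin 2) (Fin 2) ℝ :=
  !![1 / ((p 0 - p 1) ^ 2 * f (p 0)), 0; 0, 1 / ((p 0 - p 1) ^ 2 * φ (p 1))]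

/-- The nonlocal operator with parameters `f` and `φ`; here `ξ 0 = uₓ` and `ξ 1 = vₓ`. -/
def chaplyginOperator (f φ : ℝ → ℝ) : HydroOperator 2 2 where
  lead p := (p 0 - p 1) ^ 2 • !![f (p 0), 0; 0, φ (p 1)]
  coef p ξ := (p 0 - p 1) •
    !![(1 / 2) * (p 0 - p 1) * deriv f (p 0) * ξ 0 + f (p 0) * (ξ 0 - ξ 1),
        φ (p 1) * ξ 0 + f (p 0) * ξ 1;
      - φ (p 1) * ξ 0 - f (p 0) * ξ 1,
        (1 / 2) * (p 0 - p 1) * deriv φ (p 1) * ξ 1 + φ (p 1) * (ξ 0 - ξ 1)]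
  left p ξ := !![speed₁ f φ p * ξ 0, ξ 0; speed₂ f φ p * ξ 1, ξ 1]
  right p ξ := !![ξ 0, ξ 1; speed₁ f φ p * ξ 0, speed₂ f φ p * ξ 1]

/-- `F` is an antiderivative of `1 / √|f|` on `U`. -/
def IsRootPrimitive (U : Set ℝ) (f F : ℝ → ℝ) : Prop :=
  ∀ t ∈ U, HasDerivAt F (1 / √|f t|) t

/-- The density `([∫ du/√f]² - [∫ dv/√φ]²) / (4 (v - u))`, in terms of antiderivatives `F` of
`1 / √|f|` and `Φ` of `1 / √|φ|`. Where `f < 0`, one has `√f = i √|f|`, so that the square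
`[∫ du/√f]²` is the real number `- F²`; similarly for `φ`. -/
def chaplyginDensity (f φ F Φ : ℝ → ℝ) (p : Fin 2 → ℝ) : ℝ :=
  (Real.sign (f (p 0)) * F (p 0) ^ 2 - Real.sign (φ (p 1)) * Φ (p 1) ^ 2) /
    (4 * (p 1 - p 0))

end

/-! The operator depends linearly on the pair (f, φ) (`chaplyginOperator_linear`), and the Jacobi
identity never uses that f and φ are nonzero. A linear combination of two operators is therefore
again an operator of the same form, with parameters that may vanish, and compatibility costs no more
than the Hamiltonian property itself.

Write P_a and Q_a for `invD` of `transFlux u a` and `speedFlux f φ u a`. Integration by parts gives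
the bracket of a and b a density that is skew in a and b: a local part plus (w·a) P_b − P_a (w·b)
(`linBracket_chaplyginOperator`). When it is differentiated in a direction X, the skew-symmetry of
`invD` moves the antiderivative off every factor containing X, so that the resulting density is
local in X (`hasDerivAt_linBracket`). With X = J c, the cyclic sum becomes a polynomial in the jets
of u, a, b, c, in f, φ and their derivatives, and in the functions P and Q. It is the exact
x-derivative of an explicit compactly supported function built from 3×3 determinants
(`hasDerivAt_jacobiPotential`), so its integral vanishes.

This computation is carried out for f and φ smooth on all of ℝ. In general a, b, c are supported in
some (-R, R), the field maps [-R, R] into a compact subset of Ω, and cut-offs replace f and φ by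
globally smooth functions that agree with them near the two coordinate images of this interval
(`exists_contDiff_parameters`). The perturbed field u + s J c may leave Ω far away, but neither side
of the bracket sees that.

The remaining claims are of other kinds. For diagonal flows, commuting with the system amounts to (u
- v) ∂w¹/∂v = (u - v) ∂w²/∂u = w² - w¹. The density is verified by writing f = σ r² with σ = ±1,
together with an explicit antiderivative for each of the two nonlocal terms. Locality is tested on a
field that leaves a point p and returns to it: the tail at x = 0 sees covectors supported near x =
2π, which forces 2 wⁱ(p) = 0. Constant fields reveal the leading term, hence f and φ. Finally, the
commutativity equations are integrated: the common value of -∂w¹/∂v and -∂w²/∂u is a function of u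
plus a function of v, and these two functions are f'/2 and φ'/2
(`exists_speeds_of_commutativity_equations`). -/

open MeasureTheory

/-! ### The skew-symmetric antiderivative -/

section Primitive

variable {p q : ℝ → ℝ}

theorem invD_eq_sub (hp : Integrable p) (x : ℝ) :
    invD p x = (∫ y in Set.Iic x, p y) - (1 / 2) * ∫ y, p y := by
  have h := intervalIntegral.integral_Iic_add_Ioi (b := x) hp.integrableOn hp.integrableOn
  rw [invD, ← h]; ring

theorem hasDerivAt_invD (hp : Continuous p) (hc : HasCompactSupport p) (x : ℝ) :
    HasDerivAt (invD p) (p x) x := by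
  have hi : Integrable p := hp.integrable_of_hasCompactSupport hc
  have h : invD p = fun x => (∫ y in (0 : ℝ)..x, p y) +
      ((∫ y in Set.Iic 0, p y) - (1 / 2) * ∫ y, p y) := by
    ext x
    rw [invD_eq_sub hi, ← intervalIntegral.integral_Iic_sub_Iic hi.integrableOn hi.integrableOn]
    ring
  rw [h]
  exact (intervalIntegral.integral_hasDerivAt_right (hp.intervalIntegrable _ _)
    (hp.stronglyMeasurableAtFilter _ _) hp.continuousAt).add_const _

theorem contDiff_invD (hp : ContDiff ℝ ∞ p) (hc : HasCompactSupport p) :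
    ContDiff ℝ ∞ (invD p) := by
  have h := hasDerivAt_invD hp.continuous hc
  rw [contDiff_infty_iff_deriv]
  refine ⟨fun x => (h x).differentiableAt, ?_⟩
  rwa [funext fun x => (h x).deriv]

theorem invD_add (hp : Integrable p) (hq : Integrable q) (x : ℝ) :
    invD (fun y => p y + q y) x = invD p x + invD q x := by
  simp only [invD, integral_add hp.integrableOn hq.integrableOn]
  ring

theorem invD_const_mul (r : ℝ) (p : ℝ → ℝ) (x : ℝ) :
    invD (fun y => r * p y) x = r * invD p x := by
  simp only [invD, integral_const_mul]
  ring

theorem integral_eq_sub_of_hasDerivAt_of_support {g h : ℝ → ℝ} {R : ℝ}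
    (hd : ∀ x, HasDerivAt g (h x) x) (hh : Continuous h) (hs : Function.support h ⊆ Set.Ioc (-R) R) :
    ∫ x, h x = g R - g (-R) := by
  rw [← intervalIntegral.integral_eq_integral_of_support_subset hs]
  exact intervalIntegral.integral_eq_sub_of_hasDerivAt (fun x _ => hd x)
    (hh.intervalIntegrable _ _)

theorem HasCompactSupport.exists_subset_Ioo (hc : HasCompactSupport p) :
    ∃ R : ℝ, 0 < R ∧ tsupport p ⊆ Set.Ioo (-R) R := by
  obtain ⟨R, hR⟩ := hc.isCompact.isBounded.subset_ball_lt 0 0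
  exact ⟨R, hR.1, by simpa [Real.ball_eq_Ioo] using hR.2⟩

theorem integral_eq_zero_of_hasDerivAt {g h : ℝ → ℝ} (hc : HasCompactSupport g)
    (hd : ∀ x, HasDerivAt g (h x) x) (hh : Continuous h) : ∫ x, h x = 0 := by
  obtain ⟨R, hR, hs⟩ := hc.exists_subset_Ioo
  have h0 : ∀ x, x ∉ Set.Ioo (-R) R → g x = 0 := fun x hx =>
    image_eq_zero_of_notMem_tsupport fun h => hx (hs h)
  rw [integral_eq_sub_of_hasDerivAt_of_support hd hh, h0 R (by simp), h0 (-R) (by simp), sub_zero]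
  have : h = deriv g := funext fun x => (hd x).deriv.symm
  rw [this]
  exact (support_deriv_subset.trans hs).trans Set.Ioo_subset_Ioc_self

/-- `invD p` is not compactly supported: to the right and to the left of the support it equals plus
and minus half the total integral. These are the boundary values in integrations by parts. -/
theorem invD_of_support_subset {R : ℝ} (hp : Continuous p) (hc : HasCompactSupport p)
    (hs : tsupport p ⊆ Set.Ioo (-R) R) :
    invD p R = (1 / 2) * ∫ y, p y ∧ invD p (-R) = -((1 / 2) * ∫ y, p y) := by
  have hi : Integrable p := hp.integrable_of_hasCompactSupport hc
  have h0 : ∀ x, x ∉ Set.Ioo (-R) R → p x = 0 := fun x hx =>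
    image_eq_zero_of_notMem_tsupport fun h => hx (hs h)
  constructor
  · rw [invD_eq_sub hi, setIntegral_eq_integral_of_forall_compl_eq_zero]
    · ring
    · intro x hx; exact h0 x fun h => hx h.2.le
  · rw [invD_eq_sub hi, setIntegral_eq_zero_of_forall_eq_zero]
    · ring
    · intro x hx; exact h0 x fun h => absurd h.1 (not_lt.2 hx)

/-- The operator `invD` is skew-symmetric. -/
theorem integral_mul_invD_add (hp : Continuous p) (hpc : HasCompactSupport p) (hq : Continuous q)
    (hqc : HasCompactSupport q) : ∫ x, (p x * invD q x + invD p x * q x) = 0 := by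
  obtain ⟨R₁, hR₁, hs₁⟩ := hpc.exists_subset_Ioo
  obtain ⟨R₂, hR₂, hs₂⟩ := hqc.exists_subset_Ioo
  have hs₁ : tsupport p ⊆ Set.Ioo (-max R₁ R₂) (max R₁ R₂) :=
    hs₁.trans (Set.Ioo_subset_Ioo (neg_le_neg (le_max_left _ _)) (le_max_left _ _))
  have hs₂ : tsupport q ⊆ Set.Ioo (-max R₁ R₂) (max R₁ R₂) :=
    hs₂.trans (Set.Ioo_subset_Ioo (neg_le_neg (le_max_right _ _)) (le_max_right _ _))
  have hP := hasDerivAt_invD hp hpc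
  have hQ := hasDerivAt_invD hq hqc
  have hPc : Continuous (invD p) := continuous_iff_continuousAt.2 fun x => (hP x).continuousAt
  have hQc : Continuous (invD q) := continuous_iff_continuousAt.2 fun x => (hQ x).continuousAt
  rw [integral_eq_sub_of_hasDerivAt_of_support (R := max R₁ R₂)
    (fun x => (hP x).mul (hQ x)) (by fun_prop)]
  -- At both ends the product of the antiderivatives is (1/4) ∫p ∫q, so the boundary terms cancel.
  -- The symmetric choice of kernel is what makes this happen.
  · simp [invD_of_support_subset hp hpc hs₁, invD_of_support_subset hq hqc hs₂]
  · intro x hx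
    by_contra h
    have h : x ∉ Set.Ioo (-max R₁ R₂) (max R₁ R₂) := fun h' => h (Set.Ioo_subset_Ioc_self h')
    exact hx (by simp [image_eq_zero_of_notMem_tsupport fun h' => h (hs₁ h'),
      image_eq_zero_of_notMem_tsupport fun h' => h (hs₂ h')])

end Primitive

/-- Differentiation under the integral sign: for |s| < 1 the s-derivative is dominated by its
maximum over the compact set [-1, 1] × K, and it vanishes off K. -/
theorem hasDerivAt_integral_of_contDiff {G : ℝ × ℝ → ℝ} {G' : ℝ → ℝ} {K : Set ℝ}
    (hK : IsCompact K) (hG : ContDiff ℝ 1 G) (h0 : ∀ s x, x ∉ K → G (s, x) = 0)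
    (hG' : ∀ x, HasDerivAt (fun s => G (s, x)) (G' x) 0) :
    HasDerivAt (fun s => ∫ x, G (s, x)) (∫ x, G' x) 0 := by
  have hd : ∀ s x, HasDerivAt (fun s => G (s, x)) (fderiv ℝ G (s, x) (1, 0)) s := fun s x =>
    ((hG.differentiable one_ne_zero (s, x)).hasFDerivAt).comp_hasDerivAt s
      ((hasDerivAt_id s).prodMk (hasDerivAt_const s x))
  have hcont : Continuous fun z : ℝ × ℝ => fderiv ℝ G z (1, 0) :=
    (hG.continuous_fderiv one_ne_zero).clm_apply continuous_const
  have hint : ∀ s, Integrable fun x => G (s, x) := fun s =>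
    (hG.continuous.comp (by fun_prop : Continuous fun x : ℝ => (s, x))).integrable_of_hasCompactSupport
      (HasCompactSupport.intro hK (h0 s))
  obtain ⟨C, hC⟩ := ((isCompact_closedBall (0 : ℝ) 1).prod hK).exists_bound_of_continuousOn
    hcont.continuousOn
  have hz : ∀ s x, x ∉ K → fderiv ℝ G (s, x) (1, 0) = 0 := fun s x hx =>
    (hd s x).unique (by simpa [h0 _ x hx] using hasDerivAt_const s (0 : ℝ))
  have := (hasDerivAt_integral_of_dominated_loc_of_deriv_le
    (μ := volume) (F := fun s x => G (s, x)) (F' := fun s x => fderiv ℝ G (s, x) (1, 0))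
    (bound := K.indicator fun _ => C)
    (Metric.ball_mem_nhds (0 : ℝ) one_pos)
    (Filter.Eventually.of_forall fun s => (hint s).aestronglyMeasurable)
    (hint 0) (hcont.comp (by fun_prop : Continuous fun x : ℝ => ((0 : ℝ), x))).aestronglyMeasurable
    (Filter.Eventually.of_forall fun x s hs => ?_)
    ((integrable_indicator_iff hK.measurableSet).2 (integrableOn_const hK.measure_lt_top.ne))
    (Filter.Eventually.of_forall fun x s _ => hd s x)).2
  · rwa [show G' = fun x => fderiv ℝ G (0, x) (1, 0) from
      funext fun x => (hG' x).unique (hd 0 x)]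
  · by_cases hx : x ∈ K
    · rw [Set.indicator_of_mem hx]
      exact hC (s, x) ⟨Metric.ball_subset_closedBall hs, hx⟩
    · simp [Set.indicator_of_notMem hx, hz s x hx]

/-! ### The operator in coordinates and the skew-symmetric form of the bracket -/

/-- The density `uₓ · a`. -/
noncomputable def transFlux (u a : ℝ → Fin 2 → ℝ) (x : ℝ) : ℝ :=
  deriv u x 0 * a x 0 + deriv u x 1 * a x 1

/-- The density `w¹ uₓ a₁ + w² vₓ a₂`. -/
noncomputable def speedFlux (f φ : ℝ → ℝ) (u a : ℝ → Fin 2 → ℝ) (x : ℝ) : ℝ :=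
  speed₁ f φ (u x) * deriv u x 0 * a x 0 + speed₂ f φ (u x) * deriv u x 1 * a x 1

/-- The skew-symmetric density of the local part of the bracket. -/
noncomputable def localDensity (f φ : ℝ → ℝ) (u a b : ℝ → Fin 2 → ℝ) (x : ℝ) : ℝ :=
  (1 / 2) * ((u x 0 - u x 1) ^ 2 * f (u x 0)) * (a x 0 * deriv b x 0 - deriv a x 0 * b x 0) +
  (1 / 2) * ((u x 0 - u x 1) ^ 2 * φ (u x 1)) * (a x 1 * deriv b x 1 - deriv a x 1 * b x 1) +
  (u x 0 - u x 1) * (φ (u x 1) * deriv u x 0 + f (u x 0) * deriv u x 1) *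
    (a x 0 * b x 1 - a x 1 * b x 0)

theorem chaplyginOperator_apply_zero (f φ : ℝ → ℝ) (u a : ℝ → Fin 2 → ℝ) (x : ℝ) :
    (chaplyginOperator f φ).toFieldOperator u a x 0 =
      (u x 0 - u x 1) ^ 2 * f (u x 0) * deriv a x 0 +
      (u x 0 - u x 1) * ((1 / 2) * (u x 0 - u x 1) * deriv f (u x 0) * deriv u x 0 +
        f (u x 0) * (deriv u x 0 - deriv u x 1)) * a x 0 +
      (u x 0 - u x 1) * (φ (u x 1) * deriv u x 0 + f (u x 0) * deriv u x 1) * a x 1 +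
      speed₁ f φ (u x) * deriv u x 0 * invD (transFlux u a) x +
      deriv u x 0 * invD (speedFlux f φ u a) x := by
  simp [HydroOperator.toFieldOperator, chaplyginOperator, Matrix.mulVec, dotProduct,
    Fin.sum_univ_two]
  simp only [← transFlux.eq_def, ← speedFlux.eq_def]
  ring

theorem chaplyginOperator_apply_one (f φ : ℝ → ℝ) (u a : ℝ → Fin 2 → ℝ) (x : ℝ) :
    (chaplyginOperator f φ).toFieldOperator u a x 1 =
      (u x 0 - u x 1) ^ 2 * φ (u x 1) * deriv a x 1 -
      (u x 0 - u x 1) * (φ (u x 1) * deriv u x 0 + f (u x 0) * deriv u x 1) * a x 0 +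
      (u x 0 - u x 1) * ((1 / 2) * (u x 0 - u x 1) * deriv φ (u x 1) * deriv u x 1 +
        φ (u x 1) * (deriv u x 0 - deriv u x 1)) * a x 1 +
      speed₂ f φ (u x) * deriv u x 1 * invD (transFlux u a) x +
      deriv u x 1 * invD (speedFlux f φ u a) x := by
  simp [HydroOperator.toFieldOperator, chaplyginOperator, Matrix.mulVec, dotProduct,
    Fin.sum_univ_two]
  simp only [← transFlux.eq_def, ← speedFlux.eq_def]
  ring

section Smooth

variable {f φ : ℝ → ℝ} {u a b : ℝ → Fin 2 → ℝ}

theorem ContDiff.deriv_infty {E : Type*} [NormedAddCommGroup E] [NormedSpace ℝ E] {g : ℝ → E}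
    (hg : ContDiff ℝ ∞ g) : ContDiff ℝ ∞ (deriv g) :=
  (contDiff_infty_iff_deriv.1 hg).2

theorem ContDiff.hasDerivAt_deriv {E : Type*} [NormedAddCommGroup E] [NormedSpace ℝ E] {g : ℝ → E}
    (hg : ContDiff ℝ ∞ g) (x : ℝ) : HasDerivAt g (deriv g x) x :=
  ((contDiff_infty_iff_deriv.1 hg).1 x).hasDerivAt

theorem ContDiff.coord {n : ℕ} {u : ℝ → Fin n → ℝ} (hu : ContDiff ℝ ∞ u) (i : Fin n) :
    ContDiff ℝ ∞ fun x => u x i :=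
  contDiff_pi.1 hu i

theorem ContDiff.hasDerivAt_coord {n : ℕ} {u : ℝ → Fin n → ℝ} (hu : ContDiff ℝ ∞ u) (i : Fin n)
    (x : ℝ) : HasDerivAt (fun x => u x i) (deriv u x i) x :=
  hasDerivAt_pi.1 (hu.hasDerivAt_deriv x) i

theorem coord_eq_zero_of_notMem_tsupport {x : ℝ} (hx : x ∉ tsupport a) (i : Fin 2) :
    a x i = 0 ∧ deriv a x i = 0 := by
  refine ⟨by simp [image_eq_zero_of_notMem_tsupport hx], ?_⟩
  have : deriv a x = 0 := by
    by_contra h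
    exact hx (support_deriv_subset h)
  simp [this]

theorem contDiff_transFlux (hu : ContDiff ℝ ∞ u) (ha : IsTestCovector a) :
    ContDiff ℝ ∞ (transFlux u a) := by
  have h₁ := hu.deriv_infty.coord
  have h₂ := ha.1.coord
  exact ((h₁ 0).mul (h₂ 0)).add ((h₁ 1).mul (h₂ 1))

theorem hasCompactSupport_transFlux (u : ℝ → Fin 2 → ℝ) (ha : IsTestCovector a) :
    HasCompactSupport (transFlux u a) :=
  HasCompactSupport.intro ha.2.isCompact fun x hx => by simp [transFlux, coord_eq_zero_of_notMem_tsupport hx]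

theorem contDiff_speed₁ (hf : ContDiff ℝ ∞ f) (hφ : ContDiff ℝ ∞ φ) (hu : ContDiff ℝ ∞ u) :
    ContDiff ℝ ∞ fun x => speed₁ f φ (u x) := by
  have h₀ := hu.coord 0
  have h₁ := hu.coord 1
  have h₂ := hf.deriv_infty
  unfold speed₁
  exact contDiff_const.mul ((((h₀.sub h₁).mul (h₂.comp h₀)).sub (hf.comp h₀)).sub (hφ.comp h₁))

theorem contDiff_speed₂ (hf : ContDiff ℝ ∞ f) (hφ : ContDiff ℝ ∞ φ) (hu : ContDiff ℝ ∞ u) :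
    ContDiff ℝ ∞ fun x => speed₂ f φ (u x) := by
  have h₀ := hu.coord 0
  have h₁ := hu.coord 1
  have h₂ := hφ.deriv_infty
  unfold speed₂
  exact contDiff_const.mul ((((h₁.sub h₀).mul (h₂.comp h₁)).sub (hf.comp h₀)).sub (hφ.comp h₁))

theorem contDiff_speedFlux (hf : ContDiff ℝ ∞ f) (hφ : ContDiff ℝ ∞ φ) (hu : ContDiff ℝ ∞ u)
    (ha : IsTestCovector a) : ContDiff ℝ ∞ (speedFlux f φ u a) := by
  have h₁ := hu.deriv_infty.coord
  have h₂ := ha.1.coord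
  exact (((contDiff_speed₁ hf hφ hu).mul (h₁ 0)).mul (h₂ 0)).add
    (((contDiff_speed₂ hf hφ hu).mul (h₁ 1)).mul (h₂ 1))

theorem hasCompactSupport_speedFlux (f φ : ℝ → ℝ) (u : ℝ → Fin 2 → ℝ) (ha : IsTestCovector a) :
    HasCompactSupport (speedFlux f φ u a) :=
  HasCompactSupport.intro ha.2.isCompact fun x hx => by simp [speedFlux, coord_eq_zero_of_notMem_tsupport hx]

theorem contDiff_chaplyginOperator (hf : ContDiff ℝ ∞ f) (hφ : ContDiff ℝ ∞ φ)
    (hu : ContDiff ℝ ∞ u) (ha : IsTestCovector a) :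
    ContDiff ℝ ∞ ((chaplyginOperator f φ).toFieldOperator u a) := by
  have h₁ := hu.coord 0
  have h₂ := hu.coord 1
  have h₃ := hu.deriv_infty.coord 0
  have h₄ := hu.deriv_infty.coord 1
  have h₅ := ha.1.coord 0
  have h₆ := ha.1.coord 1
  have h₇ := ha.1.deriv_infty.coord 0
  have h₈ := ha.1.deriv_infty.coord 1
  have h₁₁ := contDiff_speed₁ hf hφ hu
  have h₁₂ := contDiff_speed₂ hf hφ hu
  have h₁₃ := contDiff_invD (contDiff_transFlux hu ha) (hasCompactSupport_transFlux u ha)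
  have h₁₄ := contDiff_invD (contDiff_speedFlux hf hφ hu ha) (hasCompactSupport_speedFlux f φ u ha)
  -- Each component is replaced by an opaque scalar function, so that `fun_prop` meets atoms with
  -- known smoothness instead of evaluations of vector-valued functions.
  obtain ⟨W₁, eW₁⟩ : ∃ W : ℝ → ℝ, ∀ x, speed₁ f φ (u x) = W x := ⟨_, fun _ => rfl⟩
  obtain ⟨W₂, eW₂⟩ : ∃ W : ℝ → ℝ, ∀ x, speed₂ f φ (u x) = W x := ⟨_, fun _ => rfl⟩
  obtain ⟨U, eU⟩ : ∃ U : ℝ → ℝ, ∀ x, u x 0 = U x := ⟨_, fun _ => rfl⟩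
  obtain ⟨V, eV⟩ : ∃ V : ℝ → ℝ, ∀ x, u x 1 = V x := ⟨_, fun _ => rfl⟩
  obtain ⟨U', eU'⟩ : ∃ U' : ℝ → ℝ, ∀ x, deriv u x 0 = U' x := ⟨_, fun _ => rfl⟩
  obtain ⟨V', eV'⟩ : ∃ V' : ℝ → ℝ, ∀ x, deriv u x 1 = V' x := ⟨_, fun _ => rfl⟩
  obtain ⟨A₁, eA₁⟩ : ∃ A₁ : ℝ → ℝ, ∀ x, a x 0 = A₁ x := ⟨_, fun _ => rfl⟩
  obtain ⟨A₂, eA₂⟩ : ∃ A₂ : ℝ → ℝ, ∀ x, a x 1 = A₂ x := ⟨_, fun _ => rfl⟩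
  obtain ⟨A₁', eA₁'⟩ : ∃ A₁' : ℝ → ℝ, ∀ x, deriv a x 0 = A₁' x := ⟨_, fun _ => rfl⟩
  obtain ⟨A₂', eA₂'⟩ : ∃ A₂' : ℝ → ℝ, ∀ x, deriv a x 1 = A₂' x := ⟨_, fun _ => rfl⟩
  rw [contDiff_pi, Fin.forall_fin_two]
  constructor
  · simp only [chaplyginOperator_apply_zero, eW₁, eW₂, eU, eV, eU', eV', eA₁, eA₂, eA₁', eA₂'] at *
    fun_prop
  · simp only [chaplyginOperator_apply_one, eW₁, eW₂, eU, eV, eU', eV', eA₁, eA₂, eA₁', eA₂'] at *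
    fun_prop

theorem continuous_localDensity (hf : ContDiff ℝ ∞ f) (hφ : ContDiff ℝ ∞ φ)
    (hu : ContDiff ℝ ∞ u) (ha : IsTestCovector a) (hb : IsTestCovector b) :
    Continuous (localDensity f φ u a b) := by
  have h₁ := (hu.coord 0).continuous
  have h₂ := (hu.coord 1).continuous
  have h₃ := (hu.deriv_infty.coord 0).continuous
  have h₄ := (hu.deriv_infty.coord 1).continuous
  have h₅ := (ha.1.coord 0).continuous
  have h₆ := (ha.1.coord 1).continuous
  have h₇ := (ha.1.deriv_infty.coord 0).continuous
  have h₈ := (ha.1.deriv_infty.coord 1).continuous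
  have h₉ := (hb.1.coord 0).continuous
  have h₁₀ := (hb.1.coord 1).continuous
  have h₁₁ := (hb.1.deriv_infty.coord 0).continuous
  have h₁₂ := (hb.1.deriv_infty.coord 1).continuous
  have h₁₃ := hf.continuous
  have h₁₄ := hφ.continuous
  obtain ⟨U, eU⟩ : ∃ U : ℝ → ℝ, ∀ x, u x 0 = U x := ⟨_, fun _ => rfl⟩
  obtain ⟨V, eV⟩ : ∃ V : ℝ → ℝ, ∀ x, u x 1 = V x := ⟨_, fun _ => rfl⟩
  obtain ⟨U', eU'⟩ : ∃ U' : ℝ → ℝ, ∀ x, deriv u x 0 = U' x := ⟨_, fun _ => rfl⟩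
  obtain ⟨V', eV'⟩ : ∃ V' : ℝ → ℝ, ∀ x, deriv u x 1 = V' x := ⟨_, fun _ => rfl⟩
  obtain ⟨A₁, eA₁⟩ : ∃ A₁ : ℝ → ℝ, ∀ x, a x 0 = A₁ x := ⟨_, fun _ => rfl⟩
  obtain ⟨A₂, eA₂⟩ : ∃ A₂ : ℝ → ℝ, ∀ x, a x 1 = A₂ x := ⟨_, fun _ => rfl⟩
  obtain ⟨A₁', eA₁'⟩ : ∃ A₁' : ℝ → ℝ, ∀ x, deriv a x 0 = A₁' x := ⟨_, fun _ => rfl⟩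
  obtain ⟨A₂', eA₂'⟩ : ∃ A₂' : ℝ → ℝ, ∀ x, deriv a x 1 = A₂' x := ⟨_, fun _ => rfl⟩
  obtain ⟨B₁, eB₁⟩ : ∃ B₁ : ℝ → ℝ, ∀ x, b x 0 = B₁ x := ⟨_, fun _ => rfl⟩
  obtain ⟨B₂, eB₂⟩ : ∃ B₂ : ℝ → ℝ, ∀ x, b x 1 = B₂ x := ⟨_, fun _ => rfl⟩
  obtain ⟨B₁', eB₁'⟩ : ∃ B₁' : ℝ → ℝ, ∀ x, deriv b x 0 = B₁' x := ⟨_, fun _ => rfl⟩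
  obtain ⟨B₂', eB₂'⟩ : ∃ B₂' : ℝ → ℝ, ∀ x, deriv b x 1 = B₂' x := ⟨_, fun _ => rfl⟩
  unfold localDensity
  simp only [eU, eV, eU', eV', eA₁, eA₂, eA₁', eA₂', eB₁, eB₂, eB₁', eB₂'] at *
  fun_prop

theorem integral_add_eq_of_hasDerivAt {g h p : ℝ → ℝ} (hc : HasCompactSupport g)
    (hd : ∀ x, HasDerivAt g (h x) x) (hh : Continuous h) (hp : Integrable p) :
    ∫ x, (p x + h x) = ∫ x, p x := by
  have hhc : HasCompactSupport h := by
    rw [show h = deriv g from funext fun x => (hd x).deriv.symm]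
    exact hc.deriv
  rw [integral_add hp (hh.integrable_of_hasCompactSupport hhc),
    integral_eq_zero_of_hasDerivAt hc hd hh, add_zero]

/-- Two integrations by parts produce a density that is visibly skew in a and b. The symmetric part
of the local terms is the derivative of half the metric pairing of a and b, and the term containing
Q_b is traded for one containing P_a. Besides skew-symmetry this leaves only antiderivatives of
`transFlux`, which is linear in the field. -/
theorem linBracket_chaplyginOperator (hf : ContDiff ℝ ∞ f) (hφ : ContDiff ℝ ∞ φ)
    (hu : ContDiff ℝ ∞ u) (ha : IsTestCovector a) (hb : IsTestCovector b) :
    linBracket (chaplyginOperator f φ).toFieldOperator a b u =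
      ∫ x, (localDensity f φ u a b x + speedFlux f φ u a x * invD (transFlux u b) x -
        invD (transFlux u a) x * speedFlux f φ u b x) := by
  have hpa := contDiff_transFlux hu ha
  have hpa' := hasCompactSupport_transFlux u ha
  have hpb := contDiff_transFlux hu hb
  have hpb' := hasCompactSupport_transFlux u hb
  have hqa := contDiff_speedFlux hf hφ hu ha
  have hqa' := hasCompactSupport_speedFlux f φ u ha
  have hqb := contDiff_speedFlux hf hφ hu hb
  have hqb' := hasCompactSupport_speedFlux f φ u hb
  have hPa := (contDiff_invD hpa hpa').continuous
  have hPb := (contDiff_invD hpb hpb').continuous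
  have hQa := (contDiff_invD hqa hqa').continuous
  have hQb := (contDiff_invD hqb hqb').continuous
  have hl := continuous_localDensity hf hφ hu ha hb
  have hlc : HasCompactSupport (localDensity f φ u a b) :=
    HasCompactSupport.intro ha.2.isCompact fun x hx => by simp [localDensity, coord_eq_zero_of_notMem_tsupport hx]
  set D : ℝ → ℝ := fun x => localDensity f φ u a b x + speedFlux f φ u a x * invD (transFlux u b) x -
        invD (transFlux u a) x * speedFlux f φ u b x with hD
  have hDc : Continuous D := by
    have := hqa.continuous; have := hqb.continuous
    fun_prop
  have hDi : Integrable D :=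
    hDc.integrable_of_hasCompactSupport ((hlc.add hqa'.mul_right).sub hqb'.mul_left)
  have hdu0 := hu.hasDerivAt_coord 0
  have hdu1 := hu.hasDerivAt_coord 1
  -- The exact term: half of g^{ij} a_i b_j, with g^{ij} the leading coefficient.
  have hg : ∀ x, HasDerivAt (fun x => (1 / 2) * ((u x 0 - u x 1) ^ 2 * f (u x 0)) * (a x 0 * b x 0)
      + (1 / 2) * ((u x 0 - u x 1) ^ 2 * φ (u x 1)) * (a x 1 * b x 1)) _ x := fun x =>
    (((((hdu0 x).sub (hdu1 x)).pow 2).mul ((hf.hasDerivAt_deriv _).comp x (hdu0 x))).const_mul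
      (1 / 2)).mul ((ha.1.hasDerivAt_coord 0 x).mul (hb.1.hasDerivAt_coord 0 x)) |>.add
    ((((((hdu0 x).sub (hdu1 x)).pow 2).mul ((hφ.hasDerivAt_deriv _).comp x (hdu1 x))).const_mul
      (1 / 2)).mul ((ha.1.hasDerivAt_coord 1 x).mul (hb.1.hasDerivAt_coord 1 x)))
  have hgc : HasCompactSupport (fun x => (1 / 2) * ((u x 0 - u x 1) ^ 2 * f (u x 0)) *
      (a x 0 * b x 0) + (1 / 2) * ((u x 0 - u x 1) ^ 2 * φ (u x 1)) * (a x 1 * b x 1)) :=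
    HasCompactSupport.intro ha.2.isCompact fun x hx => by simp [coord_eq_zero_of_notMem_tsupport hx]
  have hE : Integrable fun x => transFlux u a x * invD (speedFlux f φ u b) x +
      invD (transFlux u a) x * speedFlux f φ u b x := by
    refine Continuous.integrable_of_hasCompactSupport ?_ (hpa'.mul_right.add hqb'.mul_left)
    have := hpa.continuous; have := hqb.continuous
    fun_prop
  have hE0 := integral_mul_invD_add hpa.continuous hpa' hqb.continuous hqb'
  have hsum := integral_add_eq_of_hasDerivAt hgc hg ?_ (hDi.add hE)
  · simp only [Pi.add_apply] at hsum
    -- Adding the vanishing integrals `hE0` and that of the derivative in `hg` to the skew density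
    -- turns it pointwise into a · J b.
    rw [← add_zero (∫ x, D x), ← hE0, ← integral_add hDi hE, ← hsum, linBracket]
    congr 1
    ext x
    simp only [dotProduct, Fin.sum_univ_two, chaplyginOperator_apply_zero,
      chaplyginOperator_apply_one, hD, localDensity, Pi.mul_apply, Pi.sub_apply, Pi.pow_apply, Function.comp]
    simp only [transFlux, speedFlux]
    push_cast
    ring
  · have h₁ := (hu.coord 0).continuous
    have h₂ := (hu.coord 1).continuous
    have h₃ := (hu.deriv_infty.coord 0).continuous
    have h₄ := (hu.deriv_infty.coord 1).continuous
    have h₅ := (ha.1.coord 0).continuous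
    have h₆ := (ha.1.coord 1).continuous
    have h₇ := (ha.1.deriv_infty.coord 0).continuous
    have h₈ := (ha.1.deriv_infty.coord 1).continuous
    have h₉ := (hb.1.coord 0).continuous
    have h₁₀ := (hb.1.coord 1).continuous
    have h₁₁ := (hb.1.deriv_infty.coord 0).continuous
    have h₁₂ := (hb.1.deriv_infty.coord 1).continuous
    have h₁₃ := hf.continuous
    have h₁₄ := hφ.continuous
    have h₁₅ := hf.deriv_infty.continuous
    have h₁₆ := hφ.deriv_infty.continuous
    obtain ⟨U, eU⟩ : ∃ U : ℝ → ℝ, ∀ x, u x 0 = U x := ⟨_, fun _ => rfl⟩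
    obtain ⟨V, eV⟩ : ∃ V : ℝ → ℝ, ∀ x, u x 1 = V x := ⟨_, fun _ => rfl⟩
    obtain ⟨U', eU'⟩ : ∃ U' : ℝ → ℝ, ∀ x, deriv u x 0 = U' x := ⟨_, fun _ => rfl⟩
    obtain ⟨V', eV'⟩ : ∃ V' : ℝ → ℝ, ∀ x, deriv u x 1 = V' x := ⟨_, fun _ => rfl⟩
    obtain ⟨A₁, eA₁⟩ : ∃ A₁ : ℝ → ℝ, ∀ x, a x 0 = A₁ x := ⟨_, fun _ => rfl⟩
    obtain ⟨A₂, eA₂⟩ : ∃ A₂ : ℝ → ℝ, ∀ x, a x 1 = A₂ x := ⟨_, fun _ => rfl⟩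
    obtain ⟨A₁', eA₁'⟩ : ∃ A₁' : ℝ → ℝ, ∀ x, deriv a x 0 = A₁' x := ⟨_, fun _ => rfl⟩
    obtain ⟨A₂', eA₂'⟩ : ∃ A₂' : ℝ → ℝ, ∀ x, deriv a x 1 = A₂' x := ⟨_, fun _ => rfl⟩
    obtain ⟨B₁, eB₁⟩ : ∃ B₁ : ℝ → ℝ, ∀ x, b x 0 = B₁ x := ⟨_, fun _ => rfl⟩
    obtain ⟨B₂, eB₂⟩ : ∃ B₂ : ℝ → ℝ, ∀ x, b x 1 = B₂ x := ⟨_, fun _ => rfl⟩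
    obtain ⟨B₁', eB₁'⟩ : ∃ B₁' : ℝ → ℝ, ∀ x, deriv b x 0 = B₁' x := ⟨_, fun _ => rfl⟩
    obtain ⟨B₂', eB₂'⟩ : ∃ B₂' : ℝ → ℝ, ∀ x, deriv b x 1 = B₂' x := ⟨_, fun _ => rfl⟩
    simp only [Function.comp, Pi.mul_apply, Pi.sub_apply, Pi.pow_apply,
      eU, eV, eU', eV', eA₁, eA₂, eA₁', eA₂', eB₁, eB₂, eB₁', eB₂'] at *
    fun_prop

end Smooth

/-! ### First variation of the bracket -/

/-- The derivative of `localDensity` in the direction `X`. -/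
noncomputable def localVariation (f φ : ℝ → ℝ) (u X a b : ℝ → Fin 2 → ℝ) (x : ℝ) : ℝ :=
  (1 / 2) * (2 * (u x 0 - u x 1) * (X x 0 - X x 1) * f (u x 0) +
      (u x 0 - u x 1) ^ 2 * (deriv f (u x 0) * X x 0)) *
    (a x 0 * deriv b x 0 - deriv a x 0 * b x 0) +
  (1 / 2) * (2 * (u x 0 - u x 1) * (X x 0 - X x 1) * φ (u x 1) +
      (u x 0 - u x 1) ^ 2 * (deriv φ (u x 1) * X x 1)) *
    (a x 1 * deriv b x 1 - deriv a x 1 * b x 1) +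
  ((X x 0 - X x 1) * (φ (u x 1) * deriv u x 0 + f (u x 0) * deriv u x 1) +
    (u x 0 - u x 1) * (deriv φ (u x 1) * X x 1 * deriv u x 0 + φ (u x 1) * deriv X x 0 +
      (deriv f (u x 0) * X x 0 * deriv u x 1 + f (u x 0) * deriv X x 1))) *
    (a x 0 * b x 1 - a x 1 * b x 0)

/-- The derivative of `speedFlux` in the direction `X`. -/
noncomputable def speedVariation (f φ : ℝ → ℝ) (u X a : ℝ → Fin 2 → ℝ) (x : ℝ) : ℝ :=
  ((1 / 2) * ((u x 0 - u x 1) * (deriv (deriv f) (u x 0) * X x 0) - X x 1 * deriv f (u x 0) -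
      deriv φ (u x 1) * X x 1) * deriv u x 0 + speed₁ f φ (u x) * deriv X x 0) * a x 0 +
  ((1 / 2) * ((u x 1 - u x 0) * (deriv (deriv φ) (u x 1) * X x 1) - X x 0 * deriv φ (u x 1) -
      deriv f (u x 0) * X x 0) * deriv u x 1 + speed₂ f φ (u x) * deriv X x 1) * a x 1

/-- A density of the derivative of the bracket in the direction `X`. -/
noncomputable def bracketVariation (f φ : ℝ → ℝ) (u X a b : ℝ → Fin 2 → ℝ) (x : ℝ) : ℝ :=
  localVariation f φ u X a b x + speedVariation f φ u X a x * invD (transFlux u b) x -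
    invD (transFlux u a) x * speedVariation f φ u X b x +
    transFlux X a x * invD (speedFlux f φ u b) x - invD (speedFlux f φ u a) x * transFlux X b x

section Variation

variable {f φ : ℝ → ℝ} {u X a b : ℝ → Fin 2 → ℝ}

theorem deriv_add_smul (hu : ContDiff ℝ ∞ u) (hX : ContDiff ℝ ∞ X) (s x : ℝ) :
    deriv (u + s • X) x = deriv u x + s • deriv X x :=
  ((hu.hasDerivAt_deriv x).add ((hX.hasDerivAt_deriv x).const_smul s)).deriv

theorem hasDerivAt_line (p q : ℝ) : HasDerivAt (fun s : ℝ => p + s * q) q 0 := by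
  simpa using ((hasDerivAt_id (0 : ℝ)).mul_const q).const_add p

theorem hasDerivAt_comp_line (hf : ContDiff ℝ ∞ f) (p q : ℝ) :
    HasDerivAt (fun s : ℝ => f (p + s * q)) (deriv f p * q) 0 := by
  have h := hf.hasDerivAt_deriv (p + 0 * q)
  have := h.comp 0 (hasDerivAt_line p q)
  rwa [zero_mul, add_zero] at this

theorem hasDerivAt_localDensity (hf : ContDiff ℝ ∞ f) (hφ : ContDiff ℝ ∞ φ)
    (hu : ContDiff ℝ ∞ u) (hX : ContDiff ℝ ∞ X) (a b : ℝ → Fin 2 → ℝ) (x : ℝ) :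
    HasDerivAt (fun s : ℝ => localDensity f φ (u + s • X) a b x)
      (localVariation f φ u X a b x) 0 := by
  simp only [localDensity, deriv_add_smul hu hX, Pi.add_apply, Pi.smul_apply, smul_eq_mul]
  have h₀ := hasDerivAt_line (u x 0) (X x 0)
  have h₁ := hasDerivAt_line (u x 1) (X x 1)
  have k₀ := hasDerivAt_line (deriv u x 0) (deriv X x 0)
  have k₁ := hasDerivAt_line (deriv u x 1) (deriv X x 1)
  have hf₀ := hasDerivAt_comp_line hf (u x 0) (X x 0)
  have hφ₁ := hasDerivAt_comp_line hφ (u x 1) (X x 1)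
  refine (((((h₀.sub h₁).pow 2).mul hf₀).const_mul (1 / 2)).mul_const _ |>.add
    (((((h₀.sub h₁).pow 2).mul hφ₁).const_mul (1 / 2)).mul_const _) |>.add
    (((h₀.sub h₁).mul ((hφ₁.mul k₀).add (hf₀.mul k₁))).mul_const _)).congr_deriv ?_
  simp only [localVariation, Pi.sub_apply, Pi.mul_apply, Pi.add_apply, Pi.pow_apply]
  simp only [zero_mul, add_zero]
  push_cast
  ring

theorem hasDerivAt_speedFlux (hf : ContDiff ℝ ∞ f) (hφ : ContDiff ℝ ∞ φ)
    (hu : ContDiff ℝ ∞ u) (hX : ContDiff ℝ ∞ X) (a : ℝ → Fin 2 → ℝ) (x : ℝ) :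
    HasDerivAt (fun s : ℝ => speedFlux f φ (u + s • X) a x)
      (speedVariation f φ u X a x) 0 := by
  simp only [speedFlux, speed₁, speed₂, deriv_add_smul hu hX, Pi.add_apply, Pi.smul_apply,
    smul_eq_mul]
  have h₀ := hasDerivAt_line (u x 0) (X x 0)
  have h₁ := hasDerivAt_line (u x 1) (X x 1)
  have k₀ := hasDerivAt_line (deriv u x 0) (deriv X x 0)
  have k₁ := hasDerivAt_line (deriv u x 1) (deriv X x 1)
  have hf₀ := hasDerivAt_comp_line hf (u x 0) (X x 0)
  have hφ₁ := hasDerivAt_comp_line hφ (u x 1) (X x 1)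
  have hf₀' := hasDerivAt_comp_line hf.deriv_infty (u x 0) (X x 0)
  have hφ₁' := hasDerivAt_comp_line hφ.deriv_infty (u x 1) (X x 1)
  refine ((((((h₀.sub h₁).mul hf₀').sub hf₀).sub hφ₁).const_mul (1 / 2)).mul k₀ |>.mul_const _ |>.add
    ((((((h₁.sub h₀).mul hφ₁').sub hf₀).sub hφ₁).const_mul (1 / 2)).mul k₁ |>.mul_const _)).congr_deriv ?_
  simp only [speedVariation, speed₁, speed₂, Pi.sub_apply, Pi.mul_apply]
  simp only [zero_mul, add_zero]
  ring

theorem transFlux_add_smul (hu : ContDiff ℝ ∞ u) (hX : ContDiff ℝ ∞ X) (a : ℝ → Fin 2 → ℝ)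
    (s x : ℝ) : transFlux (u + s • X) a x = transFlux u a x + s * transFlux X a x := by
  simp only [transFlux, deriv_add_smul hu hX, Pi.add_apply, Pi.smul_apply, smul_eq_mul]
  ring

/-- Because this term is affine in s, no derivative ever has to be taken through `invD`. -/
theorem invD_transFlux_add_smul (hu : ContDiff ℝ ∞ u) (hX : ContDiff ℝ ∞ X)
    (ha : IsTestCovector a) (s x : ℝ) :
    invD (transFlux (u + s • X) a) x = invD (transFlux u a) x + s * invD (transFlux X a) x := by
  have h₁ := (contDiff_transFlux hu ha).continuous.integrable_of_hasCompactSupport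
    (hasCompactSupport_transFlux u ha) (μ := volume)
  have h₂ := (contDiff_transFlux hX ha).continuous.integrable_of_hasCompactSupport
    (hasCompactSupport_transFlux X ha) (μ := volume)
  rw [funext (transFlux_add_smul hu hX a s), invD_add h₁ (h₂.const_mul s), invD_const_mul]

/-- Joint smoothness in (s, x), as needed to differentiate under the integral sign. -/
theorem contDiff_localDensity_line (hf : ContDiff ℝ ∞ f) (hφ : ContDiff ℝ ∞ φ)
    (hu : ContDiff ℝ ∞ u) (hX : ContDiff ℝ ∞ X) (ha : IsTestCovector a) (hb : IsTestCovector b) :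
    ContDiff ℝ ∞ fun z : ℝ × ℝ => localDensity f φ (u + z.1 • X) a b z.2 := by
  simp only [localDensity, deriv_add_smul hu hX, Pi.add_apply, Pi.smul_apply, smul_eq_mul]
  have h₁ := hu.coord
  have h₂ := hu.deriv_infty.coord
  have h₃ := hX.coord
  have h₄ := hX.deriv_infty.coord
  have h₅ := ha.1.coord
  have h₆ := ha.1.deriv_infty.coord
  have h₇ := hb.1.coord
  have h₈ := hb.1.deriv_infty.coord
  rw [Fin.forall_fin_two] at h₁ h₂ h₃ h₄ h₅ h₆ h₇ h₈
  obtain ⟨U, eU⟩ : ∃ F : ℝ → ℝ, ∀ x, u x 0 = F x := ⟨_, fun _ => rfl⟩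
  obtain ⟨V, eV⟩ : ∃ F : ℝ → ℝ, ∀ x, u x 1 = F x := ⟨_, fun _ => rfl⟩
  obtain ⟨U', eU'⟩ : ∃ F : ℝ → ℝ, ∀ x, deriv u x 0 = F x := ⟨_, fun _ => rfl⟩
  obtain ⟨V', eV'⟩ : ∃ F : ℝ → ℝ, ∀ x, deriv u x 1 = F x := ⟨_, fun _ => rfl⟩
  obtain ⟨X₁, eX₁⟩ : ∃ F : ℝ → ℝ, ∀ x, X x 0 = F x := ⟨_, fun _ => rfl⟩
  obtain ⟨X₂, eX₂⟩ : ∃ F : ℝ → ℝ, ∀ x, X x 1 = F x := ⟨_, fun _ => rfl⟩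
  obtain ⟨X₁', eX₁'⟩ : ∃ F : ℝ → ℝ, ∀ x, deriv X x 0 = F x := ⟨_, fun _ => rfl⟩
  obtain ⟨X₂', eX₂'⟩ : ∃ F : ℝ → ℝ, ∀ x, deriv X x 1 = F x := ⟨_, fun _ => rfl⟩
  obtain ⟨A₁, eA₁⟩ : ∃ F : ℝ → ℝ, ∀ x, a x 0 = F x := ⟨_, fun _ => rfl⟩
  obtain ⟨A₂, eA₂⟩ : ∃ F : ℝ → ℝ, ∀ x, a x 1 = F x := ⟨_, fun _ => rfl⟩
  obtain ⟨A₁', eA₁'⟩ : ∃ F : ℝ → ℝ, ∀ x, deriv a x 0 = F x := ⟨_, fun _ => rfl⟩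
  obtain ⟨A₂', eA₂'⟩ : ∃ F : ℝ → ℝ, ∀ x, deriv a x 1 = F x := ⟨_, fun _ => rfl⟩
  obtain ⟨B₁, eB₁⟩ : ∃ F : ℝ → ℝ, ∀ x, b x 0 = F x := ⟨_, fun _ => rfl⟩
  obtain ⟨B₂, eB₂⟩ : ∃ F : ℝ → ℝ, ∀ x, b x 1 = F x := ⟨_, fun _ => rfl⟩
  obtain ⟨B₁', eB₁'⟩ : ∃ F : ℝ → ℝ, ∀ x, deriv b x 0 = F x := ⟨_, fun _ => rfl⟩
  obtain ⟨B₂', eB₂'⟩ : ∃ F : ℝ → ℝ, ∀ x, deriv b x 1 = F x := ⟨_, fun _ => rfl⟩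
  simp only [eU, eV, eU', eV', eX₁, eX₂, eX₁', eX₂',
    eA₁, eA₂, eA₁', eA₂', eB₁, eB₂, eB₁', eB₂'] at *
  obtain ⟨_, _⟩ := h₁
  obtain ⟨_, _⟩ := h₂
  obtain ⟨_, _⟩ := h₃
  obtain ⟨_, _⟩ := h₄
  obtain ⟨_, _⟩ := h₅
  obtain ⟨_, _⟩ := h₆
  obtain ⟨_, _⟩ := h₇
  obtain ⟨_, _⟩ := h₈
  fun_prop

theorem contDiff_speedFlux_line (hf : ContDiff ℝ ∞ f) (hφ : ContDiff ℝ ∞ φ)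
    (hu : ContDiff ℝ ∞ u) (hX : ContDiff ℝ ∞ X) (ha : IsTestCovector a) :
    ContDiff ℝ ∞ fun z : ℝ × ℝ => speedFlux f φ (u + z.1 • X) a z.2 := by
  simp only [speedFlux, speed₁, speed₂, deriv_add_smul hu hX, Pi.add_apply, Pi.smul_apply,
    smul_eq_mul]
  have h₁ := hu.coord
  have h₂ := hu.deriv_infty.coord
  have h₃ := hX.coord
  have h₄ := hX.deriv_infty.coord
  have h₅ := ha.1.coord
  have h₆ := hf.deriv_infty
  have h₇ := hφ.deriv_infty
  rw [Fin.forall_fin_two] at h₁ h₂ h₃ h₄ h₅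
  obtain ⟨U, eU⟩ : ∃ F : ℝ → ℝ, ∀ x, u x 0 = F x := ⟨_, fun _ => rfl⟩
  obtain ⟨V, eV⟩ : ∃ F : ℝ → ℝ, ∀ x, u x 1 = F x := ⟨_, fun _ => rfl⟩
  obtain ⟨U', eU'⟩ : ∃ F : ℝ → ℝ, ∀ x, deriv u x 0 = F x := ⟨_, fun _ => rfl⟩
  obtain ⟨V', eV'⟩ : ∃ F : ℝ → ℝ, ∀ x, deriv u x 1 = F x := ⟨_, fun _ => rfl⟩
  obtain ⟨X₁, eX₁⟩ : ∃ F : ℝ → ℝ, ∀ x, X x 0 = F x := ⟨_, fun _ => rfl⟩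
  obtain ⟨X₂, eX₂⟩ : ∃ F : ℝ → ℝ, ∀ x, X x 1 = F x := ⟨_, fun _ => rfl⟩
  obtain ⟨X₁', eX₁'⟩ : ∃ F : ℝ → ℝ, ∀ x, deriv X x 0 = F x := ⟨_, fun _ => rfl⟩
  obtain ⟨X₂', eX₂'⟩ : ∃ F : ℝ → ℝ, ∀ x, deriv X x 1 = F x := ⟨_, fun _ => rfl⟩
  obtain ⟨A₁, eA₁⟩ : ∃ F : ℝ → ℝ, ∀ x, a x 0 = F x := ⟨_, fun _ => rfl⟩
  obtain ⟨A₂, eA₂⟩ : ∃ F : ℝ → ℝ, ∀ x, a x 1 = F x := ⟨_, fun _ => rfl⟩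
  simp only [eU, eV, eU', eV', eX₁, eX₂, eX₁', eX₂',
    eA₁, eA₂] at *
  obtain ⟨_, _⟩ := h₁
  obtain ⟨_, _⟩ := h₂
  obtain ⟨_, _⟩ := h₃
  obtain ⟨_, _⟩ := h₄
  obtain ⟨_, _⟩ := h₅
  fun_prop

theorem continuous_localVariation (hf : ContDiff ℝ ∞ f) (hφ : ContDiff ℝ ∞ φ)
    (hu : ContDiff ℝ ∞ u) (hX : ContDiff ℝ ∞ X) (ha : IsTestCovector a) (hb : IsTestCovector b) :
    Continuous (localVariation f φ u X a b) := by
  unfold localVariation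
  have h₁ := fun i => (hu.coord i).continuous
  have h₂ := fun i => (hu.deriv_infty.coord i).continuous
  have h₃ := fun i => (hX.coord i).continuous
  have h₄ := fun i => (hX.deriv_infty.coord i).continuous
  have h₅ := fun i => (ha.1.coord i).continuous
  have h₆ := fun i => (ha.1.deriv_infty.coord i).continuous
  have h₇ := fun i => (hb.1.coord i).continuous
  have h₈ := fun i => (hb.1.deriv_infty.coord i).continuous
  have := hf.continuous
  have := hφ.continuous
  have := hf.deriv_infty.continuous
  have := hφ.deriv_infty.continuous
  rw [Fin.forall_fin_two] at h₁ h₂ h₃ h₄ h₅ h₆ h₇ h₈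
  obtain ⟨U, eU⟩ : ∃ F : ℝ → ℝ, ∀ x, u x 0 = F x := ⟨_, fun _ => rfl⟩
  obtain ⟨V, eV⟩ : ∃ F : ℝ → ℝ, ∀ x, u x 1 = F x := ⟨_, fun _ => rfl⟩
  obtain ⟨U', eU'⟩ : ∃ F : ℝ → ℝ, ∀ x, deriv u x 0 = F x := ⟨_, fun _ => rfl⟩
  obtain ⟨V', eV'⟩ : ∃ F : ℝ → ℝ, ∀ x, deriv u x 1 = F x := ⟨_, fun _ => rfl⟩
  obtain ⟨X₁, eX₁⟩ : ∃ F : ℝ → ℝ, ∀ x, X x 0 = F x := ⟨_, fun _ => rfl⟩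
  obtain ⟨X₂, eX₂⟩ : ∃ F : ℝ → ℝ, ∀ x, X x 1 = F x := ⟨_, fun _ => rfl⟩
  obtain ⟨X₁', eX₁'⟩ : ∃ F : ℝ → ℝ, ∀ x, deriv X x 0 = F x := ⟨_, fun _ => rfl⟩
  obtain ⟨X₂', eX₂'⟩ : ∃ F : ℝ → ℝ, ∀ x, deriv X x 1 = F x := ⟨_, fun _ => rfl⟩
  obtain ⟨A₁, eA₁⟩ : ∃ F : ℝ → ℝ, ∀ x, a x 0 = F x := ⟨_, fun _ => rfl⟩
  obtain ⟨A₂, eA₂⟩ : ∃ F : ℝ → ℝ, ∀ x, a x 1 = F x := ⟨_, fun _ => rfl⟩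
  obtain ⟨A₁', eA₁'⟩ : ∃ F : ℝ → ℝ, ∀ x, deriv a x 0 = F x := ⟨_, fun _ => rfl⟩
  obtain ⟨A₂', eA₂'⟩ : ∃ F : ℝ → ℝ, ∀ x, deriv a x 1 = F x := ⟨_, fun _ => rfl⟩
  obtain ⟨B₁, eB₁⟩ : ∃ F : ℝ → ℝ, ∀ x, b x 0 = F x := ⟨_, fun _ => rfl⟩
  obtain ⟨B₂, eB₂⟩ : ∃ F : ℝ → ℝ, ∀ x, b x 1 = F x := ⟨_, fun _ => rfl⟩
  obtain ⟨B₁', eB₁'⟩ : ∃ F : ℝ → ℝ, ∀ x, deriv b x 0 = F x := ⟨_, fun _ => rfl⟩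
  obtain ⟨B₂', eB₂'⟩ : ∃ F : ℝ → ℝ, ∀ x, deriv b x 1 = F x := ⟨_, fun _ => rfl⟩
  simp only [eU, eV, eU', eV', eX₁, eX₂, eX₁', eX₂',
    eA₁, eA₂, eA₁', eA₂', eB₁, eB₂, eB₁', eB₂'] at *
  obtain ⟨_, _⟩ := h₁
  obtain ⟨_, _⟩ := h₂
  obtain ⟨_, _⟩ := h₃
  obtain ⟨_, _⟩ := h₄
  obtain ⟨_, _⟩ := h₅
  obtain ⟨_, _⟩ := h₆
  obtain ⟨_, _⟩ := h₇
  obtain ⟨_, _⟩ := h₈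
  fun_prop

theorem continuous_speedVariation (hf : ContDiff ℝ ∞ f) (hφ : ContDiff ℝ ∞ φ)
    (hu : ContDiff ℝ ∞ u) (hX : ContDiff ℝ ∞ X) (ha : IsTestCovector a) :
    Continuous (speedVariation f φ u X a) := by
  unfold speedVariation
  have h₁ := fun i => (hu.coord i).continuous
  have h₂ := fun i => (hu.deriv_infty.coord i).continuous
  have h₃ := fun i => (hX.coord i).continuous
  have h₄ := fun i => (hX.deriv_infty.coord i).continuous
  have h₅ := fun i => (ha.1.coord i).continuous
  have := hf.deriv_infty.continuous
  have := hφ.deriv_infty.continuous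
  have := hf.deriv_infty.deriv_infty.continuous
  have := hφ.deriv_infty.deriv_infty.continuous
  have := (contDiff_speed₁ hf hφ hu).continuous
  have := (contDiff_speed₂ hf hφ hu).continuous
  rw [Fin.forall_fin_two] at h₁ h₂ h₃ h₄ h₅
  obtain ⟨W₁, eW₁⟩ : ∃ F : ℝ → ℝ, ∀ x, speed₁ f φ (u x) = F x := ⟨_, fun _ => rfl⟩
  obtain ⟨W₂, eW₂⟩ : ∃ F : ℝ → ℝ, ∀ x, speed₂ f φ (u x) = F x := ⟨_, fun _ => rfl⟩
  obtain ⟨U, eU⟩ : ∃ F : ℝ → ℝ, ∀ x, u x 0 = F x := ⟨_, fun _ => rfl⟩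
  obtain ⟨V, eV⟩ : ∃ F : ℝ → ℝ, ∀ x, u x 1 = F x := ⟨_, fun _ => rfl⟩
  obtain ⟨U', eU'⟩ : ∃ F : ℝ → ℝ, ∀ x, deriv u x 0 = F x := ⟨_, fun _ => rfl⟩
  obtain ⟨V', eV'⟩ : ∃ F : ℝ → ℝ, ∀ x, deriv u x 1 = F x := ⟨_, fun _ => rfl⟩
  obtain ⟨X₁, eX₁⟩ : ∃ F : ℝ → ℝ, ∀ x, X x 0 = F x := ⟨_, fun _ => rfl⟩
  obtain ⟨X₂, eX₂⟩ : ∃ F : ℝ → ℝ, ∀ x, X x 1 = F x := ⟨_, fun _ => rfl⟩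
  obtain ⟨X₁', eX₁'⟩ : ∃ F : ℝ → ℝ, ∀ x, deriv X x 0 = F x := ⟨_, fun _ => rfl⟩
  obtain ⟨X₂', eX₂'⟩ : ∃ F : ℝ → ℝ, ∀ x, deriv X x 1 = F x := ⟨_, fun _ => rfl⟩
  obtain ⟨A₁, eA₁⟩ : ∃ F : ℝ → ℝ, ∀ x, a x 0 = F x := ⟨_, fun _ => rfl⟩
  obtain ⟨A₂, eA₂⟩ : ∃ F : ℝ → ℝ, ∀ x, a x 1 = F x := ⟨_, fun _ => rfl⟩
  simp only [eW₁, eW₂, eU, eV, eU', eV', eX₁, eX₂, eX₁', eX₂', eA₁, eA₂] at *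
  obtain ⟨_, _⟩ := h₁
  obtain ⟨_, _⟩ := h₂
  obtain ⟨_, _⟩ := h₃
  obtain ⟨_, _⟩ := h₄
  obtain ⟨_, _⟩ := h₅
  fun_prop

theorem hasCompactSupport_speedVariation (f φ : ℝ → ℝ) (u X : ℝ → Fin 2 → ℝ)
    (ha : IsTestCovector a) : HasCompactSupport (speedVariation f φ u X a) :=
  HasCompactSupport.intro ha.2.isCompact fun x hx => by
    simp [speedVariation, coord_eq_zero_of_notMem_tsupport hx]

theorem hasCompactSupport_localVariation (f φ : ℝ → ℝ) (u X b : ℝ → Fin 2 → ℝ)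
    (ha : IsTestCovector a) : HasCompactSupport (localVariation f φ u X a b) :=
  HasCompactSupport.intro ha.2.isCompact fun x hx => by
    simp [localVariation, coord_eq_zero_of_notMem_tsupport hx]

theorem continuous_bracketVariation (hf : ContDiff ℝ ∞ f) (hφ : ContDiff ℝ ∞ φ)
    (hu : ContDiff ℝ ∞ u) (hX : ContDiff ℝ ∞ X) (ha : IsTestCovector a) (hb : IsTestCovector b) :
    Continuous (bracketVariation f φ u X a b) := by
  have := continuous_localVariation hf hφ hu hX ha hb
  have := continuous_speedVariation hf hφ hu hX ha
  have := continuous_speedVariation hf hφ hu hX hb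
  have := (contDiff_transFlux hX ha).continuous
  have := (contDiff_transFlux hX hb).continuous
  have := (contDiff_invD (contDiff_transFlux hu ha) (hasCompactSupport_transFlux u ha)).continuous
  have := (contDiff_invD (contDiff_transFlux hu hb) (hasCompactSupport_transFlux u hb)).continuous
  have := (contDiff_invD (contDiff_speedFlux hf hφ hu ha)
    (hasCompactSupport_speedFlux f φ u ha)).continuous
  have := (contDiff_invD (contDiff_speedFlux hf hφ hu hb)
    (hasCompactSupport_speedFlux f φ u hb)).continuous
  unfold bracketVariation
  fun_prop

theorem hasCompactSupport_bracketVariation (f φ : ℝ → ℝ) (u X : ℝ → Fin 2 → ℝ)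
    (ha : IsTestCovector a) (hb : IsTestCovector b) :
    HasCompactSupport (bracketVariation f φ u X a b) :=
  ((((hasCompactSupport_localVariation f φ u X b ha).add
    (hasCompactSupport_speedVariation f φ u X ha).mul_right).sub
    (hasCompactSupport_speedVariation f φ u X hb).mul_left).add
    (hasCompactSupport_transFlux X ha).mul_right).sub (hasCompactSupport_transFlux X hb).mul_left

/-- The direct derivative contains antiderivatives of `transFlux X`, which for X = J c would be
nested. Skew-symmetry of `invD` moves the antiderivative onto `speedFlux` at the unperturbed field,
and what remains is local in X. -/
theorem hasDerivAt_linBracket (hf : ContDiff ℝ ∞ f) (hφ : ContDiff ℝ ∞ φ)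
    (hu : ContDiff ℝ ∞ u) (hX : ContDiff ℝ ∞ X) (ha : IsTestCovector a) (hb : IsTestCovector b) :
    HasDerivAt
      (fun s : ℝ => linBracket (chaplyginOperator f φ).toFieldOperator a b (u + s • X))
      (∫ x, bracketVariation f φ u X a b x) 0 := by
  have hlin : ∀ s : ℝ, linBracket (chaplyginOperator f φ).toFieldOperator a b (u + s • X) =
      ∫ x, (localDensity f φ (u + s • X) a b x + speedFlux f φ (u + s • X) a x *
        (invD (transFlux u b) x + s * invD (transFlux X b) x) -
        (invD (transFlux u a) x + s * invD (transFlux X a) x) *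
          speedFlux f φ (u + s • X) b x) := fun s => by
    have hus : ContDiff ℝ ∞ (u + s • X) := hu.add (hX.const_smul s)
    rw [linBracket_chaplyginOperator hf hφ hus ha hb]
    simp only [invD_transFlux_add_smul hu hX ha, invD_transFlux_add_smul hu hX hb]
  have hpa := contDiff_transFlux hX ha
  have hpa' := hasCompactSupport_transFlux X ha
  have hpb := contDiff_transFlux hX hb
  have hpb' := hasCompactSupport_transFlux X hb
  have hqa := contDiff_speedFlux hf hφ hu ha
  have hqa' := hasCompactSupport_speedFlux f φ u ha
  have hqb := contDiff_speedFlux hf hφ hu hb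
  have hqb' := hasCompactSupport_speedFlux f φ u hb
  have hPa := contDiff_invD hpa hpa'
  have hPb := contDiff_invD hpb hpb'
  have hQa := contDiff_invD hqa hqa'
  have hQb := contDiff_invD hqb hqb'
  have hPa₀ := contDiff_invD (contDiff_transFlux hu ha) (hasCompactSupport_transFlux u ha)
  have hPb₀ := contDiff_invD (contDiff_transFlux hu hb) (hasCompactSupport_transFlux u hb)
  have i₁ := integral_mul_invD_add hpa.continuous hpa' hqb.continuous hqb'
  have i₂ := integral_mul_invD_add hqa.continuous hqa' hpb.continuous hpb'
  have c₁ : Integrable fun x => transFlux X a x * invD (speedFlux f φ u b) x +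
      invD (transFlux X a) x * speedFlux f φ u b x :=
    Continuous.integrable_of_hasCompactSupport (by
      have := hpa.continuous; have := hqb.continuous; have := hQb.continuous
      have := hPa.continuous; fun_prop) (hpa'.mul_right.add hqb'.mul_left)
  have c₂ : Integrable fun x => speedFlux f φ u a x * invD (transFlux X b) x +
      invD (speedFlux f φ u a) x * transFlux X b x :=
    Continuous.integrable_of_hasCompactSupport (by
      have := hpb.continuous; have := hqa.continuous; have := hQa.continuous
      have := hPb.continuous; fun_prop) (hqa'.mul_right.add hpb'.mul_left)
  have c₀ : Integrable (bracketVariation f φ u X a b) :=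
    (continuous_bracketVariation hf hφ hu hX ha hb).integrable_of_hasCompactSupport
      (hasCompactSupport_bracketVariation f φ u X ha hb)
  simp only [hlin]
  have key := hasDerivAt_integral_of_contDiff (G := fun z : ℝ × ℝ =>
      localDensity f φ (u + z.1 • X) a b z.2 + speedFlux f φ (u + z.1 • X) a z.2 *
        (invD (transFlux u b) z.2 + z.1 * invD (transFlux X b) z.2) -
        (invD (transFlux u a) z.2 + z.1 * invD (transFlux X a) z.2) *
          speedFlux f φ (u + z.1 • X) b z.2)
    -- The literal pointwise derivative is `bracketVariation` corrected by two pairs of the form p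
    -- (D⁻¹q) + (D⁻¹p) q, whose integrals are zero by `i₁` and `i₂`.
    (G' := fun x => bracketVariation f φ u X a b x -
      (transFlux X a x * invD (speedFlux f φ u b) x +
        invD (transFlux X a) x * speedFlux f φ u b x) +
      (speedFlux f φ u a x * invD (transFlux X b) x +
        invD (speedFlux f φ u a) x * transFlux X b x)) (ha.2.isCompact.union hb.2.isCompact)
    ?_ ?_ ?_
  · have e := integral_add (c₀.sub c₁) c₂
    simp only [Pi.sub_apply] at e
    rwa [e, integral_sub c₀ c₁, i₁, i₂, sub_zero, add_zero] at key
  · have := contDiff_localDensity_line hf hφ hu hX ha hb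
    have := contDiff_speedFlux_line hf hφ hu hX ha
    have := contDiff_speedFlux_line hf hφ hu hX hb
    exact ContDiff.of_le (by fun_prop : ContDiff ℝ ∞ _) (by norm_num)
  · intro s x hx
    have hxa : x ∉ tsupport a := fun h => hx (Or.inl h)
    have hxb : x ∉ tsupport b := fun h => hx (Or.inr h)
    simp [localDensity, speedFlux, coord_eq_zero_of_notMem_tsupport hxa,
      coord_eq_zero_of_notMem_tsupport hxb]
  · intro x
    refine (((hasDerivAt_localDensity hf hφ hu hX a b x).add
      ((hasDerivAt_speedFlux hf hφ hu hX a x).mul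
        (hasDerivAt_line (invD (transFlux u b) x) (invD (transFlux X b) x)))).sub
      ((hasDerivAt_line (invD (transFlux u a) x) (invD (transFlux X a) x)).mul (hasDerivAt_speedFlux hf hφ hu hX b x))).congr_deriv ?_
    simp only [bracketVariation, zero_smul, add_zero, zero_mul]
    ring

end Variation

/-! ### The Jacobi identity as an exact derivative -/

section Jacobi

variable {f φ : ℝ → ℝ} {u a b c : ℝ → Fin 2 → ℝ}

theorem hasDerivAt_speed₁ (hf : ContDiff ℝ ∞ f) (hφ : ContDiff ℝ ∞ φ) (hu : ContDiff ℝ ∞ u)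
    (x : ℝ) : HasDerivAt (fun x => speed₁ f φ (u x))
      ((1 / 2) * ((u x 0 - u x 1) * (deriv (deriv f) (u x 0) * deriv u x 0) -
        deriv u x 1 * deriv f (u x 0) - deriv φ (u x 1) * deriv u x 1)) x := by
  have h₀ := hu.hasDerivAt_coord 0 x
  have h₁ := hu.hasDerivAt_coord 1 x
  refine (((((h₀.sub h₁).mul ((hf.deriv_infty.hasDerivAt_deriv _).comp x h₀)).sub
    ((hf.hasDerivAt_deriv _).comp x h₀)).sub ((hφ.hasDerivAt_deriv _).comp x h₁)).const_mul
    (1 / 2)).congr_deriv ?_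
  simp only [Function.comp, Pi.sub_apply]
  ring

theorem hasDerivAt_speed₂ (hf : ContDiff ℝ ∞ f) (hφ : ContDiff ℝ ∞ φ) (hu : ContDiff ℝ ∞ u)
    (x : ℝ) : HasDerivAt (fun x => speed₂ f φ (u x))
      ((1 / 2) * ((u x 1 - u x 0) * (deriv (deriv φ) (u x 1) * deriv u x 1) -
        deriv u x 0 * deriv φ (u x 1) - deriv f (u x 0) * deriv u x 0)) x := by
  have h₀ := hu.hasDerivAt_coord 0 x
  have h₁ := hu.hasDerivAt_coord 1 x
  refine (((((h₁.sub h₀).mul ((hφ.deriv_infty.hasDerivAt_deriv _).comp x h₁)).sub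
    ((hf.hasDerivAt_deriv _).comp x h₀)).sub ((hφ.hasDerivAt_deriv _).comp x h₁)).const_mul
    (1 / 2)).congr_deriv ?_
  simp only [Function.comp, Pi.sub_apply]
  ring

/-- The variation formulas involve X_x, hence for X = J a the derivative of the operator.
Differentiating P_a and Q_a returns the fluxes themselves, so no new nonlocal quantity appears. -/
theorem deriv_chaplyginOperator_zero (hf : ContDiff ℝ ∞ f) (hφ : ContDiff ℝ ∞ φ)
    (hu : ContDiff ℝ ∞ u) (ha : IsTestCovector a) (x : ℝ) :
    deriv ((chaplyginOperator f φ).toFieldOperator u a) x 0 =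
      (u x 0 - u x 1) ^ 2 * f (u x 0) * deriv (deriv a) x 0 +
      (2 * (u x 0 - u x 1) * (deriv u x 0 - deriv u x 1) * f (u x 0) +
        (u x 0 - u x 1) ^ 2 * (deriv f (u x 0) * deriv u x 0)) * deriv a x 0 +
      (u x 0 - u x 1) * ((1 / 2) * (u x 0 - u x 1) * deriv f (u x 0) * deriv u x 0 +
        f (u x 0) * (deriv u x 0 - deriv u x 1)) * deriv a x 0 +
      ((deriv u x 0 - deriv u x 1) * ((1 / 2) * (u x 0 - u x 1) * deriv f (u x 0) * deriv u x 0 +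
        f (u x 0) * (deriv u x 0 - deriv u x 1)) + (u x 0 - u x 1) *
        ((1 / 2) * (deriv u x 0 - deriv u x 1) * deriv f (u x 0) * deriv u x 0 +
         (1 / 2) * (u x 0 - u x 1) * (deriv (deriv f) (u x 0) * deriv u x 0) * deriv u x 0 +
         (1 / 2) * (u x 0 - u x 1) * deriv f (u x 0) * deriv (deriv u) x 0 +
         deriv f (u x 0) * deriv u x 0 * (deriv u x 0 - deriv u x 1) +
         f (u x 0) * (deriv (deriv u) x 0 - deriv (deriv u) x 1))) * a x 0 +
      (u x 0 - u x 1) * (φ (u x 1) * deriv u x 0 + f (u x 0) * deriv u x 1) * deriv a x 1 +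
      ((deriv u x 0 - deriv u x 1) * (φ (u x 1) * deriv u x 0 + f (u x 0) * deriv u x 1) +
        (u x 0 - u x 1) * (deriv φ (u x 1) * deriv u x 1 * deriv u x 0 +
          φ (u x 1) * deriv (deriv u) x 0 + deriv f (u x 0) * deriv u x 0 * deriv u x 1 +
          f (u x 0) * deriv (deriv u) x 1)) * a x 1 +
      ((1 / 2) * ((u x 0 - u x 1) * (deriv (deriv f) (u x 0) * deriv u x 0) -
        deriv u x 1 * deriv f (u x 0) - deriv φ (u x 1) * deriv u x 1) * deriv u x 0 +
        speed₁ f φ (u x) * deriv (deriv u) x 0) * invD (transFlux u a) x +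
      speed₁ f φ (u x) * deriv u x 0 * transFlux u a x +
      deriv (deriv u) x 0 * invD (speedFlux f φ u a) x + deriv u x 0 * speedFlux f φ u a x := by
  have h := (contDiff_chaplyginOperator hf hφ hu ha).hasDerivAt_coord 0 x
  simp only [chaplyginOperator_apply_zero] at h
  refine h.unique ?_
  have h₀ := hu.hasDerivAt_coord 0 x
  have h₁ := hu.hasDerivAt_coord 1 x
  have k₀ := hu.deriv_infty.hasDerivAt_coord 0 x
  have k₁ := hu.deriv_infty.hasDerivAt_coord 1 x
  have a₀ := ha.1.hasDerivAt_coord 0 x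
  have a₁ := ha.1.hasDerivAt_coord 1 x
  have a₂ := ha.1.deriv_infty.hasDerivAt_coord 0 x
  have hf₀ := (hf.hasDerivAt_deriv _).comp x h₀
  have hf₁ := (hf.deriv_infty.hasDerivAt_deriv _).comp x h₀
  have hφ₀ := (hφ.hasDerivAt_deriv _).comp x h₁
  have hw := hasDerivAt_speed₁ hf hφ hu x
  have hP := hasDerivAt_invD (contDiff_transFlux hu ha).continuous
    (hasCompactSupport_transFlux u ha) x
  have hQ := hasDerivAt_invD (contDiff_speedFlux hf hφ hu ha).continuous
    (hasCompactSupport_speedFlux f φ u ha) x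
  have hd := h₀.sub h₁
  refine ((((hd.pow 2).mul hf₀).mul a₂ |>.add
    ((hd.mul ((((hd.const_mul (1 / 2)).mul hf₁).mul k₀).add (hf₀.mul (k₀.sub k₁)))).mul a₀)
    |>.add ((hd.mul ((hφ₀.mul k₀).add (hf₀.mul k₁))).mul a₁)
    |>.add ((hw.mul k₀).mul hP) |>.add (k₀.mul hQ))).congr_deriv ?_
  simp only [Function.comp, Pi.sub_apply, Pi.mul_apply, Pi.add_apply, Pi.pow_apply]
  push_cast
  ring

theorem deriv_chaplyginOperator_one (hf : ContDiff ℝ ∞ f) (hφ : ContDiff ℝ ∞ φ)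
    (hu : ContDiff ℝ ∞ u) (ha : IsTestCovector a) (x : ℝ) :
    deriv ((chaplyginOperator f φ).toFieldOperator u a) x 1 =
      (u x 0 - u x 1) ^ 2 * φ (u x 1) * deriv (deriv a) x 1 +
      (2 * (u x 0 - u x 1) * (deriv u x 0 - deriv u x 1) * φ (u x 1) +
        (u x 0 - u x 1) ^ 2 * (deriv φ (u x 1) * deriv u x 1)) * deriv a x 1 +
      (u x 0 - u x 1) * ((1 / 2) * (u x 0 - u x 1) * deriv φ (u x 1) * deriv u x 1 +
        φ (u x 1) * (deriv u x 0 - deriv u x 1)) * deriv a x 1 +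
      ((deriv u x 0 - deriv u x 1) * ((1 / 2) * (u x 0 - u x 1) * deriv φ (u x 1) * deriv u x 1 +
        φ (u x 1) * (deriv u x 0 - deriv u x 1)) + (u x 0 - u x 1) *
        ((1 / 2) * (deriv u x 0 - deriv u x 1) * deriv φ (u x 1) * deriv u x 1 +
         (1 / 2) * (u x 0 - u x 1) * (deriv (deriv φ) (u x 1) * deriv u x 1) * deriv u x 1 +
         (1 / 2) * (u x 0 - u x 1) * deriv φ (u x 1) * deriv (deriv u) x 1 +
         deriv φ (u x 1) * deriv u x 1 * (deriv u x 0 - deriv u x 1) +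
         φ (u x 1) * (deriv (deriv u) x 0 - deriv (deriv u) x 1))) * a x 1 -
      (u x 0 - u x 1) * (φ (u x 1) * deriv u x 0 + f (u x 0) * deriv u x 1) * deriv a x 0 -
      ((deriv u x 0 - deriv u x 1) * (φ (u x 1) * deriv u x 0 + f (u x 0) * deriv u x 1) +
        (u x 0 - u x 1) * (deriv φ (u x 1) * deriv u x 1 * deriv u x 0 +
          φ (u x 1) * deriv (deriv u) x 0 + deriv f (u x 0) * deriv u x 0 * deriv u x 1 +
          f (u x 0) * deriv (deriv u) x 1)) * a x 0 +
      ((1 / 2) * ((u x 1 - u x 0) * (deriv (deriv φ) (u x 1) * deriv u x 1) -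
        deriv u x 0 * deriv φ (u x 1) - deriv f (u x 0) * deriv u x 0) * deriv u x 1 +
        speed₂ f φ (u x) * deriv (deriv u) x 1) * invD (transFlux u a) x +
      speed₂ f φ (u x) * deriv u x 1 * transFlux u a x +
      deriv (deriv u) x 1 * invD (speedFlux f φ u a) x + deriv u x 1 * speedFlux f φ u a x := by
  have h := (contDiff_chaplyginOperator hf hφ hu ha).hasDerivAt_coord 1 x
  simp only [chaplyginOperator_apply_one] at h
  refine h.unique ?_
  have h₀ := hu.hasDerivAt_coord 0 x
  have h₁ := hu.hasDerivAt_coord 1 x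
  have k₀ := hu.deriv_infty.hasDerivAt_coord 0 x
  have k₁ := hu.deriv_infty.hasDerivAt_coord 1 x
  have a₀ := ha.1.hasDerivAt_coord 0 x
  have a₁ := ha.1.hasDerivAt_coord 1 x
  have a₂ := ha.1.deriv_infty.hasDerivAt_coord 1 x
  have hf₀ := (hf.hasDerivAt_deriv _).comp x h₀
  have hφ₀ := (hφ.hasDerivAt_deriv _).comp x h₁
  have hφ₁ := (hφ.deriv_infty.hasDerivAt_deriv _).comp x h₁
  have hw := hasDerivAt_speed₂ hf hφ hu x
  have hP := hasDerivAt_invD (contDiff_transFlux hu ha).continuous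
    (hasCompactSupport_transFlux u ha) x
  have hQ := hasDerivAt_invD (contDiff_speedFlux hf hφ hu ha).continuous
    (hasCompactSupport_speedFlux f φ u ha) x
  have hd := h₀.sub h₁
  refine ((((hd.pow 2).mul hφ₀).mul a₂ |>.sub
    ((hd.mul ((hφ₀.mul k₀).add (hf₀.mul k₁))).mul a₀) |>.add
    ((hd.mul ((((hd.const_mul (1 / 2)).mul hφ₁).mul k₁).add (hφ₀.mul (k₀.sub k₁)))).mul a₁)
    |>.add ((hw.mul k₁).mul hP) |>.add (k₁.mul hQ))).congr_deriv ?_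
  simp only [Function.comp, Pi.sub_apply, Pi.mul_apply, Pi.add_apply, Pi.pow_apply]
  push_cast
  ring

/-- The determinant of a triple of triples of functions. -/
noncomputable def tripleDet (p₁ p₂ p₃ q₁ q₂ q₃ r₁ r₂ r₃ : ℝ) : ℝ :=
  p₁ * (q₂ * r₃ - q₃ * r₂) + p₂ * (q₃ * r₁ - q₁ * r₃) + p₃ * (q₁ * r₂ - q₂ * r₁)

theorem HasDerivAt.tripleDet {p₁ p₂ p₃ q₁ q₂ q₃ r₁ r₂ r₃ : ℝ → ℝ}
    {p₁' p₂' p₃' q₁' q₂' q₃' r₁' r₂' r₃' x : ℝ}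
    (hp₁ : HasDerivAt p₁ p₁' x) (hp₂ : HasDerivAt p₂ p₂' x) (hp₃ : HasDerivAt p₃ p₃' x)
    (hq₁ : HasDerivAt q₁ q₁' x) (hq₂ : HasDerivAt q₂ q₂' x) (hq₃ : HasDerivAt q₃ q₃' x)
    (hr₁ : HasDerivAt r₁ r₁' x) (hr₂ : HasDerivAt r₂ r₂' x) (hr₃ : HasDerivAt r₃ r₃' x) :
    HasDerivAt (fun x => _root_.tripleDet (p₁ x) (p₂ x) (p₃ x) (q₁ x) (q₂ x) (q₃ x)
        (r₁ x) (r₂ x) (r₃ x))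
      (_root_.tripleDet p₁' p₂' p₃' (q₁ x) (q₂ x) (q₃ x) (r₁ x) (r₂ x) (r₃ x) +
        _root_.tripleDet (p₁ x) (p₂ x) (p₃ x) q₁' q₂' q₃' (r₁ x) (r₂ x) (r₃ x) +
        _root_.tripleDet (p₁ x) (p₂ x) (p₃ x) (q₁ x) (q₂ x) (q₃ x) r₁' r₂' r₃') x := by
  refine ((hp₁.mul ((hq₂.mul hr₃).sub (hq₃.mul hr₂))).add
    (hp₂.mul ((hq₃.mul hr₁).sub (hq₁.mul hr₃))) |>.add
    (hp₃.mul ((hq₁.mul hr₂).sub (hq₂.mul hr₁)))).congr_deriv ?_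
  simp only [_root_.tripleDet, Pi.sub_apply, Pi.mul_apply]
  ring

/-- A function of `x` whose derivative is the density of the Jacobi identity. -/
noncomputable def jacobiPotential (f φ : ℝ → ℝ) (u a b c : ℝ → Fin 2 → ℝ) (x : ℝ) : ℝ :=
  (u x 0 - u x 1) ^ 3 * (f (u x 0) * φ (u x 1)) *
    (tripleDet (a x 0) (b x 0) (c x 0) (a x 1) (b x 1) (c x 1)
      (deriv a x 0) (deriv b x 0) (deriv c x 0) +
     tripleDet (a x 0) (b x 0) (c x 0) (a x 1) (b x 1) (c x 1)
      (deriv a x 1) (deriv b x 1) (deriv c x 1)) -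
  (u x 0 - u x 1) * (speed₂ f φ (u x) * φ (u x 1) * deriv u x 0 +
    speed₁ f φ (u x) * f (u x 0) * deriv u x 1) *
    tripleDet (invD (transFlux u a) x) (invD (transFlux u b) x) (invD (transFlux u c) x)
      (a x 0) (b x 0) (c x 0) (a x 1) (b x 1) (c x 1) -
  (u x 0 - u x 1) * (φ (u x 1) * deriv u x 0 + f (u x 0) * deriv u x 1) *
    tripleDet (invD (speedFlux f φ u a) x) (invD (speedFlux f φ u b) x)
      (invD (speedFlux f φ u c) x) (a x 0) (b x 0) (c x 0) (a x 1) (b x 1) (c x 1) -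
  (u x 0 - u x 1) ^ 2 * (f (u x 0) * (speed₁ f φ (u x) *
    tripleDet (invD (transFlux u a) x) (invD (transFlux u b) x) (invD (transFlux u c) x)
      (a x 0) (b x 0) (c x 0) (deriv a x 0) (deriv b x 0) (deriv c x 0) +
    tripleDet (invD (speedFlux f φ u a) x) (invD (speedFlux f φ u b) x)
      (invD (speedFlux f φ u c) x)
      (a x 0) (b x 0) (c x 0) (deriv a x 0) (deriv b x 0) (deriv c x 0))) -
  (u x 0 - u x 1) ^ 2 * (φ (u x 1) * (speed₂ f φ (u x) *
    tripleDet (invD (transFlux u a) x) (invD (transFlux u b) x) (invD (transFlux u c) x)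
      (a x 1) (b x 1) (c x 1) (deriv a x 1) (deriv b x 1) (deriv c x 1) +
    tripleDet (invD (speedFlux f φ u a) x) (invD (speedFlux f φ u b) x)
      (invD (speedFlux f φ u c) x)
      (a x 1) (b x 1) (c x 1) (deriv a x 1) (deriv b x 1) (deriv c x 1)))

-- The heart of the Hamiltonian property. The cyclic sum is alternating in a, b, c, which is why the
-- potential is a combination of 3×3 determinants in the values and derivatives of the covectors and
-- in the P and Q. Its coefficients are such that all second derivatives of the field and covectors
-- match; no sign or nonvanishing condition on f and φ enters.
set_option maxHeartbeats 4000000 in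
theorem hasDerivAt_jacobiPotential (hf : ContDiff ℝ ∞ f) (hφ : ContDiff ℝ ∞ φ)
    (hu : ContDiff ℝ ∞ u) (ha : IsTestCovector a) (hb : IsTestCovector b)
    (hc : IsTestCovector c) (x : ℝ) :
    HasDerivAt (jacobiPotential f φ u a b c)
      (bracketVariation f φ u ((chaplyginOperator f φ).toFieldOperator u c) a b x +
        bracketVariation f φ u ((chaplyginOperator f φ).toFieldOperator u a) b c x +
        bracketVariation f φ u ((chaplyginOperator f φ).toFieldOperator u b) c a x) x := by
  have h₀ := hu.hasDerivAt_coord 0 x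
  have h₁ := hu.hasDerivAt_coord 1 x
  have k₀ := hu.deriv_infty.hasDerivAt_coord 0 x
  have k₁ := hu.deriv_infty.hasDerivAt_coord 1 x
  have a₀ := ha.1.hasDerivAt_coord 0 x
  have a₁ := ha.1.hasDerivAt_coord 1 x
  have a₂ := ha.1.deriv_infty.hasDerivAt_coord 0 x
  have a₃ := ha.1.deriv_infty.hasDerivAt_coord 1 x
  have b₀ := hb.1.hasDerivAt_coord 0 x
  have b₁ := hb.1.hasDerivAt_coord 1 x
  have b₂ := hb.1.deriv_infty.hasDerivAt_coord 0 x
  have b₃ := hb.1.deriv_infty.hasDerivAt_coord 1 x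
  have c₀ := hc.1.hasDerivAt_coord 0 x
  have c₁ := hc.1.hasDerivAt_coord 1 x
  have c₂ := hc.1.deriv_infty.hasDerivAt_coord 0 x
  have c₃ := hc.1.deriv_infty.hasDerivAt_coord 1 x
  have hf₀ := (hf.hasDerivAt_deriv _).comp x h₀
  have hφ₀ := (hφ.hasDerivAt_deriv _).comp x h₁
  have hw₁ := hasDerivAt_speed₁ hf hφ hu x
  have hw₂ := hasDerivAt_speed₂ hf hφ hu x
  have hP := fun {a} (ha : IsTestCovector a) =>
    hasDerivAt_invD (contDiff_transFlux hu ha).continuous (hasCompactSupport_transFlux u ha) x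
  have hQ := fun {a} (ha : IsTestCovector a) =>
    hasDerivAt_invD (contDiff_speedFlux hf hφ hu ha).continuous
      (hasCompactSupport_speedFlux f φ u ha) x
  have hd := h₀.sub h₁
  refine (((hd.pow 3).mul (hf₀.mul hφ₀)).mul ((a₀.tripleDet b₀ c₀ a₁ b₁ c₁ a₂ b₂ c₂).add
      (a₀.tripleDet b₀ c₀ a₁ b₁ c₁ a₃ b₃ c₃)) |>.sub
    ((hd.mul (((hw₂.mul hφ₀).mul k₀).add ((hw₁.mul hf₀).mul k₁))).mul
      ((hP ha).tripleDet (hP hb) (hP hc) a₀ b₀ c₀ a₁ b₁ c₁)) |>.sub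
    ((hd.mul ((hφ₀.mul k₀).add (hf₀.mul k₁))).mul
      ((hQ ha).tripleDet (hQ hb) (hQ hc) a₀ b₀ c₀ a₁ b₁ c₁)) |>.sub
    ((hd.pow 2).mul (hf₀.mul ((hw₁.mul ((hP ha).tripleDet (hP hb) (hP hc) a₀ b₀ c₀ a₂ b₂ c₂)).add
      ((hQ ha).tripleDet (hQ hb) (hQ hc) a₀ b₀ c₀ a₂ b₂ c₂)))) |>.sub
    ((hd.pow 2).mul (hφ₀.mul ((hw₂.mul ((hP ha).tripleDet (hP hb) (hP hc) a₁ b₁ c₁ a₃ b₃ c₃)).add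
      ((hQ ha).tripleDet (hQ hb) (hQ hc) a₁ b₁ c₁ a₃ b₃ c₃))))).congr_deriv ?_
  simp only [bracketVariation, localVariation, speedVariation,
    deriv_chaplyginOperator_zero hf hφ hu ha, deriv_chaplyginOperator_one hf hφ hu ha,
    deriv_chaplyginOperator_zero hf hφ hu hb, deriv_chaplyginOperator_one hf hφ hu hb,
    deriv_chaplyginOperator_zero hf hφ hu hc, deriv_chaplyginOperator_one hf hφ hu hc,
    chaplyginOperator_apply_zero, chaplyginOperator_apply_one, transFlux, speedFlux,
    tripleDet, speed₁, speed₂, Function.comp, Pi.sub_apply, Pi.mul_apply, Pi.add_apply,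
    Pi.pow_apply]
  push_cast
  -- Outside the arguments of f, φ and their derivatives, the values u and v enter only through
  -- their difference. Once d, the jets and the values of f, φ, P, Q are treated as independent
  -- variables, the claim is a polynomial identity.
  obtain ⟨d, hd⟩ : ∃ d, u x 0 - u x 1 = d := ⟨_, rfl⟩
  have hd' : u x 1 - u x 0 = -d := by rw [← hd]; ring
  simp only [hd, hd']
  generalize f (u x 0) = f₀
  generalize φ (u x 1) = φ₀
  generalize deriv f (u x 0) = f₁
  generalize deriv φ (u x 1) = φ₁
  generalize deriv (deriv f) (u x 0) = f₂
  generalize deriv (deriv φ) (u x 1) = φ₂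
  generalize deriv (deriv u) x 0 = u₂
  generalize deriv (deriv u) x 1 = v₂
  generalize deriv u x 0 = u₁
  generalize deriv u x 1 = v₁
  generalize invD (transFlux u a) x = Pa
  generalize invD (transFlux u b) x = Pb
  generalize invD (transFlux u c) x = Pc
  generalize invD (speedFlux f φ u a) x = Qa
  generalize invD (speedFlux f φ u b) x = Qb
  generalize invD (speedFlux f φ u c) x = Qc
  ring

end Jacobi

/-! ### Globally smooth parameters: vanishing cyclic sum and linearity -/

section Global

variable {f φ : ℝ → ℝ} {u a b c : ℝ → Fin 2 → ℝ}

/-- P and Q do not vanish at infinity, but every determinant has at least two rows made of the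
covectors or their derivatives. -/
theorem hasCompactSupport_jacobiPotential (f φ : ℝ → ℝ) (u : ℝ → Fin 2 → ℝ)
    (ha : IsTestCovector a) (hb : IsTestCovector b) (hc : IsTestCovector c) :
    HasCompactSupport (jacobiPotential f φ u a b c) := by
  refine HasCompactSupport.intro
    ((ha.2.isCompact.union hb.2.isCompact).union hc.2.isCompact) fun x hx => ?_
  have hxa : x ∉ tsupport a := fun h => hx (Or.inl (Or.inl h))
  have hxb : x ∉ tsupport b := fun h => hx (Or.inl (Or.inr h))
  have hxc : x ∉ tsupport c := fun h => hx (Or.inr h)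
  simp [jacobiPotential, tripleDet, coord_eq_zero_of_notMem_tsupport hxa,
    coord_eq_zero_of_notMem_tsupport hxb, coord_eq_zero_of_notMem_tsupport hxc]

theorem integral_bracketVariation_cyclic (hf : ContDiff ℝ ∞ f) (hφ : ContDiff ℝ ∞ φ)
    (hu : ContDiff ℝ ∞ u) (ha : IsTestCovector a) (hb : IsTestCovector b)
    (hc : IsTestCovector c) :
    (∫ x, bracketVariation f φ u ((chaplyginOperator f φ).toFieldOperator u c) a b x) +
      (∫ x, bracketVariation f φ u ((chaplyginOperator f φ).toFieldOperator u a) b c x) +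
      ∫ x, bracketVariation f φ u ((chaplyginOperator f φ).toFieldOperator u b) c a x = 0 := by
  have hJ := fun {a} (ha : IsTestCovector a) => contDiff_chaplyginOperator hf hφ hu ha
  have hcont := fun {a b c} (ha : IsTestCovector a) (hb : IsTestCovector b)
    (hc : IsTestCovector c) => continuous_bracketVariation hf hφ hu (hJ hc) ha hb
  have hint := fun {a b c} (ha : IsTestCovector a) (hb : IsTestCovector b)
      (hc : IsTestCovector c) =>
    (hcont ha hb hc).integrable_of_hasCompactSupport (μ := volume)
      (hasCompactSupport_bracketVariation f φ u _ ha hb)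
  have e := integral_add ((hint ha hb hc).add (hint hb hc ha)) (hint hc ha hb)
  simp only [Pi.add_apply] at e
  rw [← integral_add (hint ha hb hc) (hint hb hc ha), ← e]
  exact integral_eq_zero_of_hasDerivAt (hasCompactSupport_jacobiPotential f φ u ha hb hc)
    (hasDerivAt_jacobiPotential hf hφ hu ha hb hc)
    (((hcont ha hb hc).add (hcont hb hc ha)).add (hcont hc ha hb))

theorem integrable_transFlux (hu : ContDiff ℝ ∞ u) (ha : IsTestCovector a) :
    Integrable (transFlux u a) :=
  (contDiff_transFlux hu ha).continuous.integrable_of_hasCompactSupport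
    (hasCompactSupport_transFlux u ha)

theorem integrable_speedFlux (hf : ContDiff ℝ ∞ f) (hφ : ContDiff ℝ ∞ φ)
    (hu : ContDiff ℝ ∞ u) (ha : IsTestCovector a) : Integrable (speedFlux f φ u a) :=
  (contDiff_speedFlux hf hφ hu ha).continuous.integrable_of_hasCompactSupport
    (hasCompactSupport_speedFlux f φ u ha)

theorem IsTestCovector.add (ha : IsTestCovector a) (hb : IsTestCovector b) :
    IsTestCovector (a + b) :=
  ⟨ha.1.add hb.1, ha.2.add hb.2⟩

theorem chaplyginOperator_map_add (hf : ContDiff ℝ ∞ f) (hφ : ContDiff ℝ ∞ φ)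
    (hu : ContDiff ℝ ∞ u) (ha : IsTestCovector a) (hb : IsTestCovector b) :
    (chaplyginOperator f φ).toFieldOperator u (a + b) =
      (chaplyginOperator f φ).toFieldOperator u a + (chaplyginOperator f φ).toFieldOperator u b := by
  have hd : ∀ x, deriv (a + b) x = deriv a x + deriv b x := fun x =>
    ((ha.1.hasDerivAt_deriv x).add (hb.1.hasDerivAt_deriv x)).deriv
  have h₁ : transFlux u (a + b) = fun x => transFlux u a x + transFlux u b x := by
    ext x; simp only [transFlux, Pi.add_apply]; ring
  have h₂ : speedFlux f φ u (a + b) = fun x => speedFlux f φ u a x + speedFlux f φ u b x := by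
    ext x; simp only [speedFlux, Pi.add_apply]; ring
  ext x i
  fin_cases i <;>
  simp only [Fin.zero_eta, Fin.mk_one, Pi.add_apply, chaplyginOperator_apply_zero,
    chaplyginOperator_apply_one, hd, h₁, h₂,
    invD_add (integrable_transFlux hu ha) (integrable_transFlux hu hb),
    invD_add (integrable_speedFlux hf hφ hu ha) (integrable_speedFlux hf hφ hu hb)] <;>
  ring

theorem chaplyginOperator_map_smul (f φ : ℝ → ℝ) (u : ℝ → Fin 2 → ℝ) (ha : IsTestCovector a)
    (r : ℝ) : (chaplyginOperator f φ).toFieldOperator u (r • a) =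
      r • (chaplyginOperator f φ).toFieldOperator u a := by
  have hd : ∀ x, deriv (r • a) x = r • deriv a x := fun x =>
    ((ha.1.hasDerivAt_deriv x).const_smul r).deriv
  have h₁ : transFlux u (r • a) = fun x => r * transFlux u a x := by
    ext x; simp only [transFlux, Pi.smul_apply, smul_eq_mul]; ring
  have h₂ : speedFlux f φ u (r • a) = fun x => r * speedFlux f φ u a x := by
    ext x; simp only [speedFlux, Pi.smul_apply, smul_eq_mul]; ring
  ext x i
  fin_cases i <;>
  simp only [Fin.zero_eta, Fin.mk_one, Pi.smul_apply, smul_eq_mul, chaplyginOperator_apply_zero,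
    chaplyginOperator_apply_one, hd, h₁, h₂, invD_const_mul] <;>
  ring

/-- The operator depends linearly on the pair of functions `f`, `φ`. -/
theorem chaplyginOperator_linear {f₁ φ₁ f₂ φ₂ : ℝ → ℝ} (hf₁ : ContDiff ℝ ∞ f₁)
    (hφ₁ : ContDiff ℝ ∞ φ₁) (hf₂ : ContDiff ℝ ∞ f₂) (hφ₂ : ContDiff ℝ ∞ φ₂)
    (hu : ContDiff ℝ ∞ u) (ha : IsTestCovector a) (c₁ c₂ x : ℝ) :
    (chaplyginOperator (c₁ • f₁ + c₂ • f₂) (c₁ • φ₁ + c₂ • φ₂)).toFieldOperator u a x =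
      c₁ • (chaplyginOperator f₁ φ₁).toFieldOperator u a x +
        c₂ • (chaplyginOperator f₂ φ₂).toFieldOperator u a x := by
  have hdf : ∀ t, deriv (c₁ • f₁ + c₂ • f₂) t = c₁ * deriv f₁ t + c₂ * deriv f₂ t := fun t =>
    (((hf₁.hasDerivAt_deriv t).const_smul c₁).add ((hf₂.hasDerivAt_deriv t).const_smul c₂)).deriv
  have hdφ : ∀ t, deriv (c₁ • φ₁ + c₂ • φ₂) t = c₁ * deriv φ₁ t + c₂ * deriv φ₂ t := fun t =>
    (((hφ₁.hasDerivAt_deriv t).const_smul c₁).add ((hφ₂.hasDerivAt_deriv t).const_smul c₂)).deriv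
  have h₂ : speedFlux (c₁ • f₁ + c₂ • f₂) (c₁ • φ₁ + c₂ • φ₂) u a = fun x =>
      c₁ * speedFlux f₁ φ₁ u a x + c₂ * speedFlux f₂ φ₂ u a x := by
    ext x
    simp only [speedFlux, speed₁, speed₂, hdf, hdφ, Pi.add_apply, Pi.smul_apply, smul_eq_mul]
    ring
  ext i
  fin_cases i <;>
  simp only [Fin.zero_eta, Fin.mk_one, Pi.add_apply, Pi.smul_apply, smul_eq_mul,
    chaplyginOperator_apply_zero, chaplyginOperator_apply_one, h₂,
    invD_add ((integrable_speedFlux hf₁ hφ₁ hu ha).const_mul c₁)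
      ((integrable_speedFlux hf₂ hφ₂ hu ha).const_mul c₂), invD_const_mul, speed₁, speed₂,
    hdf, hdφ] <;>
  ring

end Global

/-! ### Localization: parameters defined only on U and V -/

section Local

/-- The action of the operator on covectors supported in `(-R, R)` depends, on that interval, only
on the restriction of the field. -/
theorem chaplyginOperator_congr {f φ g ψ : ℝ → ℝ} {u w b : ℝ → Fin 2 → ℝ} {R : ℝ} {M N : Set ℝ}
    (hM : IsOpen M) (hN : IsOpen N) (hfg : Set.EqOn f g M) (hφψ : Set.EqOn φ ψ N)
    (hu : ∀ x ∈ Set.Ioo (-R) R, u x 0 ∈ M ∧ u x 1 ∈ N) (huw : Set.EqOn u w (Set.Ioo (-R) R))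
    (hb : tsupport b ⊆ Set.Ioo (-R) R) {x : ℝ} (hx : x ∈ Set.Ioo (-R) R) :
    (chaplyginOperator f φ).toFieldOperator u b x =
      (chaplyginOperator g ψ).toFieldOperator w b x := by
  have hd : ∀ y ∈ Set.Ioo (-R) R, deriv u y = deriv w y := fun y hy =>
    (huw.eventuallyEq_of_mem (isOpen_Ioo.mem_nhds hy)).deriv_eq
  have hdf : ∀ t ∈ M, deriv f t = deriv g t := fun t ht =>
    (hfg.eventuallyEq_of_mem (hM.mem_nhds ht)).deriv_eq
  have hdφ : ∀ t ∈ N, deriv φ t = deriv ψ t := fun t ht =>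
    (hφψ.eventuallyEq_of_mem (hN.mem_nhds ht)).deriv_eq
  have hs : ∀ y ∈ Set.Ioo (-R) R, speed₁ f φ (u y) = speed₁ g ψ (w y) ∧
      speed₂ f φ (u y) = speed₂ g ψ (w y) := fun y hy => by
    obtain ⟨h₀, h₁⟩ := hu y hy
    rw [huw hy] at h₀ h₁
    simp only [speed₁, speed₂, hdf _ h₀, hdφ _ h₁, hfg h₀, hφψ h₁, huw hy, and_self]
  -- Off the support of b the fluxes vanish whatever the field is. They thus agree on the whole
  -- line, and so do their antiderivatives.
  have ht : transFlux u b = transFlux w b := by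
    ext y
    by_cases hy : y ∈ tsupport b
    · simp only [transFlux, hd y (hb hy)]
    · simp [transFlux, coord_eq_zero_of_notMem_tsupport hy]
  have hq : speedFlux f φ u b = speedFlux g ψ w b := by
    ext y
    by_cases hy : y ∈ tsupport b
    · simp only [speedFlux, hd y (hb hy), hs y (hb hy)]
    · simp [speedFlux, coord_eq_zero_of_notMem_tsupport hy]
  obtain ⟨h₀, h₁⟩ := hu x hx
  have hsx := hs x hx
  rw [huw hx] at h₀ h₁ hsx
  ext i
  fin_cases i <;>
  simp only [Fin.zero_eta, Fin.mk_one, chaplyginOperator_apply_zero, chaplyginOperator_apply_one,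
    ht, hq, hsx, hd x hx, hdf _ h₀, hdφ _ h₁, hfg h₀, hφψ h₁, huw hx]

/-- Multiply f by a smooth cut-off that is 1 near K and 0 near the complement of U. Agreement on an
open set, and not merely on K, is needed so that the derivatives agree and so that small
perturbations of the field are covered. -/
theorem exists_contDiff_eqOn_nhds {U K : Set ℝ} {f : ℝ → ℝ} (hU : IsOpen U)
    (hf : ContDiffOn ℝ ∞ f U) (hK : IsCompact K) (hKU : K ⊆ U) :
    ∃ (g : ℝ → ℝ) (M : Set ℝ), ContDiff ℝ ∞ g ∧ IsOpen M ∧ K ⊆ M ∧ Set.EqOn f g M := by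
  obtain ⟨χ, h0, h1, -⟩ := exists_contMDiffMap_zero_one_nhds_of_isClosed (n := ⊤)
    (modelWithCornersSelf ℝ ℝ) hU.isClosed_compl hK.isClosed
    (Set.disjoint_left.2 fun x hx hxK => hx (hKU hxK))
  have hχ : ContDiff ℝ ∞ χ := χ.contMDiff.contDiff
  obtain ⟨M, hM, hKM, hM1⟩ := eventually_nhdsSet_iff_exists.1 h1
  refine ⟨fun t => χ t * f t, M, ?_, hM, hKM, fun t ht => by simp [hM1 t ht]⟩
  rw [contDiff_iff_contDiffAt]
  intro t
  by_cases ht : t ∈ U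
  · exact hχ.contDiffAt.mul (hf.contDiffAt (hU.mem_nhds ht))
  · refine (contDiffAt_const (c := (0 : ℝ))).congr_of_eventuallyEq ?_
    filter_upwards [(eventually_nhdsSet_iff_forall.1 h0) t ht] with s hs
    simp [hs]

theorem linBracket_congr {n : ℕ} {J K : FieldOperator n} {a b u w : ℝ → Fin n → ℝ} {R : ℝ}
    (ha : tsupport a ⊆ Set.Ioo (-R) R) (h : ∀ x ∈ Set.Ioo (-R) R, J u b x = K w b x) :
    linBracket J a b u = linBracket K a b w := by
  unfold linBracket
  congr 1
  ext x
  by_cases hx : x ∈ tsupport a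
  · rw [h x (ha hx)]
  · simp [image_eq_zero_of_notMem_tsupport hx]

/-- The lower bound r lets the interval contain a prescribed point too; the quantifier over S allows
a common radius for several covectors. -/
theorem IsTestCovector.exists_tsupport_subset {n : ℕ} {a : ℝ → Fin n → ℝ} (ha : IsTestCovector a)
    (r : ℝ) : ∃ R : ℝ, r < R ∧ ∀ S, R ≤ S → tsupport a ⊆ Set.Ioo (-S) S := by
  obtain ⟨R, hR⟩ := ha.2.isCompact.isBounded.subset_ball_lt r 0
  refine ⟨R, hR.1, fun S hS => hR.2.trans ?_⟩
  rw [Real.ball_eq_Ioo, zero_sub, zero_add]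
  exact Set.Ioo_subset_Ioo (neg_le_neg hS) hS

/-- On a bounded interval a linear combination of two operators acts, on fields close to a given
one, as an operator with globally smooth parameters. -/
theorem exists_contDiff_parameters {U V : Set ℝ} (hU : IsOpen U) (hV : IsOpen V)
    {f₁ φ₁ f₂ φ₂ : ℝ → ℝ} (hf₁ : ContDiffOn ℝ ∞ f₁ U) (hφ₁ : ContDiffOn ℝ ∞ φ₁ V)
    (hf₂ : ContDiffOn ℝ ∞ f₂ U) (hφ₂ : ContDiffOn ℝ ∞ φ₂ V) (c₁ c₂ : ℝ)
    {u : ℝ → Fin 2 → ℝ} (hu : IsSmoothField (offDiagonal U V) u) (R : ℝ) :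
    ∃ (f φ : ℝ → ℝ) (M N : Set ℝ), ContDiff ℝ ∞ f ∧ ContDiff ℝ ∞ φ ∧ IsOpen M ∧ IsOpen N ∧
      (∀ x ∈ Set.Icc (-R) R, u x 0 ∈ M ∧ u x 1 ∈ N) ∧
      ∀ w v b : ℝ → Fin 2 → ℝ, ContDiff ℝ ∞ v → IsTestCovector b → tsupport b ⊆ Set.Ioo (-R) R →
        Set.EqOn w v (Set.Ioo (-R) R) → (∀ x ∈ Set.Ioo (-R) R, v x 0 ∈ M ∧ v x 1 ∈ N) →
        ∀ x ∈ Set.Ioo (-R) R,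
          (c₁ • (chaplyginOperator f₁ φ₁).toFieldOperator +
            c₂ • (chaplyginOperator f₂ φ₂).toFieldOperator) w b x =
          (chaplyginOperator f φ).toFieldOperator v b x := by
  have hKU : IsCompact ((fun x => u x 0) '' Set.Icc (-R) R) :=
    isCompact_Icc.image (hu.1.coord 0).continuous
  have hKV : IsCompact ((fun x => u x 1) '' Set.Icc (-R) R) :=
    isCompact_Icc.image (hu.1.coord 1).continuous
  have hKU' : (fun x => u x 0) '' Set.Icc (-R) R ⊆ U := by
    rintro _ ⟨x, -, rfl⟩; exact (hu.2 x).1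
  have hKV' : (fun x => u x 1) '' Set.Icc (-R) R ⊆ V := by
    rintro _ ⟨x, -, rfl⟩; exact (hu.2 x).2.1
  obtain ⟨g₁, M₁, hg₁, hM₁, hK₁, e₁⟩ := exists_contDiff_eqOn_nhds hU hf₁ hKU hKU'
  obtain ⟨g₂, M₂, hg₂, hM₂, hK₂, e₂⟩ := exists_contDiff_eqOn_nhds hU hf₂ hKU hKU'
  obtain ⟨ψ₁, N₁, hψ₁, hN₁, hL₁, d₁⟩ := exists_contDiff_eqOn_nhds hV hφ₁ hKV hKV'
  obtain ⟨ψ₂, N₂, hψ₂, hN₂, hL₂, d₂⟩ := exists_contDiff_eqOn_nhds hV hφ₂ hKV hKV'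
  -- By linearity in the parameters the combination of operators is the operator of the combined
  -- cut-off parameters.
  refine ⟨c₁ • g₁ + c₂ • g₂, c₁ • ψ₁ + c₂ • ψ₂, M₁ ∩ M₂, N₁ ∩ N₂,
    (hg₁.const_smul c₁).add (hg₂.const_smul c₂), (hψ₁.const_smul c₁).add (hψ₂.const_smul c₂),
    hM₁.inter hM₂, hN₁.inter hN₂, fun x hx => ⟨⟨hK₁ ⟨x, hx, rfl⟩, hK₂ ⟨x, hx, rfl⟩⟩,
      hL₁ ⟨x, hx, rfl⟩, hL₂ ⟨x, hx, rfl⟩⟩, fun w v b hv hb hbR hwv hvM x hx => ?_⟩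
  rw [chaplyginOperator_linear hg₁ hψ₁ hg₂ hψ₂ hv hb]
  have hw : ∀ x ∈ Set.Ioo (-R) R, w x 0 ∈ M₁ ∩ M₂ ∧ w x 1 ∈ N₁ ∩ N₂ := fun x hx => by
    rw [hwv hx]; exact hvM x hx
  simp only [Pi.add_apply, Pi.smul_apply]
  rw [chaplyginOperator_congr hM₁ hN₁ e₁ d₁ (fun y hy => ⟨(hw y hy).1.1, (hw y hy).2.1⟩) hwv
      hbR hx,
    chaplyginOperator_congr hM₂ hN₂ e₂ d₂ (fun y hy => ⟨(hw y hy).1.2, (hw y hy).2.2⟩) hwv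
      hbR hx]

/-- Compactness gives one range of s for all x in K. On the whole line u + s X may leave the domain
for every s ≠ 0. -/
theorem eventually_forall_mem_of_isCompact {u X : ℝ → Fin 2 → ℝ} {M N K : Set ℝ}
    (hu : Continuous u) (hX : Continuous X) (hK : IsCompact K) (hM : IsOpen M) (hN : IsOpen N)
    (h : ∀ x ∈ K, u x 0 ∈ M ∧ u x 1 ∈ N) :
    ∀ᶠ s : ℝ in 𝓝 0, ∀ x ∈ K, (u + s • X) x 0 ∈ M ∧ (u + s • X) x 1 ∈ N := by
  refine hK.eventually_forall_of_forall_eventually fun x hx => ?_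
  have hc : Continuous fun z : ℝ × ℝ => (u + z.1 • X) z.2 := by
    simp only [Pi.add_apply, Pi.smul_apply]
    fun_prop
  have h₀ := ((continuous_apply (0 : Fin 2)).comp hc).continuousAt (x := ((0 : ℝ), x))
  have h₁ := ((continuous_apply (1 : Fin 2)).comp hc).continuousAt (x := ((0 : ℝ), x))
  exact (h₀.eventually_mem (hM.mem_nhds (by simpa using (h x hx).1))).and
    (h₁.eventually_mem (hN.mem_nhds (by simpa using (h x hx).2)))

/-- Each axiom tests the operator at a point or on finitely many covectors, so a large interval
reduces it to one operator with globally smooth parameters. Zeros of f and φ are allowed, as they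
must be, since combinations of nonvanishing functions can vanish. -/
theorem isHamiltonianOperator_linear_combination {U V : Set ℝ} (hU : IsOpen U) (hV : IsOpen V)
    {f₁ φ₁ f₂ φ₂ : ℝ → ℝ} (hf₁ : ContDiffOn ℝ ∞ f₁ U) (hφ₁ : ContDiffOn ℝ ∞ φ₁ V)
    (hf₂ : ContDiffOn ℝ ∞ f₂ U) (hφ₂ : ContDiffOn ℝ ∞ φ₂ V) (c₁ c₂ : ℝ) :
    IsHamiltonianOperator (offDiagonal U V)
      (c₁ • (chaplyginOperator f₁ φ₁).toFieldOperator +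
        c₂ • (chaplyginOperator f₂ φ₂).toFieldOperator) := by
  have loc := fun {u} (hu : IsSmoothField (offDiagonal U V) u) (R : ℝ) =>
    exists_contDiff_parameters hU hV hf₁ hφ₁ hf₂ hφ₂ c₁ c₂ hu R
  set J : FieldOperator 2 := c₁ • (chaplyginOperator f₁ φ₁).toFieldOperator +
        c₂ • (chaplyginOperator f₂ φ₂).toFieldOperator with hJ
  have smooth : ∀ u a, IsSmoothField (offDiagonal U V) u → IsTestCovector a →
      ContDiff ℝ ∞ (J u a) := by
    intro u a hu ha
    rw [contDiff_iff_contDiffAt]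
    intro x
    obtain ⟨R, hxR, hR⟩ := ha.exists_tsupport_subset |x|
    obtain ⟨f, φ, M, N, hf, hφ, hM, hN, huM, h⟩ := loc hu R
    refine (contDiff_chaplyginOperator hf hφ hu.1 ha).contDiffAt.congr_of_eventuallyEq ?_
    filter_upwards [isOpen_Ioo.mem_nhds (abs_lt.1 hxR)] with y hy
    exact h u u a hu.1 ha (hR R le_rfl) (Set.eqOn_refl _ _)
      (fun z hz => huM z (Set.Ioo_subset_Icc_self hz)) y hy
  refine ⟨smooth, ?_, ?_, ?_, ?_⟩
  · intro u a b hu ha hb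
    ext1 x
    obtain ⟨R₁, hxR₁, hR₁⟩ := ha.exists_tsupport_subset |x|
    obtain ⟨R₂, hxR₂, hR₂⟩ := hb.exists_tsupport_subset |x|
    obtain ⟨R₃, -, hR₃⟩ := (ha.add hb).exists_tsupport_subset |x|
    set R := max (max R₁ R₂) R₃
    have h₁ : R₁ ≤ R := (le_max_left _ _).trans (le_max_left _ _)
    have h₂ : R₂ ≤ R := (le_max_right _ _).trans (le_max_left _ _)
    have h₃ : R₃ ≤ R := le_max_right _ _
    have hx : x ∈ Set.Ioo (-R) R := abs_lt.1 (hxR₁.trans_le h₁)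
    obtain ⟨f, φ, M, N, hf, hφ, hM, hN, huM, h⟩ := loc hu R
    have huM' : ∀ x ∈ Set.Ioo (-R) R, u x 0 ∈ M ∧ u x 1 ∈ N := fun z hz =>
      huM z (Set.Ioo_subset_Icc_self hz)
    rw [Pi.add_apply, h u u _ hu.1 (ha.add hb) (hR₃ R h₃) (Set.eqOn_refl _ _) huM' x hx,
      h u u _ hu.1 ha (hR₁ R h₁) (Set.eqOn_refl _ _) huM' x hx,
      h u u _ hu.1 hb (hR₂ R h₂) (Set.eqOn_refl _ _) huM' x hx,
      chaplyginOperator_map_add hf hφ hu.1 ha hb, Pi.add_apply]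
  · intro u a r hu ha
    ext1 x
    simp only [hJ, Pi.add_apply, Pi.smul_apply, chaplyginOperator_map_smul f₁ φ₁ u ha,
      chaplyginOperator_map_smul f₂ φ₂ u ha, smul_add, smul_comm r]
  · intro u a b hu ha hb
    obtain ⟨R₁, -, hR₁⟩ := ha.exists_tsupport_subset 0
    obtain ⟨R₂, -, hR₂⟩ := hb.exists_tsupport_subset 0
    have ha' := hR₁ _ (le_max_left R₁ R₂)
    have hb' := hR₂ _ (le_max_right R₁ R₂)
    obtain ⟨f, φ, M, N, hf, hφ, hM, hN, huM, h⟩ := loc hu (max R₁ R₂)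
    have h' := fun c hc hcR => h u u c hu.1 hc hcR (Set.eqOn_refl _ _)
      fun z hz => huM z (Set.Ioo_subset_Icc_self hz)
    rw [linBracket_congr ha' (h' b hb hb'), linBracket_congr hb' (h' a ha ha'),
      linBracket_chaplyginOperator hf hφ hu.1 ha hb, linBracket_chaplyginOperator hf hφ hu.1 hb ha,
      ← integral_neg]
    congr 1
    ext x
    simp only [localDensity]
    ring
  · intro u a b c hu ha hb hc
    obtain ⟨R₁, -, hR₁⟩ := ha.exists_tsupport_subset 0
    obtain ⟨R₂, -, hR₂⟩ := hb.exists_tsupport_subset 0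
    obtain ⟨R₃, -, hR₃⟩ := hc.exists_tsupport_subset 0
    set R := max (max R₁ R₂) R₃
    have ha' := hR₁ R ((le_max_left _ _).trans (le_max_left _ _))
    have hb' := hR₂ R ((le_max_right _ _).trans (le_max_left _ _))
    have hc' := hR₃ R (le_max_right _ _)
    obtain ⟨f, φ, M, N, hf, hφ, hM, hN, huM, h⟩ := loc hu R
    have hder : ∀ {a b c}, IsTestCovector a → IsTestCovector b → IsTestCovector c →
        tsupport a ⊆ Set.Ioo (-R) R → tsupport b ⊆ Set.Ioo (-R) R →
        tsupport c ⊆ Set.Ioo (-R) R →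
        HasDerivAt (fun s : ℝ => linBracket J a b (u + s • J u c)) (∫ x,
          bracketVariation f φ u ((chaplyginOperator f φ).toFieldOperator u c) a b x) 0 := by
      intro a b c ha hb hc ha' hb' hc'
      have hX := contDiff_chaplyginOperator hf hφ hu.1 hc
      -- For small s the perturbed field stays, over [-R, R], in the region where the parameters
      -- agree. There J u c also coincides with the globally parametrized X, so both brackets are
      -- equal near s = 0.
      refine (hasDerivAt_linBracket hf hφ hu.1 hX ha hb).congr_of_eventuallyEq ?_
      filter_upwards [eventually_forall_mem_of_isCompact hu.1.continuous hX.continuous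
        (isCompact_Icc (a := -R) (b := R)) hM hN huM] with s hs
      refine linBracket_congr ha' (h _ _ b (hu.1.add (hX.const_smul s)) hb hb' ?_
        fun z hz => hs z (Set.Ioo_subset_Icc_self hz))
      intro z hz
      simp only [Pi.add_apply, Pi.smul_apply]
      rw [h u u c hu.1 hc hc' (Set.eqOn_refl _ _)
        (fun z hz => huM z (Set.Ioo_subset_Icc_self hz)) z hz]
    exact ⟨_, _, _, hder ha hb hc ha' hb' hc', hder hb hc ha hb' hc' ha',
      hder hc ha hb hc' ha' hb', integral_bracketVariation_cyclic hf hφ hu.1 ha hb hc⟩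

end Local

/-! ### Partial derivatives in two variables -/

section PartialDerivatives

variable {h : (Fin 2 → ℝ) → ℝ} {p : Fin 2 → ℝ} {d : ℝ}

theorem hasDerivAt_vec_zero (t y : ℝ) :
    HasDerivAt (fun t => (![t, y] : Fin 2 → ℝ)) (Pi.single 0 1) t := by
  rw [hasDerivAt_pi, Fin.forall_fin_two]
  simpa using ⟨hasDerivAt_id t, hasDerivAt_const t y⟩

theorem hasDerivAt_vec_one (y t : ℝ) :
    HasDerivAt (fun t => (![y, t] : Fin 2 → ℝ)) (Pi.single 1 1) t := by
  rw [hasDerivAt_pi, Fin.forall_fin_two]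
  simpa using ⟨hasDerivAt_const t y, hasDerivAt_id t⟩

theorem vec_eta (p : Fin 2 → ℝ) : ![p 0, p 1] = p := by
  ext i; fin_cases i <;> rfl

theorem hasDerivAt_pderiv_zero (hd : DifferentiableAt ℝ h p) :
    HasDerivAt (fun t => h ![t, p 1]) (pderiv 0 h p) (p 0) := by
  have hh := hd.hasFDerivAt
  rw [← vec_eta p] at hh
  have := hh.comp_hasDerivAt (p 0) (hasDerivAt_vec_zero (p 0) (p 1))
  rwa [vec_eta p] at this

theorem hasDerivAt_pderiv_one (hd : DifferentiableAt ℝ h p) :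
    HasDerivAt (fun t => h ![p 0, t]) (pderiv 1 h p) (p 1) := by
  have hh := hd.hasFDerivAt
  rw [← vec_eta p] at hh
  have := hh.comp_hasDerivAt (p 1) (hasDerivAt_vec_one (p 0) (p 1))
  rwa [vec_eta p] at this

theorem pderiv_zero_eq (hd : DifferentiableAt ℝ h p)
    (hh : HasDerivAt (fun t => h ![t, p 1]) d (p 0)) : pderiv 0 h p = d :=
  (hasDerivAt_pderiv_zero hd).unique hh

theorem pderiv_one_eq (hd : DifferentiableAt ℝ h p)
    (hh : HasDerivAt (fun t => h ![p 0, t]) d (p 1)) : pderiv 1 h p = d :=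
  (hasDerivAt_pderiv_one hd).unique hh

theorem fderiv_eq_pderiv (h : (Fin 2 → ℝ) → ℝ) (p ξ : Fin 2 → ℝ) :
    fderiv ℝ h p ξ = pderiv 0 h p * ξ 0 + pderiv 1 h p * ξ 1 := by
  have : ξ = ξ 0 • Pi.single 0 1 + ξ 1 • Pi.single 1 1 := by
    ext i; fin_cases i <;> simp
  conv_lhs => rw [this]
  simp only [map_add, map_smul, smul_eq_mul, pderiv]
  ring

theorem pderiv_const (i : Fin 2) (r : ℝ) (p : Fin 2 → ℝ) : pderiv i (fun _ => r) p = 0 := by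
  simp [pderiv]

theorem pderiv_coord (i j : Fin 2) (p : Fin 2 → ℝ) :
    pderiv i (fun q => q j) p = if i = j then 1 else 0 := by
  have : HasFDerivAt (fun q : Fin 2 → ℝ => q j) (ContinuousLinearMap.proj (R := ℝ) j) p :=
    hasFDerivAt_apply j p
  rw [pderiv, this.fderiv]
  simp [Pi.single_apply, eq_comm]

end PartialDerivatives

/-! ### Smoothness on the domain Ω -/

section Domain

variable {U V : Set ℝ} {p : Fin 2 → ℝ}

theorem isOpen_offDiagonal (hU : IsOpen U) (hV : IsOpen V) : IsOpen (offDiagonal U V) := by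
  have h₀ : Continuous fun p : Fin 2 → ℝ => p 0 := continuous_apply 0
  have h₁ : Continuous fun p : Fin 2 → ℝ => p 1 := continuous_apply 1
  have hne : IsOpen {p : Fin 2 → ℝ | p 0 ≠ p 1} := (isClosed_eq h₀ h₁).isOpen_compl
  exact (hU.preimage h₀).inter ((hV.preimage h₁).inter hne)

theorem hasDerivAt_of_contDiffOn {f : ℝ → ℝ} {t : ℝ} (hU : IsOpen U) (hf : ContDiffOn ℝ ∞ f U)
    (ht : t ∈ U) : HasDerivAt f (deriv f t) t :=
  ((hf.contDiffAt (hU.mem_nhds ht)).differentiableAt (by simp)).hasDerivAt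

theorem contDiffOn_deriv {f : ℝ → ℝ} (hU : IsOpen U) (hf : ContDiffOn ℝ ∞ f U) :
    ContDiffOn ℝ ∞ (deriv f) U :=
  ((contDiffOn_infty_iff_deriv_of_isOpen hU).1 hf).2

theorem contDiffOn_comp_zero {f : ℝ → ℝ} (hf : ContDiffOn ℝ ∞ f U) (V : Set ℝ) :
    ContDiffOn ℝ ∞ (fun p : Fin 2 → ℝ => f (p 0)) (offDiagonal U V) :=
  hf.comp (contDiff_apply ℝ ℝ (0 : Fin 2)).contDiffOn fun _ hp => hp.1

theorem contDiffOn_comp_one {φ : ℝ → ℝ} (U : Set ℝ) (hφ : ContDiffOn ℝ ∞ φ V) :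
    ContDiffOn ℝ ∞ (fun p : Fin 2 → ℝ => φ (p 1)) (offDiagonal U V) :=
  hφ.comp (contDiff_apply ℝ ℝ (1 : Fin 2)).contDiffOn fun _ hp => hp.2.1

theorem contDiffOn_coord (i : Fin 2) (s : Set (Fin 2 → ℝ)) :
    ContDiffOn ℝ ∞ (fun p : Fin 2 → ℝ => p i) s :=
  (contDiff_apply ℝ ℝ i).contDiffOn

theorem contDiffOn_speed₁ {f φ : ℝ → ℝ} (hU : IsOpen U) (hf : ContDiffOn ℝ ∞ f U)
    (hφ : ContDiffOn ℝ ∞ φ V) : ContDiffOn ℝ ∞ (speed₁ f φ) (offDiagonal U V) :=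
  contDiffOn_const.mul (((((contDiffOn_coord 0 _).sub (contDiffOn_coord 1 _)).mul
    (contDiffOn_comp_zero (contDiffOn_deriv hU hf) V)).sub (contDiffOn_comp_zero hf V)).sub
    (contDiffOn_comp_one U hφ))

theorem contDiffOn_speed₂ {f φ : ℝ → ℝ} (hV : IsOpen V) (hf : ContDiffOn ℝ ∞ f U)
    (hφ : ContDiffOn ℝ ∞ φ V) : ContDiffOn ℝ ∞ (speed₂ f φ) (offDiagonal U V) :=
  contDiffOn_const.mul (((((contDiffOn_coord 1 _).sub (contDiffOn_coord 0 _)).mul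
    (contDiffOn_comp_one U (contDiffOn_deriv hV hφ))).sub (contDiffOn_comp_zero hf V)).sub
    (contDiffOn_comp_one U hφ))

theorem ContDiffOn.differentiableAt_of_isOpen {h : (Fin 2 → ℝ) → ℝ} {s : Set (Fin 2 → ℝ)}
    (hh : ContDiffOn ℝ ∞ h s) (hs : IsOpen s) (hp : p ∈ s) : DifferentiableAt ℝ h p :=
  (hh.contDiffAt (hs.mem_nhds hp)).differentiableAt (by simp)

end Domain

/-! ### The Levi-Civita connection of the metric -/

section Metric

variable {U V : Set ℝ} {f φ : ℝ → ℝ}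

theorem chaplyginMetric_inv {p : Fin 2 → ℝ} (hp : p 0 - p 1 ≠ 0) (hf : f (p 0) ≠ 0)
    (hφ : φ (p 1) ≠ 0) :
    (chaplyginMetric f φ p)⁻¹ = (p 0 - p 1) ^ 2 • !![f (p 0), 0; 0, φ (p 1)] := by
  refine Matrix.inv_eq_right_inv ?_
  ext i j
  fin_cases i <;> fin_cases j <;>
    simp [chaplyginMetric, Matrix.mul_apply, Fin.sum_univ_two] <;> field_simp

/-- The metric is diagonal, so every Christoffel symbol comes from the four partial derivatives of
its two diagonal entries. Nonvanishing of f and φ is needed here for the metric to exist. -/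
theorem localPartOfMetric_chaplygin (hU : IsOpen U) (hV : IsOpen V) (hf : Admissible U f)
    (hφ : Admissible V φ) :
    LocalPartOfMetric (offDiagonal U V) (chaplyginOperator f φ) (chaplyginMetric f φ) := by
  intro p hp
  have hΩ := isOpen_offDiagonal hU hV
  have hd : p 0 - p 1 ≠ 0 := sub_ne_zero.2 hp.2.2
  have hf0 := hf.2 _ hp.1
  have hφ0 := hφ.2 _ hp.2.1
  have hf1 := hasDerivAt_of_contDiffOn hU hf.1 hp.1
  have hφ1 := hasDerivAt_of_contDiffOn hV hφ.1 hp.2.1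
  have hinv := chaplyginMetric_inv hd hf0 hφ0
  have hfp : DifferentiableAt ℝ (fun q : Fin 2 → ℝ => f (q 0)) p :=
    (contDiffOn_comp_zero hf.1 V).differentiableAt_of_isOpen hΩ hp
  have hφp : DifferentiableAt ℝ (fun q : Fin 2 → ℝ => φ (q 1)) p :=
    (contDiffOn_comp_one U hφ.1).differentiableAt_of_isOpen hΩ hp
  have h0p : DifferentiableAt ℝ (fun q : Fin 2 → ℝ => q 0) p := differentiableAt_apply 0 p
  have h1p : DifferentiableAt ℝ (fun q : Fin 2 → ℝ => q 1) p := differentiableAt_apply 1 p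
  have hden₀ : DifferentiableAt ℝ (fun q : Fin 2 → ℝ => (q 0 - q 1) ^ 2 * f (q 0)) p :=
    DifferentiableAt.fun_mul (DifferentiableAt.fun_pow (h0p.fun_sub h1p) 2) hfp
  have hg₀ : DifferentiableAt ℝ (fun q : Fin 2 → ℝ => 1 / ((q 0 - q 1) ^ 2 * f (q 0))) p := by
    have hne := mul_ne_zero (pow_ne_zero 2 hd) hf0
    simpa only [one_div] using hden₀.fun_inv hne
  have hden₁ : DifferentiableAt ℝ (fun q : Fin 2 → ℝ => (q 0 - q 1) ^ 2 * φ (q 1)) p :=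
    DifferentiableAt.fun_mul (DifferentiableAt.fun_pow (h0p.fun_sub h1p) 2) hφp
  have hg₁ : DifferentiableAt ℝ (fun q : Fin 2 → ℝ => 1 / ((q 0 - q 1) ^ 2 * φ (q 1))) p := by
    have hne := mul_ne_zero (pow_ne_zero 2 hd) hφ0
    simpa only [one_div] using hden₁.fun_inv hne
  have h00 : pderiv 0 (fun q : Fin 2 → ℝ => 1 / ((q 0 - q 1) ^ 2 * f (q 0))) p =
      -(2 * (p 0 - p 1) * f (p 0) + (p 0 - p 1) ^ 2 * deriv f (p 0)) /
        ((p 0 - p 1) ^ 2 * f (p 0)) ^ 2 := by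
    refine pderiv_zero_eq hg₀ ?_
    have hs : HasDerivAt (fun t => t - p 1) 1 (p 0) := (hasDerivAt_id _).sub_const _
    refine ((hasDerivAt_const (p 0) (1 : ℝ)).div ((hs.pow 2).mul hf1)
      (mul_ne_zero (pow_ne_zero 2 hd) hf0)).congr_deriv ?_
    simp only [Pi.mul_apply, Pi.pow_apply]
    push_cast
    ring
  have h01 : pderiv 1 (fun q : Fin 2 → ℝ => 1 / ((q 0 - q 1) ^ 2 * f (q 0))) p =
      2 * (p 0 - p 1) * f (p 0) / ((p 0 - p 1) ^ 2 * f (p 0)) ^ 2 := by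
    refine pderiv_one_eq hg₀ ?_
    have hs : HasDerivAt (fun t => p 0 - t) (-1) (p 1) := (hasDerivAt_id _).const_sub _
    refine ((hasDerivAt_const (p 1) (1 : ℝ)).div ((hs.pow 2).mul_const (f (p 0)))
      (mul_ne_zero (pow_ne_zero 2 hd) hf0)).congr_deriv ?_
    simp only [Pi.pow_apply]
    push_cast
    ring
  have h10 : pderiv 0 (fun q : Fin 2 → ℝ => 1 / ((q 0 - q 1) ^ 2 * φ (q 1))) p =
      -(2 * (p 0 - p 1) * φ (p 1)) / ((p 0 - p 1) ^ 2 * φ (p 1)) ^ 2 := by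
    refine pderiv_zero_eq hg₁ ?_
    have hs : HasDerivAt (fun t => t - p 1) 1 (p 0) := (hasDerivAt_id _).sub_const _
    refine ((hasDerivAt_const (p 0) (1 : ℝ)).div ((hs.pow 2).mul_const (φ (p 1)))
      (mul_ne_zero (pow_ne_zero 2 hd) hφ0)).congr_deriv ?_
    simp only [Pi.pow_apply]
    push_cast
    ring
  have h11 : pderiv 1 (fun q : Fin 2 → ℝ => 1 / ((q 0 - q 1) ^ 2 * φ (q 1))) p =
      (2 * (p 0 - p 1) * φ (p 1) - (p 0 - p 1) ^ 2 * deriv φ (p 1)) /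
        ((p 0 - p 1) ^ 2 * φ (p 1)) ^ 2 := by
    refine pderiv_one_eq hg₁ ?_
    have hs : HasDerivAt (fun t => p 0 - t) (-1) (p 1) := (hasDerivAt_id _).const_sub _
    refine ((hasDerivAt_const (p 1) (1 : ℝ)).div ((hs.pow 2).mul hφ1)
      (mul_ne_zero (pow_ne_zero 2 hd) hφ0)).congr_deriv ?_
    simp only [Pi.mul_apply, Pi.pow_apply]
    push_cast
    ring
  have m00 : (fun q => chaplyginMetric f φ q 0 0) = fun q => 1 / ((q 0 - q 1) ^ 2 * f (q 0)) := rfl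
  have m11 : (fun q => chaplyginMetric f φ q 1 1) = fun q => 1 / ((q 0 - q 1) ^ 2 * φ (q 1)) := rfl
  have m01 : (fun q => chaplyginMetric f φ q 0 1) = fun _ => 0 := rfl
  have m10 : (fun q => chaplyginMetric f φ q 1 0) = fun _ => 0 := rfl
  refine ⟨?_, ?_, by rw [hinv]; rfl, fun ξ i j => ?_⟩
  · ext i j
    fin_cases i <;> fin_cases j <;> rfl
  · simp [chaplyginMetric, Matrix.det_fin_two, hd, hf0, hφ0]
  · fin_cases i <;> fin_cases j <;>
      simp only [Fin.zero_eta, Fin.mk_one, christoffel, Fin.sum_univ_two, hinv, m00, m01, m10, m11,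
        h00, h01, h10, h11, pderiv_const] <;>
      simp [chaplyginOperator] <;> field_simp <;> ring

end Metric

/-! ### Commutation of flows as an identity on jets -/

section Flows

variable {n : ℕ} {Ω : Set (Fin n → ℝ)} {V W : (Fin n → ℝ) → Matrix (Fin n) (Fin n) ℝ}

/-- The derivative of `V(u) uₓ` in the direction of `W(u) uₓ`, as a function of `p = u`, `ξ = uₓ`
and `η = uₓₓ`. -/
noncomputable def flowVariation (V W : (Fin n → ℝ) → Matrix (Fin n) (Fin n) ℝ) (p ξ η : Fin n → ℝ) :
    Fin n → ℝ := fun i =>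
  ∑ j, (fderiv ℝ (fun q => V q i j) p (W p *ᵥ ξ) * ξ j +
    V p i j * ∑ k, (fderiv ℝ (fun q => W q j k) p ξ * ξ k + W p j k * η k))

theorem hasDerivAt_hydroFlow {u : ℝ → Fin n → ℝ} {x : ℝ} (hu : ContDiff ℝ ∞ u)
    (hW : ∀ i j, DifferentiableAt ℝ (fun p => W p i j) (u x)) :
    HasDerivAt (hydroFlow W u) (fun i => ∑ k, (fderiv ℝ (fun q => W q i k) (u x) (deriv u x) *
      deriv u x k + W (u x) i k * deriv (deriv u) x k)) x := by
  rw [hasDerivAt_pi]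
  intro i
  simp only [hydroFlow, Matrix.mulVec, dotProduct]
  exact HasDerivAt.fun_sum fun k _ =>
    ((hW i k).hasFDerivAt.comp_hasDerivAt x (hu.hasDerivAt_deriv x)).mul
      (hu.deriv_infty.hasDerivAt_coord k x)

/-- The first sum in `flowVariation` varies the coefficient V(u), the second varies uₓ by the
x-derivative of W(u) uₓ, which brings in uₓₓ. -/
theorem hasDerivAt_hydroFlow_add_smul {u : ℝ → Fin n → ℝ} {x : ℝ} (hu : ContDiff ℝ ∞ u)
    (hV : ∀ i j, DifferentiableAt ℝ (fun p => V p i j) (u x))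
    (hW : ∀ i j, DifferentiableAt ℝ (fun p => W p i j) (u x)) :
    HasDerivAt (fun s : ℝ => hydroFlow V (u + s • hydroFlow W u) x)
      (flowVariation V W (u x) (deriv u x) (deriv (deriv u) x)) 0 := by
  have hY := hasDerivAt_hydroFlow hu hW
  set Y := hydroFlow W u with hYdef
  set Y' : Fin n → ℝ := fun i => ∑ k, (fderiv ℝ (fun q => W q i k) (u x) (deriv u x) *
      deriv u x k + W (u x) i k * deriv (deriv u) x k)
  have hd : ∀ s : ℝ, deriv (u + s • Y) x = deriv u x + s • Y' := fun s =>
    ((hu.hasDerivAt_deriv x).add (hY.const_smul s)).deriv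
  rw [hasDerivAt_pi]
  intro i
  simp only [hydroFlow, Matrix.mulVec, dotProduct, hd, Pi.add_apply, Pi.smul_apply, smul_eq_mul]
  refine HasDerivAt.fun_sum fun j _ => ?_
  have hl : HasDerivAt (fun s : ℝ => u x + s • Y x) (Y x) 0 := by
    simpa using ((hasDerivAt_id (0 : ℝ)).smul_const (Y x)).const_add (u x)
  have hV' : HasFDerivAt (fun p => V p i j) (fderiv ℝ (fun p => V p i j) (u x))
      (u x + (0 : ℝ) • Y x) := by
    rw [zero_smul, add_zero]; exact (hV i j).hasFDerivAt
  refine ((hV'.comp_hasDerivAt (0 : ℝ) hl).mul (hasDerivAt_line _ _)).congr_deriv ?_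
  simp [hYdef, hydroFlow, Y']

/-- The derivatives in `FlowsCommute` always exist for smooth coefficients, so their equality
becomes an algebraic condition on the 2-jet of the field at each point. -/
theorem flowsCommute_iff (hΩ : IsOpen Ω) (hV : ∀ i j, ContDiffOn ℝ ∞ (fun p => V p i j) Ω)
    (hW : ∀ i j, ContDiffOn ℝ ∞ (fun p => W p i j) Ω) :
    FlowsCommute Ω V W ↔ ∀ u, IsSmoothField Ω u → ∀ x,
      flowVariation V W (u x) (deriv u x) (deriv (deriv u) x) =
        flowVariation W V (u x) (deriv u x) (deriv (deriv u) x) := by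
  have hd : ∀ {h : (Fin n → ℝ) → ℝ}, ContDiffOn ℝ ∞ h Ω → ∀ p ∈ Ω, DifferentiableAt ℝ h p :=
    fun h p hp => (h.contDiffAt (hΩ.mem_nhds hp)).differentiableAt (by simp)
  refine forall₂_congr fun u hu => forall_congr' fun x => ?_
  have h₁ := hasDerivAt_hydroFlow_add_smul (x := x) hu.1
    (fun i j => hd (hV i j) _ (hu.2 x)) (fun i j => hd (hW i j) _ (hu.2 x))
  have h₂ := hasDerivAt_hydroFlow_add_smul (x := x) hu.1
    (fun i j => hd (hW i j) _ (hu.2 x)) (fun i j => hd (hV i j) _ (hu.2 x))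
  exact ⟨fun ⟨d, hd₁, hd₂⟩ => (h₁.unique hd₁).trans (hd₂.unique h₂), fun h => ⟨_, h₁, h ▸ h₂⟩⟩

end Flows

/-! ### The commuting flows with speeds w¹, w² -/

section ChaplyginFlow

variable {U V : Set ℝ} {f φ : ℝ → ℝ}

theorem contDiffOn_chaplyginMatrix (i j : Fin 2) (s : Set (Fin 2 → ℝ)) :
    ContDiffOn ℝ ∞ (fun p => chaplyginMatrix p i j) s := by
  fin_cases i <;> fin_cases j <;> simp [chaplyginMatrix] <;>
    first | exact contDiffOn_coord _ s | exact contDiffOn_const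

theorem contDiffOn_speedMatrix (hU : IsOpen U) (hV : IsOpen V) (hf : ContDiffOn ℝ ∞ f U)
    (hφ : ContDiffOn ℝ ∞ φ V) (i j : Fin 2) :
    ContDiffOn ℝ ∞ (fun p => speedMatrix f φ p i j) (offDiagonal U V) := by
  fin_cases i <;> fin_cases j <;> simp [speedMatrix] <;>
    first | exact contDiffOn_speed₁ hU hf hφ | exact contDiffOn_speed₂ hV hf hφ |
      exact contDiffOn_const

theorem pderiv_one_speed₁ (hU : IsOpen U) (hV : IsOpen V) (hf : ContDiffOn ℝ ∞ f U)
    (hφ : ContDiffOn ℝ ∞ φ V) {p : Fin 2 → ℝ} (hp : p ∈ offDiagonal U V) :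
    pderiv 1 (speed₁ f φ) p = -(1 / 2) * (deriv f (p 0) + deriv φ (p 1)) := by
  refine pderiv_one_eq ((contDiffOn_speed₁ hU hf hφ).differentiableAt_of_isOpen
    (isOpen_offDiagonal hU hV) hp) ?_
  refine ((((((hasDerivAt_id (p 1)).const_sub (p 0)).mul_const (deriv f (p 0))).sub_const
    (f (p 0))).sub (hasDerivAt_of_contDiffOn hV hφ hp.2.1)).const_mul (1 / 2)).congr_deriv ?_
  ring

theorem pderiv_zero_speed₂ (hU : IsOpen U) (hV : IsOpen V) (hf : ContDiffOn ℝ ∞ f U)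
    (hφ : ContDiffOn ℝ ∞ φ V) {p : Fin 2 → ℝ} (hp : p ∈ offDiagonal U V) :
    pderiv 0 (speed₂ f φ) p = -(1 / 2) * (deriv f (p 0) + deriv φ (p 1)) := by
  refine pderiv_zero_eq ((contDiffOn_speed₂ hV hf hφ).differentiableAt_of_isOpen
    (isOpen_offDiagonal hU hV) hp) ?_
  refine ((((((hasDerivAt_id (p 0)).const_sub (p 1)).mul_const (deriv φ (p 1))).sub
    (hasDerivAt_of_contDiffOn hU hf hp.1)).sub_const (φ (p 1))).const_mul (1 / 2)).congr_deriv ?_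
  ring

/-- For two diagonal flows the uₓₓ terms cancel, and only ∂w¹/∂v and ∂w²/∂u survive. Both equal -(f'
+ φ')/2, which is (w² - w¹)/(u - v). -/
theorem flowsCommute_chaplygin (hU : IsOpen U) (hV : IsOpen V) (hf : ContDiffOn ℝ ∞ f U)
    (hφ : ContDiffOn ℝ ∞ φ V) :
    FlowsCommute (offDiagonal U V) chaplyginMatrix (speedMatrix f φ) := by
  rw [flowsCommute_iff (isOpen_offDiagonal hU hV) (fun i j => contDiffOn_chaplyginMatrix i j _)
    (contDiffOn_speedMatrix hU hV hf hφ)]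
  intro u hu x
  have h₁ := pderiv_one_speed₁ hU hV hf hφ (hu.2 x)
  have h₂ := pderiv_zero_speed₂ hU hV hf hφ (hu.2 x)
  ext i
  fin_cases i <;>
  simp [flowVariation, Fin.sum_univ_two, chaplyginMatrix, speedMatrix, fderiv_eq_pderiv,
    dotProduct, pderiv_coord, pderiv_const, h₁, h₂] <;>
  simp only [speed₁, speed₂] <;> ring

end ChaplyginFlow

/-! ### Square roots of the parameters and their primitives -/

section RootPrimitive

variable {U : Set ℝ} {f F : ℝ → ℝ}

/-- By the intermediate value theorem a nowhere zero continuous function on an interval has constant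
sign. -/
theorem exists_sign_eq (hU : U.OrdConnected) (hf : Admissible U f) :
    ∃ σ : ℝ, (σ = 1 ∨ σ = -1) ∧ ∀ t ∈ U, Real.sign (f t) = σ ∧ |f t| = σ * f t := by
  have hpre : IsPreconnected U := hU.isPreconnected
  by_cases h : ∃ t ∈ U, 0 < f t
  · obtain ⟨t, ht, hpos⟩ := h
    refine ⟨1, Or.inl rfl, fun s hs => ?_⟩
    have hs0 : 0 < f s := by
      by_contra hneg
      obtain ⟨z, hz, hz0⟩ := hpre.intermediate_value hs ht hf.1.continuousOn
        (show (0 : ℝ) ∈ Set.Icc (f s) (f t) from ⟨not_lt.1 hneg, hpos.le⟩)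
      exact hf.2 z hz hz0
    rw [Real.sign_of_pos hs0, abs_of_pos hs0, one_mul]
    exact ⟨rfl, rfl⟩
  · push Not at h
    refine ⟨-1, Or.inr rfl, fun s hs => ?_⟩
    have hs0 : f s < 0 := lt_of_le_of_ne (h s hs) (hf.2 s hs)
    rw [Real.sign_of_neg hs0, abs_of_neg hs0, neg_one_mul]
    exact ⟨rfl, rfl⟩

/-- With r = √|f| one has f = σ r² and F' = 1/r, so the later calculations are rational in r, r' and
F, and the sign of f enters only through the constant σ. -/
theorem exists_root_data (hUo : IsOpen U) (hU : U.OrdConnected) (hf : Admissible U f)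
    (hF : IsRootPrimitive U f F) :
    ∃ (σ : ℝ) (r : ℝ → ℝ), (σ = 1 ∨ σ = -1) ∧ ContDiffOn ℝ ∞ F U ∧ ∀ t ∈ U,
      Real.sign (f t) = σ ∧ r t ≠ 0 ∧ HasDerivAt F (1 / r t) t ∧ HasDerivAt r (deriv r t) t ∧
      f t = σ * r t ^ 2 ∧ deriv f t = 2 * σ * r t * deriv r t := by
  obtain ⟨σ, hσ, h⟩ := exists_sign_eq hU hf
  have hσ2 : σ * σ = 1 := by rcases hσ with rfl | rfl <;> norm_num
  set r : ℝ → ℝ := fun t => √|f t| with hr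
  have hr0 : ∀ t ∈ U, r t ≠ 0 := fun t ht => (Real.sqrt_pos.2 (abs_pos.2 (hf.2 t ht))).ne'
  have hrC : ContDiffOn ℝ ∞ r U := by
    refine ContDiffOn.congr (f := fun t => √(σ * f t))
      ((contDiffOn_const.mul hf.1).sqrt fun t ht => ?_) fun t ht => ?_
    · rw [← (h t ht).2]; exact abs_ne_zero.2 (hf.2 t ht)
    · rw [hr]; simp only [(h t ht).2]
  have hfr : ∀ t ∈ U, f t = σ * r t ^ 2 := fun t ht => by
    rw [hr]
    simp only
    rw [Real.sq_sqrt (abs_nonneg _), (h t ht).2, ← mul_assoc, hσ2, one_mul]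
  have hFr : ∀ t ∈ U, HasDerivAt F (1 / r t) t := hF
  refine ⟨σ, r, hσ, ?_, fun t ht => ⟨(h t ht).1, hr0 t ht, hFr t ht,
    hasDerivAt_of_contDiffOn hUo hrC ht, hfr t ht, ?_⟩⟩
  · refine (contDiffOn_infty_iff_deriv_of_isOpen hUo).2
      ⟨fun t ht => (hF t ht).differentiableAt.differentiableWithinAt, ?_⟩
    exact ContDiffOn.congr (contDiffOn_const.div hrC hr0) fun t ht => (hF t ht).deriv
  · have he : f =ᶠ[𝓝 t] fun t => σ * r t ^ 2 := by
      filter_upwards [hUo.mem_nhds ht] with s hs using hfr s hs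
    rw [he.deriv_eq, (((hasDerivAt_of_contDiffOn hUo hrC ht).fun_pow 2).const_mul σ).deriv]
    push_cast
    ring

end RootPrimitive

/-! ### The Hamiltonian density of the system -/

section Density

variable {U V : Set ℝ} {f φ F Φ : ℝ → ℝ}

/-- Once explicit antiderivatives are available for both nonlocal terms, the equation is a direct
check. Shifting F or Φ by a constant changes nothing in it, because only F' = 1/r and Φ' = 1/ρ are
used. -/
theorem isHamiltonianSystem_chaplygin (hU : IsOpen U) (hV : IsOpen V) (hU' : U.OrdConnected)
    (hV' : V.OrdConnected) (hf : Admissible U f) (hφ : Admissible V φ)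
    (hF : IsRootPrimitive U f F) (hΦ : IsRootPrimitive V φ Φ) :
    IsHamiltonianSystem (offDiagonal U V) (chaplyginOperator f φ)
      (chaplyginDensity f φ F Φ) chaplyginMatrix := by
  have hΩ := isOpen_offDiagonal hU hV
  obtain ⟨σ, r, hσ, hFC, hr⟩ := exists_root_data hU hU' hf hF
  obtain ⟨τ, ρ, hτ, hΦC, hρ⟩ := exists_root_data hV hV' hφ hΦ
  set h : (Fin 2 → ℝ) → ℝ := fun p =>
    (σ * F (p 0) ^ 2 - τ * Φ (p 1) ^ 2) / (4 * (p 1 - p 0)) with hh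
  have heq : Set.EqOn (chaplyginDensity f φ F Φ) h (offDiagonal U V) := fun p hp => by
    simp only [chaplyginDensity, hh, (hr _ hp.1).1, (hρ _ hp.2.1).1]
  have hd : ∀ p ∈ offDiagonal U V, 4 * (p 1 - p 0) ≠ 0 := fun p hp =>
    mul_ne_zero (by norm_num) (sub_ne_zero.2 hp.2.2.symm)
  have hC : ContDiffOn ℝ ∞ h (offDiagonal U V) :=
    (((contDiffOn_const.mul ((contDiffOn_comp_zero hFC V).pow 2)).sub
      (contDiffOn_const.mul ((contDiffOn_comp_one U hΦC).pow 2))).div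
      (contDiffOn_const.mul ((contDiffOn_coord 1 _).sub (contDiffOn_coord 0 _))) hd)
  have hg₀ : ∀ p ∈ offDiagonal U V, grad (chaplyginDensity f φ F Φ) p 0 =
      2 * σ * F (p 0) / (r (p 0) * (4 * (p 1 - p 0))) +
        (σ * F (p 0) ^ 2 - τ * Φ (p 1) ^ 2) / (4 * (p 1 - p 0) ^ 2) := fun p hp => by
    have he : pderiv 0 (chaplyginDensity f φ F Φ) p = pderiv 0 h p := by
      simp only [pderiv, (heq.eventuallyEq_of_mem (hΩ.mem_nhds hp)).fderiv_eq]
    rw [grad, he]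
    refine pderiv_zero_eq (hC.differentiableAt_of_isOpen hΩ hp) ?_
    obtain ⟨-, hr0, hFd, -⟩ := hr _ hp.1
    have hd' := sub_ne_zero.2 hp.2.2.symm
    refine ((((hFd.fun_pow 2).const_mul σ).sub_const (τ * Φ (p 1) ^ 2)).fun_div
      (((hasDerivAt_id (p 0)).const_sub (p 1)).const_mul 4) (hd p hp)).congr_deriv ?_
    simp only [id]
    push_cast
    field_simp
    ring
  have hg₁ : ∀ p ∈ offDiagonal U V, grad (chaplyginDensity f φ F Φ) p 1 =
      -(2 * τ * Φ (p 1)) / (ρ (p 1) * (4 * (p 1 - p 0))) -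
        (σ * F (p 0) ^ 2 - τ * Φ (p 1) ^ 2) / (4 * (p 1 - p 0) ^ 2) := fun p hp => by
    have he : pderiv 1 (chaplyginDensity f φ F Φ) p = pderiv 1 h p := by
      simp only [pderiv, (heq.eventuallyEq_of_mem (hΩ.mem_nhds hp)).fderiv_eq]
    rw [grad, he]
    refine pderiv_one_eq (hC.differentiableAt_of_isOpen hΩ hp) ?_
    obtain ⟨-, hr0, hFd, -⟩ := hρ _ hp.2.1
    have hd' := sub_ne_zero.2 hp.2.2.symm
    refine ((((hFd.fun_pow 2).const_mul τ).const_sub (σ * F (p 0) ^ 2)).fun_div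
      (((hasDerivAt_id (p 1)).sub_const (p 0)).const_mul 4) (hd p hp)).congr_deriv ?_
    simp only [id]
    push_cast
    field_simp
  -- The first nonlocal argument is uₓ h_u + vₓ h_v, so its antiderivative is the density h itself.
  -- In the second, (u + v)/2 cancels the constants in (r F)' = r' F + 1 and (ρ Φ)' = ρ' Φ + 1. The
  -- constants of integration are those that make the flow come out exactly, with no added multiple
  -- of uₓ or of the w-flow.
  refine ⟨hC.congr heq, ![chaplyginDensity f φ F Φ, fun p => (p 0 + p 1) / 2 -
    (r (p 0) * F (p 0) + ρ (p 1) * Φ (p 1)) / 2 + (f (p 0) + φ (p 1)) *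
      (σ * F (p 0) ^ 2 - τ * Φ (p 1) ^ 2) / (8 * (p 0 - p 1))], fun u hu x => ?_⟩
  have hux := hu.2 x
  have h₀ := hu.1.hasDerivAt_coord 0 x
  have h₁ := hu.1.hasDerivAt_coord 1 x
  obtain ⟨-, hr0, hFd, hrd, hfr, hfr'⟩ := hr _ hux.1
  obtain ⟨-, hρ0, hΦd, hρd, hφρ, hφρ'⟩ := hρ _ hux.2.1
  have kF := hFd.comp x h₀
  have kr := hrd.comp x h₀
  have kΦ := hΦd.comp x h₁
  have kρ := hρd.comp x h₁
  have kf := (hasDerivAt_of_contDiffOn hU hf.1 hux.1).comp x h₀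
  have kφ := (hasDerivAt_of_contDiffOn hV hφ.1 hux.2.1).comp x h₁
  have hne : u x 1 - u x 0 ≠ 0 := sub_ne_zero.2 hux.2.2.symm
  have hne' : u x 0 - u x 1 ≠ 0 := sub_ne_zero.2 hux.2.2
  refine ⟨Fin.forall_fin_two.2 ⟨?_, ?_⟩, ?_⟩
  · have hdh : DifferentiableAt ℝ (chaplyginDensity f φ F Φ) (u x) :=
      (hC.congr heq).differentiableAt_of_isOpen hΩ hux
    refine (hdh.hasFDerivAt.comp_hasDerivAt x (hu.1.hasDerivAt_deriv x)).congr_deriv ?_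
    rw [fderiv_eq_pderiv]
    simp [chaplyginOperator, grad, Matrix.mulVec, dotProduct, Fin.sum_univ_two]
    ring
  · refine ((((h₀.add h₁).div_const 2).sub (((kr.mul kF).add (kρ.mul kΦ)).div_const 2)).add
      (((kf.add kφ).mul (((kF.pow 2).const_mul σ).sub ((kΦ.pow 2).const_mul τ))).div
        ((h₀.sub h₁).const_mul 8) (mul_ne_zero (by norm_num) hne'))).congr_deriv ?_
    simp [chaplyginOperator, Matrix.mulVec, dotProduct, Fin.sum_univ_two, hg₀ _ hux, hg₁ _ hux,
      speed₁, speed₂, hfr, hφρ, hfr', hφρ']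
    -- Splitting into signs makes σ² = τ² = 1 available to `ring`.
    rcases hσ with rfl | rfl <;> rcases hτ with rfl | rfl <;> field_simp <;> ring
  · have k₀ : HasDerivAt (fun y => grad (chaplyginDensity f φ F Φ) (u y) 0)
        (2 * σ * (deriv u x 0 / r (u x 0) / (r (u x 0) * (4 * (u x 1 - u x 0))) -
          F (u x 0) * (deriv r (u x 0) * deriv u x 0 * (4 * (u x 1 - u x 0)) +
            r (u x 0) * (4 * (deriv u x 1 - deriv u x 0))) /
              (r (u x 0) * (4 * (u x 1 - u x 0))) ^ 2) +
        ((2 * σ * F (u x 0) * deriv u x 0 / r (u x 0) -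
          2 * τ * Φ (u x 1) * deriv u x 1 / ρ (u x 1)) / (4 * (u x 1 - u x 0) ^ 2) -
          (σ * F (u x 0) ^ 2 - τ * Φ (u x 1) ^ 2) *
            (8 * (u x 1 - u x 0) * (deriv u x 1 - deriv u x 0)) /
              (4 * (u x 1 - u x 0) ^ 2) ^ 2)) x := by
      simp only [fun y => hg₀ _ (hu.2 y)]
      refine (((kF.const_mul (2 * σ)).fun_div (kr.mul ((h₁.sub h₀).const_mul 4)) ?_).add
        ((((kF.fun_pow 2).const_mul σ).sub ((kΦ.fun_pow 2).const_mul τ)).fun_div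
          (((h₁.sub h₀).fun_pow 2).const_mul 4) ?_)).congr_deriv ?_
      · exact mul_ne_zero hr0 (mul_ne_zero (by norm_num) hne)
      · exact mul_ne_zero (by norm_num) (pow_ne_zero 2 hne)
      · simp only [Function.comp, Pi.mul_apply, Pi.sub_apply]
        push_cast
        field_simp
        ring
    have k₁ : HasDerivAt (fun y => grad (chaplyginDensity f φ F Φ) (u y) 1)
        (-(2 * τ) * (deriv u x 1 / ρ (u x 1) / (ρ (u x 1) * (4 * (u x 1 - u x 0))) -
          Φ (u x 1) * (deriv ρ (u x 1) * deriv u x 1 * (4 * (u x 1 - u x 0)) +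
            ρ (u x 1) * (4 * (deriv u x 1 - deriv u x 0))) /
              (ρ (u x 1) * (4 * (u x 1 - u x 0))) ^ 2) -
        ((2 * σ * F (u x 0) * deriv u x 0 / r (u x 0) -
          2 * τ * Φ (u x 1) * deriv u x 1 / ρ (u x 1)) / (4 * (u x 1 - u x 0) ^ 2) -
          (σ * F (u x 0) ^ 2 - τ * Φ (u x 1) ^ 2) *
            (8 * (u x 1 - u x 0) * (deriv u x 1 - deriv u x 0)) /
              (4 * (u x 1 - u x 0) ^ 2) ^ 2)) x := by
      simp only [fun y => hg₁ _ (hu.2 y)]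
      refine (((kΦ.const_mul (2 * τ)).fun_neg.fun_div (kρ.mul ((h₁.sub h₀).const_mul 4)) ?_).sub
        ((((kF.fun_pow 2).const_mul σ).sub ((kΦ.fun_pow 2).const_mul τ)).fun_div
          (((h₁.sub h₀).fun_pow 2).const_mul 4) ?_)).congr_deriv ?_
      · exact mul_ne_zero hρ0 (mul_ne_zero (by norm_num) hne)
      · exact mul_ne_zero (by norm_num) (pow_ne_zero 2 hne)
      · simp only [Function.comp, Pi.mul_apply, Pi.sub_apply]
        push_cast
        field_simp
        ring
    -- The derivative of the vector-valued gradient may be read off componentwise only once both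
    -- components are known to be differentiable.
    have e₀ := (hasDerivAt_pi.1 (differentiableAt_pi.2 (Fin.forall_fin_two.2
      ⟨k₀.differentiableAt, k₁.differentiableAt⟩)).hasDerivAt 0).unique k₀
    have e₁ := (hasDerivAt_pi.1 (differentiableAt_pi.2 (Fin.forall_fin_two.2
      ⟨k₀.differentiableAt, k₁.differentiableAt⟩)).hasDerivAt 1).unique k₁
    ext i
    fin_cases i
    · simp [chaplyginOperator, hydroFlow, chaplyginMatrix, Matrix.mulVec, dotProduct,
        Fin.sum_univ_two, hg₀ _ hux, hg₁ _ hux, e₀, speed₁, heq hux, hh, hfr, hφρ, hfr']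
      rcases hσ with rfl | rfl <;> rcases hτ with rfl | rfl <;> field_simp <;> ring
    · simp [chaplyginOperator, hydroFlow, chaplyginMatrix, Matrix.mulVec, dotProduct,
        Fin.sum_univ_two, hg₀ _ hux, hg₁ _ hux, e₁, speed₂, heq hux, hh, hfr, hφρ, hφρ']
      rcases hσ with rfl | rfl <;> rcases hτ with rfl | rfl <;> field_simp <;> ring

end Density

/-! ### Locality -/

section Locality

variable {U V : Set ℝ} {f φ : ℝ → ℝ}

/-- The fundamental lemma of the calculus of variations on (0, ∞); continuity upgrades almost
everywhere to everywhere. -/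
theorem eq_zero_of_integral_test_eq_zero {g : ℝ → ℝ} (hg : Continuous g)
    (h : ∀ χ : ℝ → ℝ, ContDiff ℝ ∞ χ → HasCompactSupport χ → tsupport χ ⊆ Set.Ioi 0 →
      ∫ x, χ x * g x = 0) {x : ℝ} (hx : 0 < x) : g x = 0 := by
  have hae := isOpen_Ioi.ae_eq_zero_of_integral_contDiff_smul_eq_zero
    (hg.locallyIntegrable.locallyIntegrableOn (Set.Ioi (0 : ℝ))) (μ := volume) h
  have := Measure.eqOn_open_of_ae_eq (μ := volume) (f := g) (g := fun _ => (0 : ℝ))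
    (U := Set.Ioi 0) ((ae_restrict_iff' measurableSet_Ioi).2 hae) isOpen_Ioi hg.continuousOn
    continuousOn_const
  exact this hx

theorem invD_zero_of_support {g : ℝ → ℝ} (hg : Function.support g ⊆ Set.Ioi 0) :
    invD g 0 = -(1 / 2) * ∫ x, g x := by
  have h₁ : ∫ y in Set.Iic 0, g y = 0 := setIntegral_eq_zero_of_forall_eq_zero fun y hy => by
    by_contra h
    exact absurd (hg h) (Set.notMem_Ioi.2 hy)
  have h₂ : ∫ y in Set.Ioi 0, g y = ∫ y, g y :=
    setIntegral_eq_integral_of_forall_compl_eq_zero fun y hy => by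
      by_contra h
      exact hy (hg h)
  rw [invD, h₁, h₂]
  ring

/-- Take a field u through p at x = 0 and covectors with a single component, supported in x > 0.
Locality kills J a at 0, where only the tail contributes. Up to a nonzero factor the tail is the
integral of χ uₓ (wⁱ(p) + wⁱ(u(x))), so this weight vanishes for all x > 0. Evaluating where the
field returns to p with nonzero velocity gives 2 wⁱ(p) = 0. -/
theorem speeds_eq_zero_of_isLocalOperator (hU : IsOpen U) (hV : IsOpen V)
    (hf : ContDiffOn ℝ ∞ f U) (hφ : ContDiffOn ℝ ∞ φ V)
    (hloc : IsLocalOperator (offDiagonal U V) (chaplyginOperator f φ).toFieldOperator)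
    {p : Fin 2 → ℝ} (hp : p ∈ offDiagonal U V) : speed₁ f φ p = 0 ∧ speed₂ f φ p = 0 := by
  obtain ⟨r, hr, hball⟩ := Metric.isOpen_iff.1 (isOpen_offDiagonal hU hV) p hp
  have hε : r / 2 ≠ 0 := by positivity
  -- Both components oscillate inside the ball of radius r about p; the field is at p with velocity
  -- r/2 ≠ 0 at x = 0 and again at x = 2π.
  set u : ℝ → Fin 2 → ℝ := fun x i => p i + r / 2 * Real.sin x with hu_def
  have hu : IsSmoothField (offDiagonal U V) u := by
    refine ⟨contDiff_pi.2 fun i => contDiff_const.add (contDiff_const.mul Real.contDiff_sin),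
      fun x => hball ?_⟩
    rw [Metric.mem_ball, dist_pi_lt_iff hr]
    intro i
    rw [Real.dist_eq, hu_def]
    simp only [add_sub_cancel_left, abs_mul, abs_of_pos (half_pos hr)]
    nlinarith [Real.abs_sin_le_one x]
  have hu0 : u 0 = p := by ext i; simp [hu_def]
  have hu2 : u (2 * Real.pi) = p := by ext i; simp [hu_def]
  have hdu : ∀ x i, deriv u x i = r / 2 * Real.cos x := fun x i =>
    (hu.1.hasDerivAt_coord i x).unique
      (((Real.hasDerivAt_sin x).const_mul (r / 2)).const_add (p i))
  have hs₁ : Continuous fun x => speed₁ f φ (u x) := by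
    refine continuous_iff_continuousAt.2 fun x => ?_
    exact ContinuousAt.comp (f := u) (((contDiffOn_speed₁ hU hf hφ).differentiableAt_of_isOpen
      (isOpen_offDiagonal hU hV) (hu.2 x)).continuousAt) hu.1.continuous.continuousAt
  have hs₂ : Continuous fun x => speed₂ f φ (u x) := by
    refine continuous_iff_continuousAt.2 fun x => ?_
    exact ContinuousAt.comp (f := u) (((contDiffOn_speed₂ hV hf hφ).differentiableAt_of_isOpen
      (isOpen_offDiagonal hU hV) (hu.2 x)).continuousAt) hu.1.continuous.continuousAt
  have key : ∀ (i : Fin 2) (χ : ℝ → ℝ), ContDiff ℝ ∞ χ → HasCompactSupport χ →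
      tsupport χ ⊆ Set.Ioi 0 → ∃ a : ℝ → Fin 2 → ℝ, (∀ x j, a x j = if j = i then χ x else 0) ∧
      a 0 = 0 ∧ deriv a 0 = 0 ∧ (chaplyginOperator f φ).toFieldOperator u a 0 = 0 ∧
      χ.support ⊆ Set.Ioi 0 := by
    intro i χ hχ hχc hχs
    set a : ℝ → Fin 2 → ℝ := fun x j => if j = i then χ x else 0 with ha_def
    have ha : IsTestCovector a := by
      refine ⟨contDiff_pi.2 fun j => ?_, HasCompactSupport.intro hχc.isCompact fun x hx => ?_⟩
      · by_cases hj : j = i <;> simp only [ha_def, hj, if_true, if_false]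
        exacts [hχ, contDiff_const]
      · ext j; simp [ha_def, image_eq_zero_of_notMem_tsupport hx]
    have h0 : a =ᶠ[𝓝 0] 0 := by
      have : (0 : ℝ) ∉ tsupport χ := fun h => lt_irrefl (0 : ℝ) (hχs h)
      filter_upwards [notMem_tsupport_iff_eventuallyEq.1 this] with x hx
      ext j; simp [ha_def, hx]
    exact ⟨a, fun _ _ => rfl, h0.eq_of_nhds, by rw [h0.deriv_eq]; simp, hloc u a 0 hu ha h0,
      (subset_tsupport χ).trans hχs⟩
  constructor
  · have hz := eq_zero_of_integral_test_eq_zero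
      (g := fun x => Real.cos x * (speed₁ f φ p + speed₁ f φ (u x)))
      (Real.continuous_cos.mul (continuous_const.add hs₁)) (fun χ hχ hχc hχs => by
        obtain ⟨a, ha, ha0, hda0, hJ, hs⟩ := key 0 χ hχ hχc hχs
        have hJ0 := congrFun hJ 0
        have e₁ : transFlux u a = fun x => r / 2 * (Real.cos x * χ x) := by
          ext x; simp [transFlux, ha, hdu]; ring
        have e₂ : speedFlux f φ u a = fun x => r / 2 * (speed₁ f φ (u x) * Real.cos x * χ x) := by
          ext x; simp [speedFlux, ha, hdu]; ring
        rw [chaplyginOperator_apply_zero, ha0, hda0, e₁, e₂, invD_const_mul, invD_const_mul,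
          invD_zero_of_support, invD_zero_of_support, hdu, hu0] at hJ0
        · have hi₁ : Integrable fun x => Real.cos x * χ x :=
            (Real.continuous_cos.mul hχ.continuous).integrable_of_hasCompactSupport hχc.mul_left
          have hi₂ : Integrable fun x => speed₁ f φ (u x) * Real.cos x * χ x :=
            ((hs₁.mul Real.continuous_cos).mul hχ.continuous).integrable_of_hasCompactSupport
              hχc.mul_left
          rw [show (fun x => χ x * (Real.cos x * (speed₁ f φ p + speed₁ f φ (u x)))) = fun x =>
            speed₁ f φ p * (Real.cos x * χ x) + speed₁ f φ (u x) * Real.cos x * χ x by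
              ext x; ring, integral_add (hi₁.const_mul _) hi₂, integral_const_mul]
          simp only [Pi.zero_apply, Real.cos_zero, mul_zero, zero_add, mul_one] at hJ0
          have : (r / 2) ^ 2 * (-(1 / 2)) * (speed₁ f φ p * (∫ x, Real.cos x * χ x) +
              ∫ x, speed₁ f φ (u x) * Real.cos x * χ x) = 0 := by linear_combination hJ0
          exact (mul_eq_zero.1 this).resolve_left (by simp [hε])
        · exact (Function.support_mul_subset_right _ _).trans hs
        · exact (Function.support_mul_subset_right _ _).trans hs) Real.two_pi_pos
    -- At x = 2π the cosine is 1 and u = p, so the two speeds add instead of cancelling.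
    simp only [Real.cos_two_pi, hu2] at hz
    linarith
  · have hz := eq_zero_of_integral_test_eq_zero
      (g := fun x => Real.cos x * (speed₂ f φ p + speed₂ f φ (u x)))
      (Real.continuous_cos.mul (continuous_const.add hs₂)) (fun χ hχ hχc hχs => by
        obtain ⟨a, ha, ha0, hda0, hJ, hs⟩ := key 1 χ hχ hχc hχs
        have hJ0 := congrFun hJ 1
        have e₁ : transFlux u a = fun x => r / 2 * (Real.cos x * χ x) := by
          ext x; simp [transFlux, ha, hdu]; ring
        have e₂ : speedFlux f φ u a = fun x => r / 2 * (speed₂ f φ (u x) * Real.cos x * χ x) := by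
          ext x; simp [speedFlux, ha, hdu]; ring
        rw [chaplyginOperator_apply_one, ha0, hda0, e₁, e₂, invD_const_mul, invD_const_mul,
          invD_zero_of_support, invD_zero_of_support, hdu 0 1, hu0] at hJ0
        · have hi₁ : Integrable fun x => Real.cos x * χ x :=
            (Real.continuous_cos.mul hχ.continuous).integrable_of_hasCompactSupport hχc.mul_left
          have hi₂ : Integrable fun x => speed₂ f φ (u x) * Real.cos x * χ x :=
            ((hs₂.mul Real.continuous_cos).mul hχ.continuous).integrable_of_hasCompactSupport
              hχc.mul_left
          rw [show (fun x => χ x * (Real.cos x * (speed₂ f φ p + speed₂ f φ (u x)))) = fun x =>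
            speed₂ f φ p * (Real.cos x * χ x) + speed₂ f φ (u x) * Real.cos x * χ x by
              ext x; ring, integral_add (hi₁.const_mul _) hi₂, integral_const_mul]
          simp only [Pi.zero_apply, Real.cos_zero, mul_zero, zero_add, mul_one, sub_zero] at hJ0
          have : (r / 2) ^ 2 * (-(1 / 2)) * (speed₂ f φ p * (∫ x, Real.cos x * χ x) +
              ∫ x, speed₂ f φ (u x) * Real.cos x * χ x) = 0 := by linear_combination hJ0
          exact (mul_eq_zero.1 this).resolve_left (by simp [hε])
        · exact (Function.support_mul_subset_right _ _).trans hs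
        · exact (Function.support_mul_subset_right _ _).trans hs) Real.two_pi_pos
    simp only [Real.cos_two_pi, hu2] at hz
    linarith

/-- Each of the two nonlocal terms contains the speeds once, either outside or inside the
antiderivative, so both disappear. -/
theorem isLocalOperator_of_speeds_eq_zero
    (h : ∀ p ∈ offDiagonal U V, speed₁ f φ p = 0 ∧ speed₂ f φ p = 0) :
    IsLocalOperator (offDiagonal U V) (chaplyginOperator f φ).toFieldOperator := by
  intro u a x hu _ h0
  have hq : speedFlux f φ u a = fun y => 0 * (0 : ℝ) := by
    ext y; simp [speedFlux, h _ (hu.2 y)]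
  have ha := h0.eq_of_nhds
  have hda : deriv a x = 0 := by rw [h0.deriv_eq]; simp
  ext i
  fin_cases i <;>
  simp [chaplyginOperator_apply_zero, chaplyginOperator_apply_one, ha, hda, h _ (hu.2 x), hq, invD]

theorem isLocalOperator_iff (hU : IsOpen U) (hV : IsOpen V)
    (hf : ContDiffOn ℝ ∞ f U) (hφ : ContDiffOn ℝ ∞ φ V) :
    IsLocalOperator (offDiagonal U V) (chaplyginOperator f φ).toFieldOperator ↔
      ∀ p ∈ offDiagonal U V, speed₁ f φ p = 0 ∧ speed₂ f φ p = 0 :=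
  ⟨fun h _ hp => speeds_eq_zero_of_isLocalOperator hU hV hf hφ h hp,
    isLocalOperator_of_speeds_eq_zero⟩

end Locality

/-! ### Distinct operators and nonlocal examples -/

section Distinct

variable {U V : Set ℝ}

theorem exists_mem_ne_of_isOpen {V : Set ℝ} (hV : IsOpen V) (hV₀ : V.Nonempty) (t : ℝ) :
    ∃ s ∈ V, t ≠ s := by
  obtain ⟨s, hs, hst⟩ := (infinite_of_mem_nhds _ (hV.mem_nhds hV₀.some_mem)).exists_notMem_finset {t}
  exact ⟨s, hs, fun h => hst (by simp [h])⟩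

/-- On a constant field the operator reduces to its leading term. -/
theorem lead_eq_of_sameOperatorOn {f₁ φ₁ f₂ φ₂ : ℝ → ℝ}
    (h : SameOperatorOn (offDiagonal U V) (chaplyginOperator f₁ φ₁).toFieldOperator
      (chaplyginOperator f₂ φ₂).toFieldOperator) {p : Fin 2 → ℝ} (hp : p ∈ offDiagonal U V) :
    f₁ (p 0) = f₂ (p 0) ∧ φ₁ (p 1) = φ₂ (p 1) := by
  let χ : ContDiffBump (0 : ℝ) := default
  -- A bump function equals 1 at its centre and 0 at the outer radius, so its derivative is nonzero
  -- somewhere; there the leading coefficient can be read off.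
  obtain ⟨x, hx⟩ : ∃ x, deriv χ x ≠ 0 := by
    by_contra! hz
    have hc := is_const_of_deriv_eq_zero (χ.contDiff (n := ⊤).differentiable (by simp)) hz 0 χ.rOut
    rw [χ.one_of_mem_closedBall (Metric.mem_closedBall_self χ.rIn_pos.le),
      χ.zero_of_le_dist (by simp [le_abs_self])] at hc
    exact one_ne_zero hc
  set a : ℝ → Fin 2 → ℝ := fun x _ => χ x with ha_def
  have ha : IsTestCovector a := by
    refine ⟨contDiff_pi.2 fun _ => χ.contDiff, HasCompactSupport.intro χ.hasCompactSupport.isCompact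
      fun x hx => ?_⟩
    ext j; simp [ha_def, image_eq_zero_of_notMem_tsupport hx]
  have hda : ∀ i, deriv a x i = deriv χ x := fun i =>
    (ha.1.hasDerivAt_coord i x).unique ((χ.contDiff (n := ⊤)).hasDerivAt_deriv x)
  have e := congrFun (h (fun _ => p) a ⟨contDiff_const, fun _ => hp⟩ ha) x
  have hd : (p 0 - p 1) ^ 2 ≠ 0 := pow_ne_zero 2 (sub_ne_zero.2 hp.2.2)
  constructor
  · have e₀ := congrFun e 0
    simpa [chaplyginOperator_apply_zero, hda, hd, hx] using e₀
  · have e₁ := congrFun e 1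
    simpa [chaplyginOperator_apply_one, hda, hd, hx] using e₁

theorem eqOn_of_sameOperatorOn (hU : IsOpen U) (hV : IsOpen V) (hU₀ : U.Nonempty)
    (hV₀ : V.Nonempty) {f₁ φ₁ f₂ φ₂ : ℝ → ℝ}
    (h : SameOperatorOn (offDiagonal U V) (chaplyginOperator f₁ φ₁).toFieldOperator
      (chaplyginOperator f₂ φ₂).toFieldOperator) : Set.EqOn f₁ f₂ U ∧ Set.EqOn φ₁ φ₂ V := by
  refine ⟨fun t ht => ?_, fun t ht => ?_⟩
  · obtain ⟨s, hs, hst⟩ := exists_mem_ne_of_isOpen hV hV₀ t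
    exact (lead_eq_of_sameOperatorOn h (p := ![t, s]) ⟨ht, hs, hst⟩).1
  · obtain ⟨s, hs, hst⟩ := exists_mem_ne_of_isOpen hU hU₀ t
    exact (lead_eq_of_sameOperatorOn h (p := ![s, t]) ⟨hs, ht, hst.symm⟩).2

theorem exists_infinitely_many_nonlocal (hU : IsOpen U) (hV : IsOpen V) (hU₀ : U.Nonempty)
    (hV₀ : V.Nonempty) : ∃ f φ : ℕ → ℝ → ℝ,
      (∀ k, Admissible U (f k) ∧ Admissible V (φ k) ∧
        ¬ IsLocalOperator (offDiagonal U V) (chaplyginOperator (f k) (φ k)).toFieldOperator) ∧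
      ∀ k l, k ≠ l → ¬ SameOperatorOn (offDiagonal U V)
        (chaplyginOperator (f k) (φ k)).toFieldOperator
        (chaplyginOperator (f l) (φ l)).toFieldOperator := by
  -- Constant parameters f = k + 1 and φ = 1 give w¹ = -(k + 2)/2 ≠ 0.
  refine ⟨fun k _ => k + 1, fun _ _ => 1, fun k => ⟨⟨contDiffOn_const, fun t _ => by positivity⟩,
    ⟨contDiffOn_const, fun t _ => one_ne_zero⟩, fun h => ?_⟩, fun k l hkl h => ?_⟩
  · obtain ⟨t, ht⟩ := hU₀
    obtain ⟨s, hs, hst⟩ := exists_mem_ne_of_isOpen hV hV₀ t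
    have := (speeds_eq_zero_of_isLocalOperator hU hV contDiffOn_const contDiffOn_const h
      (p := ![t, s]) ⟨ht, hs, hst⟩).1
    simp only [speed₁, deriv_const] at this
    have hk : (0 : ℝ) ≤ k := k.cast_nonneg
    linarith
  · obtain ⟨t, ht⟩ := hU₀
    have := (eqOn_of_sameOperatorOn hU hV ⟨t, ht⟩ hV₀ h).1 ht
    simp only [add_left_inj, Nat.cast_inj] at this
    exact hkl this

end Distinct

/-! ### The general commuting flow -/

section GeneralFlow

/-- A field must stay in Ω on the whole line, so a quadratic polynomial will not do. The functions
sin(Nx)/N and (1 - cos Nx)/N² have the same 2-jets at 0 as x and x²/2, and are as small as desired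
for large N. -/
theorem exists_isSmoothField_jet {n : ℕ} {Ω : Set (Fin n → ℝ)} (hΩ : IsOpen Ω) {p : Fin n → ℝ}
    (hp : p ∈ Ω) (ξ η : Fin n → ℝ) :
    ∃ u, IsSmoothField Ω u ∧ u 0 = p ∧ deriv u 0 = ξ ∧ deriv (deriv u) 0 = η := by
  obtain ⟨r, hr, hball⟩ := Metric.isOpen_iff.1 hΩ p hp
  -- The displacement is at most (‖ξ‖ + 2‖η‖)/N, using N ≤ N² and |1 - cos| ≤ 2; this N makes it
  -- smaller than r.
  set N : ℝ := 1 + (‖ξ‖ + 2 * ‖η‖) / r with hN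
  have hN1 : 1 ≤ N := le_add_of_nonneg_right (by positivity)
  have hN0 : N ≠ 0 := by positivity
  have hNr : (‖ξ‖ + 2 * ‖η‖) / N < r := by
    rw [div_lt_iff₀ (by positivity), hN]
    field_simp
    linarith
  set u : ℝ → Fin n → ℝ := fun x =>
    p + ((Real.sin (N * x) / N) • ξ + ((1 - Real.cos (N * x)) / N ^ 2) • η) with hu
  have hlin : ∀ x, HasDerivAt (fun x => N * x) N x := fun x => by
    simpa using (hasDerivAt_id x).const_mul N
  have hsin : ∀ x, HasDerivAt (fun x => Real.sin (N * x)) (N * Real.cos (N * x)) x := fun x =>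
    (((Real.hasDerivAt_sin _).comp x (hlin x))).congr_deriv (mul_comm _ _)
  have hcos : ∀ x, HasDerivAt (fun x => Real.cos (N * x)) (-(N * Real.sin (N * x))) x := fun x =>
    (((Real.hasDerivAt_cos _).comp x (hlin x))).congr_deriv (by ring)
  have hd : ∀ x, HasDerivAt u (Real.cos (N * x) • ξ + (Real.sin (N * x) / N) • η) x := fun x => by
    refine ((((hsin x).div_const N).smul_const ξ).add
      ((((hcos x).const_sub 1).div_const (N ^ 2)).smul_const η)).const_add p |>.congr_deriv ?_
    congr 2 <;> field_simp
  have hd2 : ∀ x, HasDerivAt (deriv u) (-(N * Real.sin (N * x)) • ξ + Real.cos (N * x) • η) x := by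
    intro x
    rw [funext fun x => (hd x).deriv]
    refine (((hcos x).smul_const ξ).add (((hsin x).div_const N).smul_const η)).congr_deriv ?_
    congr 2
    field_simp
  refine ⟨u, ⟨?_, fun x => hball ?_⟩, by simp [hu], by simp [(hd 0).deriv],
    by simp [(hd2 0).deriv]⟩
  · have h₁ : ContDiff ℝ ∞ fun x => Real.sin (N * x) :=
      Real.contDiff_sin.comp (contDiff_const.mul contDiff_id)
    have h₂ : ContDiff ℝ ∞ fun x => Real.cos (N * x) :=
      Real.contDiff_cos.comp (contDiff_const.mul contDiff_id)
    exact contDiff_const.add (((h₁.div_const N).smul contDiff_const).add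
      (((contDiff_const.sub h₂).div_const (N ^ 2)).smul contDiff_const))
  · have hNpos : 0 < N := by positivity
    have h₁ : ‖(Real.sin (N * x) / N) • ξ‖ ≤ ‖ξ‖ / N := by
      rw [norm_smul, norm_div, Real.norm_eq_abs, Real.norm_of_nonneg hNpos.le, div_mul_eq_mul_div]
      gcongr
      exact mul_le_of_le_one_left (norm_nonneg _) (Real.abs_sin_le_one _)
    have h₂ : ‖((1 - Real.cos (N * x)) / N ^ 2) • η‖ ≤ 2 * ‖η‖ / N := by
      rw [norm_smul, norm_div, Real.norm_eq_abs, Real.norm_of_nonneg (by positivity),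
        div_mul_eq_mul_div]
      have hc : |1 - Real.cos (N * x)| ≤ 2 := by
        rw [abs_le]; constructor <;> linarith [Real.neg_one_le_cos (N * x), Real.cos_le_one (N * x)]
      have hNN : N ≤ N ^ 2 := by nlinarith
      gcongr
    rw [mem_ball_iff_norm, hu]
    simp only [add_sub_cancel_left]
    calc _ ≤ ‖ξ‖ / N + 2 * ‖η‖ / N := (norm_add_le _ _).trans (add_le_add h₁ h₂)
      _ = (‖ξ‖ + 2 * ‖η‖) / N := by ring
      _ < r := hNr

variable {U V : Set ℝ} {W : (Fin 2 → ℝ) → Matrix (Fin 2) (Fin 2) ℝ}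

/-- The commutativity equations: the matrix `W` is diagonal and its eigenvalues satisfy
`∂w¹/∂v = ∂w²/∂u = (w² - w¹) / (u - v)`. -/
theorem commutativity_equations (hU : IsOpen U) (hV : IsOpen V)
    (hW : ∀ i j, ContDiffOn ℝ ∞ (fun p => W p i j) (offDiagonal U V))
    (hc : FlowsCommute (offDiagonal U V) chaplyginMatrix W) :
    (∀ p ∈ offDiagonal U V, W p 0 1 = 0 ∧ W p 1 0 = 0) ∧ ∀ p ∈ offDiagonal U V,
      (p 0 - p 1) * pderiv 1 (fun q => W q 0 0) p = W p 1 1 - W p 0 0 ∧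
      (p 0 - p 1) * pderiv 0 (fun q => W q 1 1) p = W p 1 1 - W p 0 0 := by
  have hΩ := isOpen_offDiagonal hU hV
  rw [flowsCommute_iff hΩ (fun i j => contDiffOn_chaplyginMatrix i j _) hW] at hc
  have key : ∀ p ∈ offDiagonal U V, ∀ ξ η : Fin 2 → ℝ,
      flowVariation chaplyginMatrix W p ξ η = flowVariation W chaplyginMatrix p ξ η := by
    intro p hp ξ η
    obtain ⟨u, hu, h0, h1, h2⟩ := exists_isSmoothField_jet hΩ hp ξ η
    have := hc u hu 0
    rwa [h0, h1, h2] at this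
  -- With uₓ = 0 only the uₓₓ terms remain, and they say that W commutes with diag(v, u). Since u ≠
  -- v on Ω, the off-diagonal entries vanish.
  have hdiag : ∀ p ∈ offDiagonal U V, W p 0 1 = 0 ∧ W p 1 0 = 0 := by
    intro p hp
    have hne := sub_ne_zero.2 hp.2.2
    constructor
    · have := congrFun (key p hp 0 (Pi.single 1 1)) 0
      simp [flowVariation, Fin.sum_univ_two, chaplyginMatrix] at this
      refine (mul_eq_zero.1 (?_ : (p 0 - p 1) * W p 0 1 = 0)).resolve_left hne
      linear_combination -this
    · have := congrFun (key p hp 0 (Pi.single 0 1)) 1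
      simp [flowVariation, Fin.sum_univ_two, chaplyginMatrix] at this
      refine (mul_eq_zero.1 (?_ : (p 0 - p 1) * W p 1 0 = 0)).resolve_left hne
      linear_combination this
  refine ⟨hdiag, fun p hp => ?_⟩
  have hz₀ : (fun q => W q 0 1) =ᶠ[𝓝 p] fun _ => 0 := by
    filter_upwards [hΩ.mem_nhds hp] with q hq using (hdiag q hq).1
  have hz₁ : (fun q => W q 1 0) =ᶠ[𝓝 p] fun _ => 0 := by
    filter_upwards [hΩ.mem_nhds hp] with q hq using (hdiag q hq).2
  have hd₀ : ∀ i, pderiv i (fun q => W q 0 1) p = 0 := fun i => by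
    rw [pderiv, hz₀.fderiv_eq]; simp
  have hd₁ : ∀ i, pderiv i (fun q => W q 1 0) p = 0 := fun i => by
    rw [pderiv, hz₁.fderiv_eq]; simp
  -- With W diagonal, the terms quadratic in uₓ reduce to the product uₓ vₓ, so the single jet uₓ =
  -- vₓ = 1, uₓₓ = vₓₓ = 0 captures both equations.
  have h₀ := congrFun (key p hp (fun _ => 1) 0) 0
  have h₁ := congrFun (key p hp (fun _ => 1) 0) 1
  simp [flowVariation, Fin.sum_univ_two, chaplyginMatrix, hd₀, hd₁, hdiag p hp, fderiv_eq_pderiv,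
    pderiv_coord, pderiv_const, dotProduct] at h₀ h₁
  constructor
  · linear_combination -h₀
  · linear_combination h₁

theorem eq_of_hasDerivAt_zero {s : Set ℝ} (hs : IsOpen s) (hs' : s.OrdConnected) {g : ℝ → ℝ}
    (hg : ∀ t ∈ s, HasDerivAt g 0 t) {x y : ℝ} (hx : x ∈ s) (hy : y ∈ s) : g x = g y :=
  hs.is_const_of_deriv_eq_zero hs'.isPreconnected
    (fun t ht => (hg t ht).differentiableAt.differentiableWithinAt) (fun t ht => (hg t ht).deriv)
    hx hy

theorem pderiv_comm {h : (Fin 2 → ℝ) → ℝ} {s : Set (Fin 2 → ℝ)} (hs : IsOpen s)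
    (hh : ContDiffOn ℝ ∞ h s) {p : Fin 2 → ℝ} (hp : p ∈ s) (i j : Fin 2) :
    pderiv i (pderiv j h) p = pderiv j (pderiv i h) p := by
  have hd : DifferentiableAt ℝ (fderiv ℝ h) p :=
    (((hh.contDiffAt (hs.mem_nhds hp)).fderiv_right (m := ∞) (by simp)).differentiableAt (by simp))
  have e : ∀ i j : Fin 2, pderiv i (pderiv j h) p =
      fderiv ℝ (fderiv ℝ h) p (Pi.single i 1) (Pi.single j 1) := fun i j => by
    have := (hd.hasFDerivAt.clm_apply (hasFDerivAt_const (Pi.single j (1 : ℝ)) p)).fderiv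
    change fderiv ℝ (fun q => fderiv ℝ h q (Pi.single j 1)) p (Pi.single i 1) = _
    rw [this]
    simp
  rw [e, e]
  exact (hh.contDiffAt (hs.mem_nhds hp)).isSymmSndFDerivAt
    (by rw [minSmoothness_of_isRCLikeNormedField]; exact ENat.LEInfty.out) _ _

theorem contDiffOn_pderiv {h : (Fin 2 → ℝ) → ℝ} {s : Set (Fin 2 → ℝ)} (hs : IsOpen s)
    (hh : ContDiffOn ℝ ∞ h s) (i : Fin 2) : ContDiffOn ℝ ∞ (pderiv i h) s :=
  (hh.fderiv_of_isOpen hs (m := ∞) (by simp)).clm_apply contDiffOn_const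

/-- On a product of disjoint intervals the solutions of the commutativity equations are the
speeds `w¹`, `w²`. -/
theorem exists_speeds_of_commutativity_equations (hU : IsOpen U) (hV : IsOpen V)
    (hU' : U.OrdConnected) (hV' : V.OrdConnected) (hU₀ : U.Nonempty) (hV₀ : V.Nonempty)
    (hUV : Disjoint U V) {w₁ w₂ : (Fin 2 → ℝ) → ℝ}
    (hw₁ : ContDiffOn ℝ ∞ w₁ (offDiagonal U V)) (hw₂ : ContDiffOn ℝ ∞ w₂ (offDiagonal U V))
    (h₁ : ∀ p ∈ offDiagonal U V, (p 0 - p 1) * pderiv 1 w₁ p = w₂ p - w₁ p)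
    (h₂ : ∀ p ∈ offDiagonal U V, (p 0 - p 1) * pderiv 0 w₂ p = w₂ p - w₁ p) :
    ∃ f φ : ℝ → ℝ, ContDiffOn ℝ ∞ f U ∧ ContDiffOn ℝ ∞ φ V ∧
      ∀ p ∈ offDiagonal U V, w₁ p = speed₁ f φ p ∧ w₂ p = speed₂ f φ p := by
  have hΩ := isOpen_offDiagonal hU hV
  obtain ⟨u₀, hu₀⟩ := hU₀
  obtain ⟨v₀, hv₀⟩ := hV₀
  -- Disjointness makes Ω the full rectangle U × V, so a function with zero derivative along a
  -- coordinate line is constant on it.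
  have hmem : ∀ {x y}, x ∈ U → y ∈ V → ![x, y] ∈ offDiagonal U V := fun {x y} hx hy =>
    ⟨hx, hy, fun h => Set.disjoint_left.1 hUV hx ((show x = y from h) ▸ hy)⟩
  have hne : ∀ {x y}, x ∈ U → y ∈ V → x - y ≠ 0 := fun hx hy => sub_ne_zero.2 (hmem hx hy).2.2
  have dx : ∀ {h : (Fin 2 → ℝ) → ℝ}, ContDiffOn ℝ ∞ h (offDiagonal U V) → ∀ {x y}, x ∈ U → y ∈ V →
      HasDerivAt (fun t => h ![t, y]) (pderiv 0 h ![x, y]) x := fun hh x y hx hy =>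
    hasDerivAt_pderiv_zero (hh.differentiableAt_of_isOpen hΩ (hmem hx hy))
  have dy : ∀ {h : (Fin 2 → ℝ) → ℝ}, ContDiffOn ℝ ∞ h (offDiagonal U V) → ∀ {x y}, x ∈ U → y ∈ V →
      HasDerivAt (fun t => h ![x, t]) (pderiv 1 h ![x, y]) y := fun hh x y hx hy =>
    hasDerivAt_pderiv_one (hh.differentiableAt_of_isOpen hΩ (hmem hx hy))
  -- `m` is the common value of `-∂w₁/∂v` and `-∂w₂/∂u`
  set m : ℝ → ℝ → ℝ := fun x y => (w₁ ![x, y] - w₂ ![x, y]) / (x - y) with hm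
  have e₁ : ∀ {x y}, x ∈ U → y ∈ V → pderiv 1 w₁ ![x, y] = -m x y := fun {x y} hx hy => by
    have := h₁ _ (hmem hx hy)
    simp only [Matrix.cons_val_zero, Matrix.cons_val_one, Matrix.cons_val_fin_one] at this
    rw [hm]
    have := hne hx hy
    field_simp
    linarith
  have e₂ : ∀ {x y}, x ∈ U → y ∈ V → pderiv 0 w₂ ![x, y] = -m x y := fun {x y} hx hy => by
    have := h₂ _ (hmem hx hy)
    simp only [Matrix.cons_val_zero, Matrix.cons_val_one, Matrix.cons_val_fin_one] at this
    rw [hm]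
    have := hne hx hy
    field_simp
    linarith
  -- This is -∂m/∂v. That it does not depend on u means ∂²m/∂u∂v = 0.
  set k : ℝ → ℝ → ℝ := fun x y => pderiv 1 w₂ ![x, y] / (x - y) with hk
  have my : ∀ {x y}, x ∈ U → y ∈ V → HasDerivAt (fun t => m x t) (-k x y) y := fun {x y} hx hy => by
    have hxy := hne hx hy
    refine (((dy hw₁ hx hy).sub (dy hw₂ hx hy)).fun_div ((hasDerivAt_id y).const_sub x)
      hxy).congr_deriv ?_
    rw [e₁ hx hy]
    simp only [hm, hk, Pi.sub_apply, id]
    field_simp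
    ring
  have kconst : ∀ {x y}, x ∈ U → y ∈ V → k x y = k u₀ y := fun {x y} hx hy => by
    refine eq_of_hasDerivAt_zero hU hU' (g := fun t => k t y) (fun t ht => ?_) hx hu₀
    have hty := hne ht hy
    -- Symmetry of second derivatives: ∂ᵤ∂ᵥw₂ = ∂ᵥ∂ᵤw₂ = -∂ᵥm = k. The quotient rule then gives ∂ᵤk
    -- = k/(u - v) - k/(u - v) = 0.
    have hsymm : pderiv 0 (pderiv 1 w₂) ![t, y] = k t y := by
      rw [pderiv_comm hΩ hw₂ (hmem ht hy)]
      have := (dy (contDiffOn_pderiv hΩ hw₂ 0) ht hy).congr_of_eventuallyEq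
        (f₁ := fun s => -m t s) (by
          filter_upwards [hV.mem_nhds hy] with s hs using (e₂ ht hs).symm)
      exact (this.unique (my ht hy).fun_neg).trans (neg_neg _)
    refine ((dx (contDiffOn_pderiv hΩ hw₂ 1) ht hy).fun_div ((hasDerivAt_id t).sub_const y)
      hty).congr_deriv ?_
    rw [hsymm]
    simp only [hk, id]
    field_simp
    ring
  have msplit : ∀ {x y}, x ∈ U → y ∈ V → m x y = m x v₀ + m u₀ y - m u₀ v₀ := fun {x y} hx hy => by
    have := eq_of_hasDerivAt_zero hV hV' (g := fun t => m x t - m u₀ t) (fun t ht =>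
      ((my hx ht).fun_sub (my hu₀ ht)).congr_deriv (by rw [kconst hx ht]; ring)) hy hv₀
    linarith
  -- Adding αu + c to f and -αv - c to φ leaves the speeds unchanged. The choice here normalizes
  -- φ(v₀) = φ'(v₀) = 0, so that w² = -f/2 on the line v = v₀; the formula for φ then solves the
  -- expression for w¹ on the line u = u₀.
  set f : ℝ → ℝ := fun x => -2 * w₂ ![x, v₀] with hf
  set φ : ℝ → ℝ := fun y => -2 * w₁ ![u₀, y] + 2 * (u₀ - y) * m u₀ v₀ + 2 * w₂ ![u₀, v₀] with hφ
  have hvec₀ : ContDiff ℝ ∞ fun x : ℝ => (![x, v₀] : Fin 2 → ℝ) :=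
    contDiff_pi.2 (Fin.forall_fin_two.2 ⟨contDiff_id, contDiff_const⟩)
  have hvec₁ : ContDiff ℝ ∞ fun y : ℝ => (![u₀, y] : Fin 2 → ℝ) :=
    contDiff_pi.2 (Fin.forall_fin_two.2 ⟨contDiff_const, contDiff_id⟩)
  have hfC : ContDiffOn ℝ ∞ f U :=
    contDiffOn_const.mul (hw₂.comp hvec₀.contDiffOn fun x hx => hmem hx hv₀)
  have hφC : ContDiffOn ℝ ∞ φ V :=
    ((contDiffOn_const.mul (hw₁.comp hvec₁.contDiffOn fun y hy => hmem hu₀ hy)).add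
      ((contDiffOn_const.mul (contDiffOn_const.sub contDiffOn_id)).mul contDiffOn_const)).add
      contDiffOn_const
  have hf' : ∀ {x}, x ∈ U → HasDerivAt f (2 * m x v₀) x := fun {x} hx => by
    refine ((dx hw₂ hx hv₀).const_mul (-2)).congr_deriv ?_
    rw [e₂ hx hv₀]; ring
  have hφ' : ∀ {y}, y ∈ V → HasDerivAt φ (2 * m u₀ y - 2 * m u₀ v₀) y := fun {y} hy => by
    refine ((((dy hw₁ hu₀ hy).const_mul (-2)).add
      ((((hasDerivAt_id y).const_sub u₀).const_mul 2).mul_const (m u₀ v₀))).add_const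
      (2 * w₂ ![u₀, v₀])).congr_deriv ?_
    rw [e₁ hu₀ hy]; ring
  have hφ0 : φ v₀ = 0 := by
    have := hne hu₀ hv₀
    simp only [hφ, hm]
    field_simp
    ring
  have hm' : ∀ {x y}, x ∈ U → y ∈ V → w₁ ![x, y] - w₂ ![x, y] = (x - y) * m x y :=
    fun {x y} hx hy => by rw [hm]; have := hne hx hy; field_simp
  refine ⟨f, φ, hfC, hφC, fun p hp => ?_⟩
  obtain ⟨hx, hy, -⟩ := hp
  have hw : ∀ {x y}, x ∈ U → y ∈ V →
      w₁ ![x, y] = (1 / 2) * ((x - y) * (2 * m x v₀) - f x - φ y) := fun {x y} hx hy => by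
    -- Both sides have the same v-derivative by the splitting of m, and they agree at v = v₀ by the
    -- normalization.
    have := eq_of_hasDerivAt_zero hV hV' (g := fun t => w₁ ![x, t] -
      (1 / 2) * ((x - t) * (2 * m x v₀) - f x - φ t)) (fun t ht => ?_) hy hv₀
    · simp only [hφ0] at this
      have h0 := hm' hx hv₀
      have hfx : f x = -2 * w₂ ![x, v₀] := rfl
      rw [hfx] at this ⊢
      linarith
    · refine ((dy hw₁ hx ht).fun_sub ((((((hasDerivAt_id t).const_sub x).mul_const
        (2 * m x v₀)).sub_const (f x)).fun_sub (hφ' ht)).const_mul (1 / 2))).congr_deriv ?_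
      rw [e₁ hx ht, msplit hx ht]
      ring
  rw [← vec_eta p]
  simp only [speed₁, speed₂, Matrix.cons_val_zero, Matrix.cons_val_one, Matrix.cons_val_fin_one,
    (hf' hx).deriv, (hφ' hy).deriv]
  refine ⟨hw hx hy, ?_⟩
  have h0 := hm' hx hy
  rw [msplit hx hy, hw hx hy] at h0
  linarith

theorem exists_speedMatrix_of_flowsCommute (hU : IsOpen U) (hV : IsOpen V)
    (hU' : U.OrdConnected) (hV' : V.OrdConnected) (hU₀ : U.Nonempty) (hV₀ : V.Nonempty)
    (hUV : Disjoint U V) (hW : ∀ i j, ContDiffOn ℝ ∞ (fun p => W p i j) (offDiagonal U V))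
    (hc : FlowsCommute (offDiagonal U V) chaplyginMatrix W) :
    ∃ f φ : ℝ → ℝ, ContDiffOn ℝ ∞ f U ∧ ContDiffOn ℝ ∞ φ V ∧
      ∀ p ∈ offDiagonal U V, W p = speedMatrix f φ p := by
  obtain ⟨hdiag, heq⟩ := commutativity_equations hU hV hW hc
  obtain ⟨f, φ, hf, hφ, h⟩ := exists_speeds_of_commutativity_equations hU hV hU' hV' hU₀ hV₀ hUV
    (hW 0 0) (hW 1 1) (fun p hp => (heq p hp).1) (fun p hp => (heq p hp).2)
  refine ⟨f, φ, hf, hφ, fun p hp => ?_⟩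
  ext i j
  fin_cases i <;> fin_cases j <;> simp [speedMatrix, hdiag p hp, h p hp]

end GeneralFlow

theorem mainTheorem5 (U V : Set ℝ) (hU : IsOpen U) (hV : IsOpen V)
    (hU' : U.OrdConnected) (hV' : V.OrdConnected) (hU₀ : U.Nonempty) (hV₀ : V.Nonempty) :
    -- each pair `f`, `φ` gives a nonlocal Hamiltonian structure of the system
    (∀ f φ : ℝ → ℝ, Admissible U f → Admissible V φ →
      LocalPartOfMetric (offDiagonal U V) (chaplyginOperator f φ) (chaplyginMetric f φ) ∧
      IsHamiltonianOperator (offDiagonal U V) (chaplyginOperator f φ).toFieldOperator ∧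
      FlowsCommute (offDiagonal U V) chaplyginMatrix (speedMatrix f φ) ∧
      (∀ F Φ : ℝ → ℝ, IsRootPrimitive U f F → IsRootPrimitive V φ Φ →
        IsHamiltonianSystem (offDiagonal U V) (chaplyginOperator f φ)
          (chaplyginDensity f φ F Φ) chaplyginMatrix) ∧
      (IsLocalOperator (offDiagonal U V) (chaplyginOperator f φ).toFieldOperator ↔
        ∀ p ∈ offDiagonal U V, speed₁ f φ p = 0 ∧ speed₂ f φ p = 0)) ∧
    -- all these structures are mutually compatible
    (∀ f₁ φ₁ f₂ φ₂ : ℝ → ℝ, Admissible U f₁ → Admissible V φ₁ →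
      Admissible U f₂ → Admissible V φ₂ →
      Compatible (offDiagonal U V) (chaplyginOperator f₁ φ₁).toFieldOperator
        (chaplyginOperator f₂ φ₂).toFieldOperator) ∧
    -- different pairs of functions give different operators
    (∀ f₁ φ₁ f₂ φ₂ : ℝ → ℝ, Admissible U f₁ → Admissible V φ₁ →
      Admissible U f₂ → Admissible V φ₂ →
      SameOperatorOn (offDiagonal U V) (chaplyginOperator f₁ φ₁).toFieldOperator
        (chaplyginOperator f₂ φ₂).toFieldOperator →
      Set.EqOn f₁ f₂ U ∧ Set.EqOn φ₁ φ₂ V) ∧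
    -- infinitely many of the operators are nonlocal
    (∃ f φ : ℕ → ℝ → ℝ,
      (∀ k, Admissible U (f k) ∧ Admissible V (φ k) ∧
        ¬ IsLocalOperator (offDiagonal U V) (chaplyginOperator (f k) (φ k)).toFieldOperator) ∧
      ∀ k l, k ≠ l → ¬ SameOperatorOn (offDiagonal U V)
        (chaplyginOperator (f k) (φ k)).toFieldOperator
        (chaplyginOperator (f l) (φ l)).toFieldOperator) ∧
    -- the speeds `w¹`, `w²` give the general commuting flow of hydrodynamic type
    (Disjoint U V → ∀ W : (Fin 2 → ℝ) → Matrix (Fin 2) (Fin 2) ℝ,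
      (∀ i j, ContDiffOn ℝ ∞ (fun p => W p i j) (offDiagonal U V)) →
      FlowsCommute (offDiagonal U V) chaplyginMatrix W →
      ∃ f φ : ℝ → ℝ, ContDiffOn ℝ ∞ f U ∧ ContDiffOn ℝ ∞ φ V ∧
        ∀ p ∈ offDiagonal U V, W p = speedMatrix f φ p) := by
  refine ⟨fun f φ hf hφ => ⟨localPartOfMetric_chaplygin hU hV hf hφ, ?_,
    flowsCommute_chaplygin hU hV hf.1 hφ.1,
    fun F Φ hF hΦ => isHamiltonianSystem_chaplygin hU hV hU' hV' hf hφ hF hΦ,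
    isLocalOperator_iff hU hV hf.1 hφ.1⟩,
    fun f₁ φ₁ f₂ φ₂ hf₁ hφ₁ hf₂ hφ₂ c₁ c₂ =>
      isHamiltonianOperator_linear_combination hU hV hf₁.1 hφ₁.1 hf₂.1 hφ₂.1 c₁ c₂,
    fun f₁ φ₁ f₂ φ₂ _ _ _ _ h => eqOn_of_sameOperatorOn hU hV hU₀ hV₀ h,
    exists_infinitely_many_nonlocal hU hV hU₀ hV₀,
    fun hUV W hW hc => exists_speedMatrix_of_flowsCommute hU hV hU' hV' hU₀ hV₀ hUV hW hc⟩
  -- A single operator is the combination with coefficients 1 and 0.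
  simpa using isHamiltonianOperator_linear_combination hU hV hf.1 hφ.1 hf.1 hφ.1 1 0
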